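/- **Theorem.** *Plant.* Let $A_p\in\mathbb R^{n_p\times n_p}$, $B_p\in\mathbb R^{n_p\times2}$, $C_p\in\mathbb R^{2\times n_p}$ be a controllable and observable triple and $$\dot x=A_px+B_p\bigl(u_{ad}+f(t,x)\bigr),\qquad x(0)=x_0,\qquad y=C_px,\qquad \|x_0\|_\infty<\rho_0 ,$$ where $f$ is measurable in $t$ and there are $F_\delta$ $(\delta>0)$ and $L_0$ with $\|f(t,x_2)-f(t,x_1)\|_\infty\le F_\delta\|x_2-x_1\|_\infty$ and $\|f(t,0)\|_\infty\le L_0$ for all $t\ge0$, $\|x_i\|_\infty<\delta$. Trajectories are Carathéodory solutions. *Design.* $M(s)=C_m(sI-A_m)^{-1}B_m$ is a $2\times2$ transfer matrix of state dimension $n_m$ with $A_m$ Hurwitz, $C_mB_m$ nonsingular and no transmission zero in $\operatorname{Re}s\ge0$; $K_g=-(C_mA_m^{-1}B_m)^{-1}$ and $C_m^\dagger=C_m^\top(C_mC_m^\top)^{-1}$. The filter $C(s)$ is a $2\times2$ strictly proper stable rational matrix with $C(0)=I$. Let $P_\ell=P_\ell^\top>0$ solve $A_m^\top P_\ell+P_\ell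 A_m=-Q$ with $Q=Q^\top>0$; let $S$ be nonsingular with $P_\ell=S^\top S$; let the rows of $D\in\mathbb R^{(n_m-2)\times n_m}$ be a basis of the null space of $C_mS^{-1}$; put $$\Lambda=\begin{bmatrix}C_m\\DS\end{bmatrix},\qquad E(t)=e^{\Lambda A_m\Lambda^{-1}t},\qquad \Phi(T_s)=\int_0^{T_s}E(T_s-\tau)\Lambda\,d\tau ,\qquad \mathbf 1_{n_m2}=\begin{bmatrix}I_2\\0\end{bmatrix}\in\mathbb R^{n_m\times2}.$$ Let $(A_o,B_o,C_o)$ be a minimal realization of $O(s)=C(s)M^{-1}(s)C_m(sI-A_m)^{-1}$, and let $K$ be such that $A_p-B_pK$ is Hurwitz. *Controller with sampling time $T_s$.* With $y_d[i]=y(iT_s)$, $\omega_c[i]=\omega_c(iT_s)$, $\hat x_d[0]=C_m^\dagger y(0)$, $x_u[0]=0$, $$\hat\sigma_d[i]=-\Phi^{-1}(T_s)E(T_s)\mathbf 1_{n_m2}\bigl(C_m\hat x_d[i]-y_d[i]\bigr),\qquad u_d[i]=K_g\omega_c[i]-C_ox_u[i],$$ $$\hat x_d[i+1]=e^{A_mT_s}\hat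 x_d[i]+A_m^{-1}(e^{A_mT_s}-I)\bigl(B_mu_d[i]+\hat\sigma_d[i]\bigr),$$ $$x_u[i+1]=e^{A_oT_s}x_u[i]+A_o^{-1}(e^{A_oT_s}-I)B_oe^{-A_mT_s}\hat\sigma_d[i],$$ and $u_{ad}(t)=u_d[i]$ for $t\in[iT_s,(i+1)T_s)$. *Commands.* The command $\omega_c:[0,\infty)\to\mathbb R^2$ is measurable, $\|\omega_c(t)\|_\infty\le M_\omega$, and $\|\omega_c(t)-\omega_c(iT_s)\|_\infty\le\eta(T_s)$ for $t\in[iT_s,(i+1)T_s)$, $i\ge0$, where $\eta$ is a given function with $\eta(T_s)\to0$ as $T_s\to0$ ($\eta=0$: discrete-time commands held constant between samples; $\eta$ a modulus of continuity: uniformly continuous commands). *Conditions.* Put $R=(sI-A_p+B_pK)^{-1}$, $P=C_pRB_p$, $H_0=RB_p$, $H_1=(I+(M^{-1}P-I)C)^{-1}$, $H_2=H_0-H_0CH_1(M^{-1}P-I)$, $H_5=H_0CH_1M^{-1}$, $G=H_0-H_5P$, $H_{in}=C_pR-C_m(sI-A_m)^{-1}C_m^\dagger C_p$. Assume that $H_1$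 is stable, that $CM^{-1}$ is proper, and that for some $\rho_r>\rho_0>0$ and $\bar\gamma_1>0$ $$\|G\|_{\mathcal L_1}\bigl(L_{\rho_r}\rho_r+L_0\bigr)<\rho_r-\rho_1-\rho_2,\qquad L_{\rho_r}=\tfrac{\bar\gamma_1+\rho_r}{\rho_r}\bigl(F_{\rho_r+\bar\gamma_1}+\|K\|_\infty\bigr),$$ $$\rho_1=\|sR-sH_5H_{in}\|_{\mathcal L_1}\rho_0,\qquad \rho_2=\|H_2K_g\|_{\mathcal L_1}M_\omega .$$ Here the $\mathcal L_1$ norm of a matrix is its largest row sum of scalar norms, and the norm of a scalar proper transfer function is the total mass of its impulse response (including a Dirac mass at $0$). $\|K\|_\infty$ is the largest absolute row sum. *Reference system.* $\dot x_{ref}=A_px_{ref}+B_p(u_{ref}+f(t,x_{ref}))$, $x_{ref}(0)=x_0$, $u_{ref}=K_g\omega_c-C\sigma_{ref}$, $$\sigma_{ref}=[(P-M)C+M]^{-1}\bigl((P-M)K_g\omega_c+P\nu_{ref}+H_{in}x_0\bigr),\qquad \nu_{ref}=Kx_{ref}+f(t,x_{ref}),$$ transfer functions acting by convolution with their impulse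 responses. *Conclusion.* There are $T_{\max}>0$ and functions $\gamma_x,\gamma_u$ of $T_s$, which do not depend on $x_0$, on $\omega_c$ or on $f$ (only on $\eta$, $M_\omega$, $\rho_0$, $\rho_r$, $\bar\gamma_1$, $F$, $L_0$ and the system and design matrices), with $\lim_{T_s\to0}\gamma_x(T_s)=\lim_{T_s\to0}\gamma_u(T_s)=0$, such that for all $0<T_s<T_{\max}$ and all admissible $f,\omega_c,x_0$ both the reference system and the closed loop have a trajectory on $[0,\infty)$, and any such trajectories satisfy $$\|x_{ref}-x\|_{\mathcal L_\infty}\le\gamma_x(T_s),\qquad \|u_{ref}-u_{ad}\|_{\mathcal L_\infty}\le\gamma_u(T_s),$$ where $\|\xi\|_{\mathcal L_\infty}=\max_i\sup_{t\ge0}|\xi_i(t)|$. -/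

import Mathlib

open Filter Topology MeasureTheory Polynomial
open scoped ENNReal

noncomputable section

/-! Rational transfer functions -/

/-- `deg num ≤ deg denom`. -/
def RatProper (r : RatFunc ℝ) : Prop := r.num.degree ≤ r.denom.degree

/-- `deg num < deg denom` (the zero function is strictly proper). -/
def RatStrictlyProper (r : RatFunc ℝ) : Prop := r.num.degree < r.denom.degree

/-- All complex poles have negative real part (`num` and `denom` are coprime). -/
def RatStable (r : RatFunc ℝ) : Prop := ∀ z : ℂ, aeval z r.denom = 0 → z.re < 0

/-- The value at infinity of a proper rational function (`denom` is monic): the weight of the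
Dirac mass at time `0` in its inverse Laplace transform. -/
def ratFeedthrough (r : RatFunc ℝ) : ℝ := r.num.coeff r.denom.natDegree

/-- `g` is the regular part of the inverse Laplace transform of the proper function `r`:
it is continuous on `[0, ∞)` and, for all `s` in some right half plane,
`∫₀^∞ e^{-st} g(t) dt = r(s) - r(∞)` with an absolutely convergent integral. -/
def IsImpulseResponse (r : RatFunc ℝ) (g : ℝ → ℝ) : Prop :=
  ContinuousOn g (Set.Ici 0) ∧
    ∃ a : ℝ, ∀ s : ℂ, a < s.re →
      IntegrableOn (fun t : ℝ => Complex.exp (-(s * t)) * (g t : ℂ)) (Set.Ioi 0) ∧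
      ∫ t in Set.Ioi (0 : ℝ), Complex.exp (-(s * t)) * (g t : ℂ) =
        RatFunc.eval (algebraMap ℝ ℂ) s r - (ratFeedthrough r : ℂ)

open Classical in
/-- The regular part of the impulse response of `r`; it exists for every proper `r`, and it is
unique on `[0, ∞)` because the Laplace transform is injective. -/
def ratImpulse (r : RatFunc ℝ) : ℝ → ℝ :=
  if h : ∃ g, IsImpulseResponse r g then Classical.choose h else 0

open Classical in
/-- The `L₁` norm of a scalar transfer function: the total mass on `[0, ∞)` of its impulse
response `r(∞) δ₀ + g(t) dt`. It is `∞` for an improper function. -/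
def ratL1 (r : RatFunc ℝ) : ℝ≥0∞ :=
  if RatProper r then
    ENNReal.ofReal |ratFeedthrough r| + ∫⁻ t in Set.Ioi (0 : ℝ), ENNReal.ofReal |ratImpulse r t|
  else ⊤

/-- The `L₁` norm of a transfer matrix: the largest row sum of the scalar `L₁` norms. -/
def tfL1 {m n : ℕ} (G : Matrix (Fin m) (Fin n) (RatFunc ℝ)) : ℝ≥0∞ :=
  ⨆ i, ∑ j, ratL1 (G i j)

/-- The `L_∞` norm on `[0, ∞)`: the maximum over the components of the supremum over time. -/
def signalLinf {n : ℕ} (ξ : ℝ → Fin n → ℝ) : ℝ≥0∞ :=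
  ⨆ i, ⨆ t : Set.Ici (0 : ℝ), ENNReal.ofReal |ξ t i|

/-- The matrix of the regular parts of the impulse responses. -/
def tfImpulse {m n : Type*} (G : Matrix m n (RatFunc ℝ)) (t : ℝ) : Matrix m n ℝ :=
  Matrix.of fun i j => ratImpulse (G i j) t

/-- The signal with Laplace transform `G(s) w(s)`, i.e. the convolution of the impulse response
of `G` with `w`: `(G w)(t) = G(∞) w(t) + ∫₀ᵗ g(t - τ) w(τ) dτ`. -/
def tfApply {m n : Type*} [Fintype m] [Fintype n] (G : Matrix m n (RatFunc ℝ))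
    (w : ℝ → n → ℝ) (t : ℝ) : m → ℝ :=
  (Matrix.of fun i j => ratFeedthrough (G i j)).mulVec (w t) +
    ∫ τ in (0 : ℝ)..t, (tfImpulse G (t - τ)).mulVec (w τ)

/-- A constant matrix as a transfer matrix. -/
def tfConst {m n : Type*} (A : Matrix m n ℝ) : Matrix m n (RatFunc ℝ) :=
  A.map (algebraMap ℝ (RatFunc ℝ))

/-- `(s I - A)⁻¹`. -/
def tfResolvent {n : Type*} [Fintype n] [DecidableEq n] (A : Matrix n n ℝ) :
    Matrix n n (RatFunc ℝ) :=
  ((RatFunc.X : RatFunc ℝ) • (1 : Matrix n n (RatFunc ℝ)) - tfConst A)⁻¹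

/-- `C (s I - A)⁻¹ B`. -/
def tfOf {m n p : Type*} [Fintype n] [DecidableEq n]
    (A : Matrix n n ℝ) (B : Matrix n p ℝ) (C : Matrix m n ℝ) : Matrix m p (RatFunc ℝ) :=
  tfConst C * tfResolvent A * tfConst B

/-- `z` is a transmission zero of `G`: the rank of `G` drops at `z` below its normal rank
(for points `z` that are not poles of `G`; this is the only case in which it is used). -/
def IsTransmissionZero {m n : ℕ} (G : Matrix (Fin m) (Fin n) (RatFunc ℝ)) (z : ℂ) : Prop :=
  (G.map (RatFunc.eval (algebraMap ℝ ℂ) z)).rank < G.rank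

/-! Linear systems -/

/-- All eigenvalues have negative real part. -/
def IsHurwitz {n : Type*} [Fintype n] [DecidableEq n] (A : Matrix n n ℝ) : Prop :=
  ∀ z : ℂ, aeval z A.charpoly = 0 → z.re < 0

/-- The columns of `B, A B, A² B, …` span the state space. -/
def IsControllable {n p : Type*} [Fintype n] [DecidableEq n]
    (A : Matrix n n ℝ) (B : Matrix n p ℝ) : Prop :=
  Submodule.span ℝ (Set.range fun q : ℕ × p => fun i => (A ^ q.1 * B) i q.2) = ⊤

/-- No nonzero state is annihilated by all of `C, C A, C A², …`. -/
def IsObservable {n m : Type*} [Fintype n] [DecidableEq n]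
    (A : Matrix n n ℝ) (C : Matrix m n ℝ) : Prop :=
  ∀ v : n → ℝ, (∀ j : ℕ, (C * A ^ j).mulVec v = 0) → v = 0

/-- `(A, B, C)` is a state-space realization of `G` of the least possible order. -/
def IsMinimalRealization {m p : Type*} {n : ℕ} (A : Matrix (Fin n) (Fin n) ℝ)
    (B : Matrix (Fin n) p ℝ) (C : Matrix m (Fin n) ℝ) (G : Matrix m p (RatFunc ℝ)) : Prop :=
  tfOf A B C = G ∧
    ∀ (n' : ℕ) (A' : Matrix (Fin n') (Fin n') ℝ) (B' : Matrix (Fin n') p ℝ)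
      (C' : Matrix m (Fin n') ℝ), tfOf A' B' C' = G → n ≤ n'

/-- The right pseudo-inverse `Tᵀ (T Tᵀ)⁻¹` of a matrix of full row rank. -/
def rightPinv {m n : Type*} [Fintype m] [DecidableEq m] [Fintype n] (T : Matrix m n ℝ) :
    Matrix n m ℝ :=
  T.transpose * (T * T.transpose)⁻¹

/-- The operator norm induced by the maximum norm: the largest absolute row sum. -/
def matInfNorm {m n : ℕ} (A : Matrix (Fin m) (Fin n) ℝ) : ℝ := ⨆ i, ∑ j, |A i j|

/-! The autopilot-vehicle system and its controller -/

/-- The matrices of the problem. The state of the desired system has dimension `n_m = 2 + k`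
and is indexed by `Fin 2 ⊕ Fin k`. The state of the controller's filter has dimension `no`. -/
structure L1Design (np k no : ℕ) where
  /-- plant -/
  Ap : Matrix (Fin np) (Fin np) ℝ
  Bp : Matrix (Fin np) (Fin 2) ℝ
  Cp : Matrix (Fin 2) (Fin np) ℝ
  /-- gain used in the analysis only -/
  K : Matrix (Fin 2) (Fin np) ℝ
  /-- desired system -/
  Am : Matrix (Fin 2 ⊕ Fin k) (Fin 2 ⊕ Fin k) ℝ
  Bm : Matrix (Fin 2 ⊕ Fin k) (Fin 2) ℝ
  Cm : Matrix (Fin 2) (Fin 2 ⊕ Fin k) ℝ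
  /-- Lyapunov matrices, a square root of `Pl`, and a matrix whose rows span the null space
  of `Cm * sqrtP⁻¹` -/
  Q : Matrix (Fin 2 ⊕ Fin k) (Fin 2 ⊕ Fin k) ℝ
  Pl : Matrix (Fin 2 ⊕ Fin k) (Fin 2 ⊕ Fin k) ℝ
  sqrtP : Matrix (Fin 2 ⊕ Fin k) (Fin 2 ⊕ Fin k) ℝ
  D : Matrix (Fin k) (Fin 2 ⊕ Fin k) ℝ
  /-- low-pass filter -/
  Cf : Matrix (Fin 2) (Fin 2) (RatFunc ℝ)
  /-- realization of the control law -/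
  Ao : Matrix (Fin no) (Fin no) ℝ
  Bo : Matrix (Fin no) (Fin 2 ⊕ Fin k) ℝ
  Co : Matrix (Fin 2) (Fin no) ℝ

namespace L1Design

variable {np k no : ℕ} (d : L1Design np k no)

/-- `M(s)` -/
def M : Matrix (Fin 2) (Fin 2) (RatFunc ℝ) := tfOf d.Am d.Bm d.Cm

/-- `K_g = -(C_m A_m⁻¹ B_m)⁻¹` -/
def Kg : Matrix (Fin 2) (Fin 2) ℝ := -(d.Cm * d.Am⁻¹ * d.Bm)⁻¹

/-- `(s I - A_p + B_p K)⁻¹` -/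
def R : Matrix (Fin np) (Fin np) (RatFunc ℝ) := tfResolvent (d.Ap - d.Bp * d.K)

/-- `P(s)` -/
def P : Matrix (Fin 2) (Fin 2) (RatFunc ℝ) := tfConst d.Cp * d.R * tfConst d.Bp

/-- `H₀(s)` -/
def H₀ : Matrix (Fin np) (Fin 2) (RatFunc ℝ) := d.R * tfConst d.Bp

/-- `H₁(s)` -/
def H₁ : Matrix (Fin 2) (Fin 2) (RatFunc ℝ) := (1 + (d.M⁻¹ * d.P - 1) * d.Cf)⁻¹

/-- `H₂(s)` -/
def H₂ : Matrix (Fin np) (Fin 2) (RatFunc ℝ) :=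
  d.H₀ - d.H₀ * d.Cf * d.H₁ * (d.M⁻¹ * d.P - 1)

/-- `H₅(s)` -/
def H₅ : Matrix (Fin np) (Fin 2) (RatFunc ℝ) := d.H₀ * d.Cf * d.H₁ * d.M⁻¹

/-- `G(s)` -/
def G : Matrix (Fin np) (Fin 2) (RatFunc ℝ) := d.H₀ - d.H₅ * d.P

/-- `H_in(s)` -/
def Hin : Matrix (Fin 2) (Fin np) (RatFunc ℝ) :=
  tfConst d.Cp * d.R - tfConst d.Cm * tfResolvent d.Am * tfConst (rightPinv d.Cm * d.Cp)

/-- `O(s) = C(s) M⁻¹(s) C_m (s I - A_m)⁻¹` -/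
def O : Matrix (Fin 2) (Fin 2 ⊕ Fin k) (RatFunc ℝ) :=
  d.Cf * d.M⁻¹ * tfConst d.Cm * tfResolvent d.Am

/-- The standing assumptions on the plant and on the design. -/
structure Admissible : Prop where
  controllable : IsControllable d.Ap d.Bp
  observable : IsObservable d.Ap d.Cp
  hurwitz_K : IsHurwitz (d.Ap - d.Bp * d.K)
  hurwitz_m : IsHurwitz d.Am
  nonsingular : IsUnit (d.Cm * d.Bm).det
  minimumPhase : ∀ z : ℂ, 0 ≤ z.re → ¬ IsTransmissionZero d.M z
  Q_pos : d.Q.PosDef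
  Pl_pos : d.Pl.PosDef
  lyapunov : d.Am.transpose * d.Pl + d.Pl * d.Am = -d.Q
  sqrtP_unit : IsUnit d.sqrtP.det
  sqrtP_sq : d.Pl = d.sqrtP.transpose * d.sqrtP
  D_null : d.D * (d.Cm * d.sqrtP⁻¹).transpose = 0
  D_rank : d.D.rank = k
  filter_strictlyProper : ∀ i j, RatStrictlyProper (d.Cf i j)
  filter_stable : ∀ i j, RatStable (d.Cf i j)
  filter_zero : d.Cf.map (RatFunc.eval (RingHom.id ℝ) 0) = 1
  realization : IsMinimalRealization d.Ao d.Bo d.Co d.O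

/-! Sampled-data controller -/

/-- `Λ = [C_m; D √P]` -/
def Lam : Matrix (Fin 2 ⊕ Fin k) (Fin 2 ⊕ Fin k) ℝ := Matrix.fromRows d.Cm (d.D * d.sqrtP)

/-- `e^{Λ A_m Λ⁻¹ t}` -/
def expLam (t : ℝ) : Matrix (Fin 2 ⊕ Fin k) (Fin 2 ⊕ Fin k) ℝ :=
  NormedSpace.exp (t • (d.Lam * d.Am * d.Lam⁻¹))

/-- `Φ(T) = ∫₀ᵀ e^{Λ A_m Λ⁻¹ (T - τ)} Λ dτ` -/
def Phi (T : ℝ) : Matrix (Fin 2 ⊕ Fin k) (Fin 2 ⊕ Fin k) ℝ :=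
  Matrix.of fun i j => ∫ τ in (0 : ℝ)..T, (d.expLam (T - τ) * d.Lam) i j

/-- Adaptation law: the estimate `σ̂_d[i]` from `ŷ_d[i] - y_d[i]`. -/
def sigmaHat (T : ℝ) (ey : Fin 2 → ℝ) : Fin 2 ⊕ Fin k → ℝ :=
  -(((d.Phi T)⁻¹ * d.expLam T *
    Matrix.fromRows (1 : Matrix (Fin 2) (Fin 2) ℝ) (0 : Matrix (Fin k) (Fin 2) ℝ)).mulVec ey)

/-- Control law: `u_d[i] = K_g ω_c[i] - C_o x_u[i]`. -/
def uOut (w : Fin 2 → ℝ) (xu : Fin no → ℝ) : Fin 2 → ℝ := d.Kg.mulVec w - d.Co.mulVec xu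

/-- The predictor state and the filter state `(x̂_d[i], x_u[i])` of the controller with sampling
time `T`, driven by the sampled outputs `y` and the sampled commands `w`. -/
def ctrlState (T : ℝ) (y w : ℕ → Fin 2 → ℝ) : ℕ → (Fin 2 ⊕ Fin k → ℝ) × (Fin no → ℝ)
  | 0 => ((rightPinv d.Cm).mulVec (y 0), 0)
  | i + 1 =>
    let xh := (ctrlState T y w i).1
    let xu := (ctrlState T y w i).2
    let σ := d.sigmaHat T (d.Cm.mulVec xh - y i)
    ((NormedSpace.exp (T • d.Am)).mulVec xh +
        (d.Am⁻¹ * (NormedSpace.exp (T • d.Am) - 1)).mulVec (d.Bm.mulVec (d.uOut (w i) xu) + σ),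
      (NormedSpace.exp (T • d.Ao)).mulVec xu +
        (d.Ao⁻¹ * (NormedSpace.exp (T • d.Ao) - 1)).mulVec
          (d.Bo.mulVec ((NormedSpace.exp (-(T • d.Am))).mulVec σ)))

/-- The input `u_ad(t) = u_d[i]`, `t ∈ [i T, (i + 1) T)`, produced by the controller along the
plant trajectory `x`, with `y_d[i] = C_p x(i T)` and `ω_c[i] = ω_c(i T)`. -/
def uad (T : ℝ) (ω : ℝ → Fin 2 → ℝ) (x : ℝ → Fin np → ℝ) (t : ℝ) : Fin 2 → ℝ :=
  d.uOut (ω ((⌊t / T⌋₊ : ℝ) * T))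
    (d.ctrlState T (fun i => d.Cp.mulVec (x ((i : ℝ) * T))) (fun i => ω ((i : ℝ) * T))
      ⌊t / T⌋₊).2

/-! Plant and reference system -/

/-- `x` solves `ẋ = A_p x + B_p (u + f(t, x))`, `x(0) = x₀` on `[0, ∞)` in the sense of
Carathéodory, i.e. it satisfies the integrated equation. -/
def IsTrajectory (f : ℝ → (Fin np → ℝ) → Fin 2 → ℝ) (x₀ : Fin np → ℝ)
    (u : ℝ → Fin 2 → ℝ) (x : ℝ → Fin np → ℝ) : Prop :=
  ∀ t : ℝ, 0 ≤ t →
    IntervalIntegrable (fun τ => d.Ap.mulVec (x τ) + d.Bp.mulVec (u τ + f τ (x τ))) volume 0 t ∧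
    x t = x₀ + ∫ τ in (0 : ℝ)..t, (d.Ap.mulVec (x τ) + d.Bp.mulVec (u τ + f τ (x τ)))

/-- Trajectory of the plant in closed loop with the sampled-data controller. -/
def IsClosedLoop (T : ℝ) (f : ℝ → (Fin np → ℝ) → Fin 2 → ℝ) (ω : ℝ → Fin 2 → ℝ)
    (x₀ : Fin np → ℝ) (x : ℝ → Fin np → ℝ) : Prop :=
  d.IsTrajectory f x₀ (d.uad T ω x) x

/-- `[(P(s) - M(s)) C(s) + M(s)]⁻¹` -/
def N : Matrix (Fin 2) (Fin 2) (RatFunc ℝ) := ((d.P - d.M) * d.Cf + d.M)⁻¹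

/-- `σ_ref` along `x_ref`; the constant vector `x₀` in `H_in(s) x₀` is the transform of an impulse,
so that the last summand is an impulse response. -/
def sigmaRef (f : ℝ → (Fin np → ℝ) → Fin 2 → ℝ) (ω : ℝ → Fin 2 → ℝ)
    (x₀ : Fin np → ℝ) (xref : ℝ → Fin np → ℝ) (t : ℝ) : Fin 2 → ℝ :=
  tfApply (d.N * (d.P - d.M) * tfConst d.Kg) ω t +
    tfApply (d.N * d.P) (fun τ => d.K.mulVec (xref τ) + f τ (xref τ)) t +
    (tfImpulse (d.N * d.Hin) t).mulVec x₀

/-- `u_ref = K_g ω_c - C(s) σ_ref` along `x_ref`. -/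
def uref (f : ℝ → (Fin np → ℝ) → Fin 2 → ℝ) (ω : ℝ → Fin 2 → ℝ)
    (x₀ : Fin np → ℝ) (xref : ℝ → Fin np → ℝ) (t : ℝ) : Fin 2 → ℝ :=
  d.Kg.mulVec (ω t) - tfApply d.Cf (d.sigmaRef f ω x₀ xref) t

/-- Trajectory of the closed-loop reference system. -/
def IsReference (f : ℝ → (Fin np → ℝ) → Fin 2 → ℝ) (ω : ℝ → Fin 2 → ℝ)
    (x₀ : Fin np → ℝ) (xref : ℝ → Fin np → ℝ) : Prop :=
  d.IsTrajectory f x₀ (d.uref f ω x₀ xref) xref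

/-! Constants of the stability condition -/

/-- `ρ₁` -/
def rho₁ (ρ₀ : ℝ) : ℝ≥0∞ :=
  tfL1 ((RatFunc.X : RatFunc ℝ) • d.R - (RatFunc.X : RatFunc ℝ) • (d.H₅ * d.Hin)) * ENNReal.ofReal ρ₀

/-- `ρ₂` -/
def rho₂ (Mω : ℝ) : ℝ≥0∞ := tfL1 (d.H₂ * tfConst d.Kg) * ENNReal.ofReal Mω

/-- `L_ρ = ((γ̄₁ + ρ) / ρ) (F_{ρ + γ̄₁} + ‖K‖_∞)` -/
def Lrho (F : ℝ → ℝ) (γ₁ ρ : ℝ) : ℝ := (γ₁ + ρ) / ρ * (F (ρ + γ₁) + matInfNorm d.K)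

/-- `‖G‖ (L_ρ ρ + L₀) + ρ₁ + ρ₂ < ρ`, i.e. `‖G‖ < (ρ - ρ₁ - ρ₂) / (L_ρ ρ + L₀)` with
the denominator cleared. -/
def NormCondition (F : ℝ → ℝ) (L₀ Mω ρ₀ γ₁ ρ : ℝ) : Prop :=
  tfL1 d.G * ENNReal.ofReal (d.Lrho F γ₁ ρ * ρ + L₀) + d.rho₁ ρ₀ + d.rho₂ Mω < ENNReal.ofReal ρ

end L1Design

/-- The assumption on the uncertainty (norms on `Fin n → ℝ` are maximum norms). -/
structure IsUncertainty {np : ℕ} (F : ℝ → ℝ) (L₀ : ℝ)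
    (f : ℝ → (Fin np → ℝ) → Fin 2 → ℝ) : Prop where
  measurable : ∀ x, Measurable fun t => f t x
  lipschitz : ∀ δ : ℝ, 0 < δ → ∀ t : ℝ, 0 ≤ t → ∀ x₁ x₂ : Fin np → ℝ, ‖x₁‖ < δ → ‖x₂‖ < δ →
    ‖f t x₂ - f t x₁‖ ≤ F δ * ‖x₂ - x₁‖
  bound : ∀ t : ℝ, 0 ≤ t → ‖f t 0‖ ≤ L₀

/-- Commands bounded by `Mω` that differ by at most `e` from their zero-order hold with sampling
time `T`. For `e = 0` these are the commands that are constant on the sampling intervals. -/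
structure IsCommand (Mω T e : ℝ) (ω : ℝ → Fin 2 → ℝ) : Prop where
  measurable : Measurable ω
  bound : ∀ t : ℝ, 0 ≤ t → ‖ω t‖ ≤ Mω
  hold : ∀ t : ℝ, 0 ≤ t → ‖ω t - ω ((⌊t / T⌋₊ : ℝ) * T)‖ ≤ e

end

open Filter Topology MeasureTheory Polynomial
open scoped ENNReal
noncomputable section
set_option linter.unusedSectionVars false


/-! Both loops are one linear loop with different inputs, and the difference of the inputs is small.

With `ν = K x + f(t, x)` the plant reads `X = R x₀ + H₀ (U + ν)`. By `output_eq` its output is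
exactly that of the desired system with input `U + σ` and initial state `C_m† C_p x₀`, where `σ =
M⁻¹ ((P - M) U + P ν + H_in x₀)`. This `σ` is an ordinary signal: `C_m B_m` is nonsingular, so `M⁻¹
P` is proper, and the chosen initial state gives `H_in` relative degree at least two, so `M⁻¹ H_in`
is strictly proper. If `U = V - C σ`, then `σ` can be solved for by means of `H₁`
(`matched_eq_matchedLoop`) and `X = H₂ V + G ν + (R - H₅ H_in) x₀` (`state_eq`). The reference
system has `V = K_g ω`, the sampled loop has `V = K_g ω + e`, and `e` collects all effects of
sampling and estimation.

The input `e` is `O(η) + O(T) sup ‖σ‖`. The heart is `predictor_error`. Over one sampling step the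
predictor error is projected onto `ker C_m`, propagated by `e^{A_m T}` and disturbed by `O(T) sup
‖σ‖`. The projection is orthogonal for the inner product of `P_ℓ`, and by the Lyapunov equation the
exponential contracts the squared norm by `1 - cT`. Hence the error stays `O(1) sup ‖σ‖`. Its output
is smaller by a factor `T`, because `C_m` annihilates the projected error, and this factor
compensates the `T⁻¹` in the adaptation gain. In `control_error` the filter `O = C M⁻¹ C_m (sI -
A_m)⁻¹` then turns the estimate into `C σ` plus `C M⁻¹` applied to the small output error. The
realization of the filter is stable because it is a minimal realization of a stable matrix.

A small-gain argument closes the loop (`performance`). As long as `‖x‖ ≤ ρ_r`, the signals `ν`, `σ`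
and `e` are bounded, and the norm condition yields `‖x‖ < ρ_r`, so the ball is never left.
Subtracting the two state formulas gives `x_ref - x = G (ν_ref - ν) - H₂ e`, where `‖G‖` times the
Lipschitz constant of `ν` is less than one. For existence, `f` is composed with a projection onto
the ball; Picard iteration solves the globally Lipschitz problem, and the ball estimate shows that
the projection is inactive along the solution.

The algebra takes place in matrices over `RatFunc ℝ`. It is transported to signals by `tfAct`, which
is multiplicative on proper matrices; this rests on existence and uniqueness of impulse responses
and on the convolution theorem for Laplace transforms. -/

/-! Rational functions that are regular at a point, and proper rational functions -/

/-- The rational functions without a pole at `z`. -/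
def regularRing (z : ℂ) : Subring (RatFunc ℝ) where
  carrier := {r | r.denom.eval₂ (algebraMap ℝ ℂ) z ≠ 0}
  mul_mem' {a b} ha hb := fun h => by
    have h1 := Polynomial.eval₂_eq_zero_of_dvd_of_eval₂_eq_zero (algebraMap ℝ ℂ) z
      (RatFunc.denom_mul_dvd a b) h
    rw [Polynomial.eval₂_mul] at h1
    exact (mul_ne_zero ha hb) h1
  one_mem' := by simp
  add_mem' {a b} ha hb := fun h => by
    have h1 := Polynomial.eval₂_eq_zero_of_dvd_of_eval₂_eq_zero (algebraMap ℝ ℂ) z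
      (RatFunc.denom_add_dvd a b) h
    rw [Polynomial.eval₂_mul] at h1
    exact (mul_ne_zero ha hb) h1
  zero_mem' := by simp
  neg_mem' {a} ha := fun h => by
    have h2 : (-a).denom ∣ a.denom := by
      have h3 := RatFunc.denom_mul_dvd (RatFunc.C (-1)) a
      have h4 : RatFunc.C (-1) * a = -a := by simp
      rwa [RatFunc.denom_C, one_mul, h4] at h3
    exact ha (Polynomial.eval₂_eq_zero_of_dvd_of_eval₂_eq_zero (algebraMap ℝ ℂ) z h2 h)

/-- Evaluation at `z`. -/
def evalAt (z : ℂ) : regularRing z →+* ℂ where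
  toFun r := RatFunc.eval (algebraMap ℝ ℂ) z r.1
  map_one' := by simp
  map_mul' a b := RatFunc.eval_mul _ _ a.2 b.2
  map_zero' := by simp
  map_add' a b := RatFunc.eval_add _ _ a.2 b.2

lemma evalAt_apply (z : ℂ) (r : regularRing z) :
    evalAt z r = RatFunc.eval (algebraMap ℝ ℂ) z r.1 := rfl

/-- The denominator of `r⁻¹` divides the numerator of `r`, which does not vanish at `z`. This
locality, and its analogue at infinity `inv_mem_properRing`, are what `EntriesIn.inv` needs. -/
lemma inv_mem_regularRing {z : ℂ} (r : regularRing z) (h : evalAt z r ≠ 0) :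
    (r : RatFunc ℝ)⁻¹ ∈ regularRing z := by
  intro h0
  have hr : (r : RatFunc ℝ) ≠ 0 := by
    intro h1; apply h; rw [evalAt_apply, h1, RatFunc.eval_zero]
  have h1 := Polynomial.eval₂_eq_zero_of_dvd_of_eval₂_eq_zero (algebraMap ℝ ℂ) z
      (RatFunc.denom_inv_dvd hr) h0
  apply h
  rw [evalAt_apply, RatFunc.eval, h1, zero_div]

lemma ratStable_iff {r : RatFunc ℝ} :
    RatStable r ↔ ∀ z : ℂ, 0 ≤ z.re → r ∈ regularRing z := by
  constructor
  · intro h z hz h0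
    exact absurd (h z h0) (not_lt.2 hz)
  · intro h z h0
    by_contra hz
    exact h z (not_lt.1 hz) h0

lemma ratProper_div {p q : ℝ[X]} (hq : q ≠ 0) (h : p.degree ≤ q.degree) :
    RatProper (algebraMap _ _ p / algebraMap _ _ q) := by
  set r : RatFunc ℝ := algebraMap _ _ p / algebraMap _ _ q with hr
  have h1 : r.num * q = p * r.denom := (RatFunc.num_mul_eq_mul_denom_iff hq).2 hr
  have h2 := congrArg degree h1
  rw [degree_mul, degree_mul] at h2
  unfold RatProper
  have hqd : q.degree ≠ ⊥ := by simpa using hq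
  have : r.num.degree + q.degree ≤ r.denom.degree + q.degree := by
    rw [h2, add_comm r.denom.degree]; gcongr
  exact (WithBot.add_le_add_iff_right hqd).1 this

lemma ratProper_iff {r : RatFunc ℝ} : RatProper r ↔
    ∃ p q : ℝ[X], q ≠ 0 ∧ p.degree ≤ q.degree ∧ r = algebraMap _ _ p / algebraMap _ _ q := by
  constructor
  · intro h
    exact ⟨r.num, r.denom, r.denom_ne_zero, h, (RatFunc.num_div_denom r).symm⟩
  · rintro ⟨p, q, hq, h, rfl⟩
    exact ratProper_div hq h

/-- The proper rational functions. -/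
def properRing : Subring (RatFunc ℝ) where
  carrier := {r | RatProper r}
  mul_mem' {a b} ha hb := by
    obtain ⟨p, q, hq, h, rfl⟩ := ratProper_iff.1 ha
    obtain ⟨p', q', hq', h', rfl⟩ := ratProper_iff.1 hb
    refine ratProper_iff.2 ⟨p * p', q * q', mul_ne_zero hq hq', ?_, ?_⟩
    · rw [degree_mul, degree_mul]; gcongr
    · rw [div_mul_div_comm, map_mul, map_mul]
  one_mem' := by simp [RatProper]
  add_mem' {a b} ha hb := by
    obtain ⟨p, q, hq, h, rfl⟩ := ratProper_iff.1 ha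
    obtain ⟨p', q', hq', h', rfl⟩ := ratProper_iff.1 hb
    refine ratProper_iff.2 ⟨p * q' + q * p', q * q', mul_ne_zero hq hq', ?_, ?_⟩
    · refine (degree_add_le _ _).trans (max_le ?_ ?_) <;> rw [degree_mul, degree_mul] <;> gcongr
    · rw [div_add_div _ _ (by simpa using hq) (by simpa using hq')]; simp
  zero_mem' := by simp [RatProper]
  neg_mem' {a} ha := by
    obtain ⟨p, q, hq, h, rfl⟩ := ratProper_iff.1 ha
    exact ratProper_iff.2 ⟨-p, q, hq, by simpa using h, by simp [neg_div]⟩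

lemma mem_properRing {r : RatFunc ℝ} : r ∈ properRing ↔ RatProper r := Iff.rfl

lemma eventually_denom_ne_zero (r : RatFunc ℝ) :
    ∀ᶠ x : ℝ in atTop, r.denom.eval₂ (RingHom.id ℝ) x ≠ 0 := by
  have := Polynomial.eventually_atTop_not_isRoot r.denom r.denom_ne_zero
  filter_upwards [this] with x hx
  simpa [Polynomial.IsRoot, Polynomial.eval₂_id] using hx

/-- As a limit along the real axis, the value at infinity inherits additivity and multiplicativity
from pointwise evaluation; `feedthroughHom` relies on this. -/
lemma tendsto_ratFeedthrough {r : RatFunc ℝ} (h : RatProper r) :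
    Tendsto (fun x : ℝ => RatFunc.eval (RingHom.id ℝ) x r) atTop (𝓝 (ratFeedthrough r)) := by
  have h0 : (fun x : ℝ => RatFunc.eval (RingHom.id ℝ) x r) =
      fun x => eval x r.num / eval x r.denom := by
    ext x; simp [RatFunc.eval, Polynomial.eval₂_id]
  rw [h0]
  rcases lt_or_eq_of_le h with hlt | heq
  · have : ratFeedthrough r = 0 := by
      refine coeff_eq_zero_of_degree_lt ?_
      rwa [← degree_eq_natDegree r.denom_ne_zero]
    rw [this]
    exact Polynomial.div_tendsto_atTop_zero_of_degree_lt _ _ hlt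
  · have : ratFeedthrough r = r.num.leadingCoeff / r.denom.leadingCoeff := by
      rw [(RatFunc.monic_denom r).leadingCoeff, div_one, ratFeedthrough, leadingCoeff,
        natDegree_eq_of_degree_eq heq]
    rw [this]
    exact Polynomial.div_tendsto_atTop_leadingCoeff_div_of_degree_eq _ _ heq

/-- The value at infinity as a ring homomorphism. -/
def feedthroughHom : properRing →+* ℝ where
  toFun r := ratFeedthrough r.1
  map_one' := by simp [ratFeedthrough]
  map_mul' a b := by
    refine tendsto_nhds_unique (tendsto_ratFeedthrough (a * b).2) ?_
    refine ((tendsto_ratFeedthrough a.2).mul (tendsto_ratFeedthrough b.2)).congr' ?_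
    filter_upwards [eventually_denom_ne_zero a.1, eventually_denom_ne_zero b.1] with x ha hb
    exact (RatFunc.eval_mul _ _ ha hb).symm
  map_zero' := by simp [ratFeedthrough]
  map_add' a b := by
    refine tendsto_nhds_unique (tendsto_ratFeedthrough (a + b).2) ?_
    refine ((tendsto_ratFeedthrough a.2).add (tendsto_ratFeedthrough b.2)).congr' ?_
    filter_upwards [eventually_denom_ne_zero a.1, eventually_denom_ne_zero b.1] with x ha hb
    exact (RatFunc.eval_add _ _ ha hb).symm

lemma feedthroughHom_apply (r : properRing) : feedthroughHom r = ratFeedthrough r.1 := rfl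

lemma inv_mem_properRing (r : properRing) (h : feedthroughHom r ≠ 0) :
    (r : RatFunc ℝ)⁻¹ ∈ properRing := by
  have hr : (r : RatFunc ℝ) ≠ 0 := by
    intro h1; apply h; rw [feedthroughHom_apply, h1]; simp [ratFeedthrough]
  have h2 : r.1.denom.degree ≤ r.1.num.degree := by
    by_contra hlt
    apply h
    rw [feedthroughHom_apply]
    refine coeff_eq_zero_of_degree_lt ?_
    rw [← degree_eq_natDegree r.1.denom_ne_zero]
    exact not_le.1 hlt
  refine ratProper_iff.2 ⟨r.1.denom, r.1.num, RatFunc.num_ne_zero hr, h2, ?_⟩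
  conv_lhs => rw [← RatFunc.num_div_denom r.1]
  rw [inv_div]

lemma ratStrictlyProper_iff {r : RatFunc ℝ} :
    RatStrictlyProper r ↔ RatProper r ∧ ratFeedthrough r = 0 := by
  constructor
  · intro h
    refine ⟨h.le, coeff_eq_zero_of_degree_lt ?_⟩
    rw [← degree_eq_natDegree r.denom_ne_zero]; exact h
  · rintro ⟨h1, h2⟩
    refine lt_of_le_of_ne h1 fun heq => ?_
    have : r.num.leadingCoeff = 0 := by
      rw [leadingCoeff, natDegree_eq_of_degree_eq heq]; exact h2
    rw [leadingCoeff_eq_zero] at this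
    rw [this, degree_zero] at heq
    exact r.denom_ne_zero (degree_eq_bot.1 heq.symm)

lemma ratProper_const (c : ℝ) : RatProper (algebraMap ℝ (RatFunc ℝ) c) := by
  rw [RatFunc.algebraMap_eq_C]; simp only [RatProper, RatFunc.num_C, RatFunc.denom_C]
  exact degree_C_le.trans (by simp)

lemma ratFeedthrough_const (c : ℝ) : ratFeedthrough (algebraMap ℝ (RatFunc ℝ) c) = c := by
  rw [RatFunc.algebraMap_eq_C]; simp [ratFeedthrough]

lemma const_mem_regularRing (c : ℝ) (z : ℂ) : algebraMap ℝ (RatFunc ℝ) c ∈ regularRing z := by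
  rw [RatFunc.algebraMap_eq_C]
  change (RatFunc.C c).denom.eval₂ (algebraMap ℝ ℂ) z ≠ 0
  simp

lemma X_mem_regularRing (z : ℂ) : (RatFunc.X : RatFunc ℝ) ∈ regularRing z := by
  change (RatFunc.X : RatFunc ℝ).denom.eval₂ (algebraMap ℝ ℂ) z ≠ 0
  simp

lemma ratStrictlyProper_inv_X : RatStrictlyProper (RatFunc.X : RatFunc ℝ)⁻¹ := by
  have hp : RatProper (RatFunc.X : RatFunc ℝ)⁻¹ :=
    ratProper_iff.2 ⟨1, X, X_ne_zero, by simp, by simp⟩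
  refine ratStrictlyProper_iff.2 ⟨hp, ?_⟩
  refine tendsto_nhds_unique (tendsto_ratFeedthrough hp) ?_
  refine tendsto_inv_atTop_zero.congr' ?_
  filter_upwards [eventually_ne_atTop 0, eventually_denom_ne_zero (RatFunc.X : RatFunc ℝ)⁻¹,
    eventually_denom_ne_zero (RatFunc.X : RatFunc ℝ)] with x hx h1 h2
  have := RatFunc.eval_mul (x := RatFunc.X) (y := (RatFunc.X : RatFunc ℝ)⁻¹) _ _ h2 h1
  rw [mul_inv_cancel₀ RatFunc.X_ne_zero, RatFunc.eval_one, RatFunc.eval_X] at this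
  exact inv_eq_of_mul_eq_one_right this.symm

/-! Matrices over a local subring of a field -/

section Matrices
variable {K L : Type*} [Field K] [Field L] {m n : Type*}

/-- All entries lie in the subring. -/
def EntriesIn (O : Subring K) (A : Matrix m n K) : Prop := ∀ i j, A i j ∈ O

lemma EntriesIn.mul {l : Type*} [Fintype l] {O : Subring K} {A : Matrix m l K} {B : Matrix l n K}
    (hA : EntriesIn O A) (hB : EntriesIn O B) : EntriesIn O (A * B) := fun i j =>
  O.sum_mem fun k _ => O.mul_mem (hA i k) (hB k j)

lemma EntriesIn.add {O : Subring K} {A B : Matrix m n K}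
    (hA : EntriesIn O A) (hB : EntriesIn O B) : EntriesIn O (A + B) := fun i j =>
  O.add_mem (hA i j) (hB i j)

lemma EntriesIn.sub {O : Subring K} {A B : Matrix m n K}
    (hA : EntriesIn O A) (hB : EntriesIn O B) : EntriesIn O (A - B) := fun i j =>
  O.sub_mem (hA i j) (hB i j)

lemma EntriesIn.one [DecidableEq n] {O : Subring K} : EntriesIn O (1 : Matrix n n K) := fun i j => by
  rw [Matrix.one_apply]; split_ifs
  · exact O.one_mem
  · exact O.zero_mem

/-- The matrix with entries in the subring. -/
def EntriesIn.lift {O : Subring K} {A : Matrix m n K} (h : EntriesIn O A) : Matrix m n O :=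
  Matrix.of fun i j => ⟨A i j, h i j⟩

lemma EntriesIn.map_lift {O : Subring K} {A : Matrix m n K} (h : EntriesIn O A) :
    h.lift.map O.subtype = A := by ext i j; rfl

/-- Cramer's rule: the adjugate stays in the subring, and the determinant is invertible there
because its image under `ev` is nonzero. With `feedthroughHom` this gives proper inverses, with
`evalAt z` inverses without a pole at `z`. -/
lemma EntriesIn.inv [Fintype n] [DecidableEq n] {O : Subring K} (ev : O →+* L)
    (hloc : ∀ x : O, ev x ≠ 0 → (x : K)⁻¹ ∈ O) {A : Matrix n n K} (h : EntriesIn O A)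
    (hdet : (h.lift.map ev).det ≠ 0) :
    A.det ≠ 0 ∧ EntriesIn O A⁻¹ := by
  have h1 : ev h.lift.det ≠ 0 := by
    rwa [RingHom.map_det]
  have h2 : A.det = (h.lift.det : K) := by
    have h4 := RingHom.map_det O.subtype h.lift
    rw [RingHom.mapMatrix_apply, h.map_lift] at h4
    exact h4.symm
  have h3 : A.det ≠ 0 := by
    rw [h2]; intro h0
    apply h1
    have : h.lift.det = 0 := Subtype.ext h0
    rw [this, map_zero]
  refine ⟨h3, ?_⟩
  have hadj : A.adjugate = h.lift.adjugate.map O.subtype := by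
    have h4 := RingHom.map_adjugate O.subtype h.lift
    rw [RingHom.mapMatrix_apply, RingHom.mapMatrix_apply, h.map_lift] at h4
    exact h4.symm
  intro i j
  rw [Matrix.inv_def, Matrix.smul_apply, smul_eq_mul, Ring.inverse_eq_inv', hadj, h2]
  exact O.mul_mem (hloc _ h1) (h.lift.adjugate i j).2

end Matrices


/-! Proper, strictly proper and stable transfer matrices -/

section TransferMatrices

variable {m n p : Type*}

/-- All entries are proper. -/
abbrev MProper (G : Matrix m n (RatFunc ℝ)) : Prop := EntriesIn properRing G

/-- All entries are strictly proper. -/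
def MStrict (G : Matrix m n (RatFunc ℝ)) : Prop := MProper ((RatFunc.X : RatFunc ℝ) • G)

/-- All entries are stable. -/
def MStable (G : Matrix m n (RatFunc ℝ)) : Prop := ∀ z : ℂ, 0 ≤ z.re → EntriesIn (regularRing z) G

/-- The value at infinity of a proper transfer matrix. -/
def ftMat (G : Matrix m n (RatFunc ℝ)) : Matrix m n ℝ := Matrix.of fun i j => ratFeedthrough (G i j)

lemma ratFeedthrough_mul {r s : RatFunc ℝ} (hr : r ∈ properRing) (hs : s ∈ properRing) :
    ratFeedthrough (r * s) = ratFeedthrough r * ratFeedthrough s :=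
  map_mul feedthroughHom ⟨r, hr⟩ ⟨s, hs⟩

lemma ratFeedthrough_add {r s : RatFunc ℝ} (hr : r ∈ properRing) (hs : s ∈ properRing) :
    ratFeedthrough (r + s) = ratFeedthrough r + ratFeedthrough s :=
  map_add feedthroughHom ⟨r, hr⟩ ⟨s, hs⟩

lemma ratFeedthrough_sub {r s : RatFunc ℝ} (hr : r ∈ properRing) (hs : s ∈ properRing) :
    ratFeedthrough (r - s) = ratFeedthrough r - ratFeedthrough s :=
  map_sub feedthroughHom ⟨r, hr⟩ ⟨s, hs⟩

lemma ratFeedthrough_sum {ι : Type*} {s : Finset ι} {r : ι → RatFunc ℝ}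
    (hr : ∀ i, r i ∈ properRing) :
    ratFeedthrough (∑ i ∈ s, r i) = ∑ i ∈ s, ratFeedthrough (r i) := by
  have := map_sum feedthroughHom (fun i => (⟨r i, hr i⟩ : properRing)) s
  rw [feedthroughHom_apply] at this
  rw [← show ((∑ i ∈ s, (⟨r i, hr i⟩ : properRing) : properRing) : RatFunc ℝ) = ∑ i ∈ s, r i by
    rw [AddSubmonoidClass.coe_finsetSum], this]
  rfl

lemma ftMat_mul [Fintype n] {G : Matrix m n (RatFunc ℝ)} {H : Matrix n p (RatFunc ℝ)}
    (hG : MProper G) (hH : MProper H) : ftMat (G * H) = ftMat G * ftMat H := by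
  ext i j
  simp only [ftMat, Matrix.of_apply, Matrix.mul_apply]
  rw [ratFeedthrough_sum fun k => properRing.mul_mem (hG i k) (hH k j)]
  exact Finset.sum_congr rfl fun k _ => ratFeedthrough_mul (hG i k) (hH k j)

lemma ftMat_add {G H : Matrix m n (RatFunc ℝ)}
    (hG : MProper G) (hH : MProper H) : ftMat (G + H) = ftMat G + ftMat H := by
  ext i j; exact ratFeedthrough_add (hG i j) (hH i j)

lemma ftMat_sub {G H : Matrix m n (RatFunc ℝ)}
    (hG : MProper G) (hH : MProper H) : ftMat (G - H) = ftMat G - ftMat H := by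
  ext i j; exact ratFeedthrough_sub (hG i j) (hH i j)

lemma ftMat_tfConst (A : Matrix m n ℝ) : ftMat (tfConst A) = A := by
  ext i j; exact ratFeedthrough_const _

lemma ftMat_one [DecidableEq n] : ftMat (1 : Matrix n n (RatFunc ℝ)) = 1 := by
  ext i j
  simp only [ftMat, Matrix.of_apply, Matrix.one_apply]
  split_ifs <;> simp [ratFeedthrough]

lemma MProper.tfConst (A : Matrix m n ℝ) : MProper (tfConst A) := fun _ _ => ratProper_const _

lemma MStable.tfConst (A : Matrix m n ℝ) : MStable (tfConst A) :=
  fun z _ _ _ => const_mem_regularRing _ z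

lemma tfConst_mul [Fintype n] (A : Matrix m n ℝ) (B : Matrix n p ℝ) :
    tfConst (A * B) = tfConst A * tfConst B := Matrix.map_mul

lemma tfConst_one [DecidableEq n] : tfConst (1 : Matrix n n ℝ) = 1 :=
  Matrix.map_one _ (map_zero _) (map_one _)

lemma X_inv_mem_properRing : (RatFunc.X : RatFunc ℝ)⁻¹ ∈ properRing := ratStrictlyProper_inv_X.le

lemma MStrict.mproper {G : Matrix m n (RatFunc ℝ)} (h : MStrict G) : MProper G := fun i j => by
  have h1 := properRing.mul_mem X_inv_mem_properRing (h i j)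
  rwa [Matrix.smul_apply, smul_eq_mul, inv_mul_cancel_left₀ RatFunc.X_ne_zero] at h1

lemma MStrict.ftMat_eq {G : Matrix m n (RatFunc ℝ)} (h : MStrict G) : ftMat G = 0 := by
  ext i j
  have h1 := ratFeedthrough_mul X_inv_mem_properRing (h i j)
  rwa [Matrix.smul_apply, smul_eq_mul, inv_mul_cancel_left₀ RatFunc.X_ne_zero,
    (ratStrictlyProper_iff.1 ratStrictlyProper_inv_X).2, zero_mul] at h1

lemma X_mul_mem_properRing {r : RatFunc ℝ} (h : RatStrictlyProper r) :
    RatFunc.X * r ∈ properRing := by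
  refine ratProper_iff.2 ⟨X * r.num, r.denom, r.denom_ne_zero, ?_, ?_⟩
  · rw [degree_mul, degree_X, add_comm]
    exact Nat.WithBot.add_one_le_of_lt h
  · conv_lhs => rw [← RatFunc.num_div_denom r]
    rw [map_mul, RatFunc.algebraMap_X, mul_div_assoc]

lemma mstrict_iff {G : Matrix m n (RatFunc ℝ)} :
    MStrict G ↔ MProper G ∧ ftMat G = 0 := by
  refine ⟨fun h => ⟨h.mproper, h.ftMat_eq⟩, fun h i j => ?_⟩
  exact X_mul_mem_properRing (ratStrictlyProper_iff.2 ⟨h.1 i j, congrFun (congrFun h.2 i) j⟩)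

lemma MStrict.mul [Fintype n] {G : Matrix m n (RatFunc ℝ)} {H : Matrix n p (RatFunc ℝ)}
    (hG : MStrict G) (hH : MProper H) : MStrict (G * H) := by
  unfold MStrict; rw [← Matrix.smul_mul]; exact EntriesIn.mul hG hH

lemma MStrict.mul_left [Fintype n] {G : Matrix m n (RatFunc ℝ)} {H : Matrix n p (RatFunc ℝ)}
    (hG : MProper G) (hH : MStrict H) : MStrict (G * H) := by
  unfold MStrict; rw [← Matrix.mul_smul]; exact EntriesIn.mul hG hH

lemma MStrict.sub {G H : Matrix m n (RatFunc ℝ)} (hG : MStrict G) (hH : MStrict H) :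
    MStrict (G - H) := by
  unfold MStrict; rw [smul_sub]; exact EntriesIn.sub hG hH

lemma MStable.mul [Fintype n] {G : Matrix m n (RatFunc ℝ)} {H : Matrix n p (RatFunc ℝ)}
    (hG : MStable G) (hH : MStable H) : MStable (G * H) := fun z hz => (hG z hz).mul (hH z hz)

lemma MStable.sub {G H : Matrix m n (RatFunc ℝ)}
    (hG : MStable G) (hH : MStable H) : MStable (G - H) := fun z hz => (hG z hz).sub (hH z hz)

lemma MStable.one [DecidableEq n] : MStable (1 : Matrix n n (RatFunc ℝ)) :=
  fun _ _ => EntriesIn.one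

lemma MStable.smul_X {G : Matrix m n (RatFunc ℝ)} (hG : MStable G) :
    MStable ((RatFunc.X : RatFunc ℝ) • G) :=
  fun z hz i j => (regularRing z).mul_mem (X_mem_regularRing z) (hG z hz i j)

lemma mproper_inv [Fintype n] [DecidableEq n] {A : Matrix n n (RatFunc ℝ)} (hA : MProper A)
    (h : (ftMat A).det ≠ 0) : A.det ≠ 0 ∧ MProper A⁻¹ :=
  EntriesIn.inv feedthroughHom inv_mem_properRing hA h

end TransferMatrices

/-! Resolvents -/

section Resolvent

variable {n : Type*} [Fintype n] [DecidableEq n]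

/-- Pulling out `s` leaves a proper matrix with value `I` at infinity, whose inverse is proper
again. The properness and the leading term of the resolvent come from this factorization. -/
lemma resolvent_eq (A : Matrix n n ℝ) :
    (RatFunc.X : RatFunc ℝ) • (1 : Matrix n n (RatFunc ℝ)) - tfConst A =
      (RatFunc.X : RatFunc ℝ) • (1 - (RatFunc.X : RatFunc ℝ)⁻¹ • tfConst A) := by
  rw [smul_sub, smul_smul, mul_inv_cancel₀ RatFunc.X_ne_zero, one_smul]

lemma mstrict_inv_X_smul {m p : Type*} {G : Matrix m p (RatFunc ℝ)} (hG : MProper G) :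
    MStrict ((RatFunc.X : RatFunc ℝ)⁻¹ • G) := by
  unfold MStrict; rw [smul_smul, mul_inv_cancel₀ RatFunc.X_ne_zero, one_smul]; exact hG

lemma mproper_one_sub (A : Matrix n n ℝ) :
    MProper (1 - (RatFunc.X : RatFunc ℝ)⁻¹ • tfConst A) :=
  EntriesIn.sub EntriesIn.one (mstrict_inv_X_smul (MProper.tfConst A)).mproper

lemma ftMat_one_sub (A : Matrix n n ℝ) :
    ftMat (1 - (RatFunc.X : RatFunc ℝ)⁻¹ • tfConst A) = 1 := by
  have h := mstrict_inv_X_smul (MProper.tfConst A)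
  rw [ftMat_sub EntriesIn.one h.mproper, h.ftMat_eq, ftMat_one, sub_zero]

lemma one_sub_inv (A : Matrix n n ℝ) :
    (1 - (RatFunc.X : RatFunc ℝ)⁻¹ • tfConst A).det ≠ 0 ∧
      MProper (1 - (RatFunc.X : RatFunc ℝ)⁻¹ • tfConst A)⁻¹ :=
  mproper_inv (mproper_one_sub A) (by rw [ftMat_one_sub, Matrix.det_one]; exact one_ne_zero)

lemma resolvent_det_ne_zero (A : Matrix n n ℝ) :
    ((RatFunc.X : RatFunc ℝ) • (1 : Matrix n n (RatFunc ℝ)) - tfConst A).det ≠ 0 := by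
  rw [resolvent_eq, Matrix.det_smul]
  exact mul_ne_zero (pow_ne_zero _ RatFunc.X_ne_zero) (one_sub_inv A).1

lemma mul_resolvent (A : Matrix n n ℝ) :
    ((RatFunc.X : RatFunc ℝ) • (1 : Matrix n n (RatFunc ℝ)) - tfConst A) * tfResolvent A = 1 :=
  Matrix.mul_nonsing_inv _ (isUnit_iff_ne_zero.2 (resolvent_det_ne_zero A))

lemma resolvent_mul (A : Matrix n n ℝ) :
    tfResolvent A * ((RatFunc.X : RatFunc ℝ) • (1 : Matrix n n (RatFunc ℝ)) - tfConst A) = 1 :=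
  Matrix.nonsing_inv_mul _ (isUnit_iff_ne_zero.2 (resolvent_det_ne_zero A))

lemma X_smul_resolvent (A : Matrix n n ℝ) :
    (RatFunc.X : RatFunc ℝ) • tfResolvent A = (1 - (RatFunc.X : RatFunc ℝ)⁻¹ • tfConst A)⁻¹ := by
  refine (Matrix.inv_eq_right_inv ?_).symm
  rw [Matrix.mul_smul, ← Matrix.smul_mul, ← resolvent_eq, mul_resolvent]

lemma mstrict_resolvent (A : Matrix n n ℝ) : MStrict (tfResolvent A) := by
  unfold MStrict; rw [X_smul_resolvent]; exact (one_sub_inv A).2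

lemma X_smul_resolvent_mul (A : Matrix n n ℝ) :
    ((RatFunc.X : RatFunc ℝ) • tfResolvent A) * (1 - (RatFunc.X : RatFunc ℝ)⁻¹ • tfConst A) = 1 := by
  rw [X_smul_resolvent]
  exact Matrix.nonsing_inv_mul _ (isUnit_iff_ne_zero.2 (one_sub_inv A).1)

lemma ftMat_X_smul_resolvent (A : Matrix n n ℝ) :
    ftMat ((RatFunc.X : RatFunc ℝ) • tfResolvent A) = 1 := by
  have h := congrArg ftMat (X_smul_resolvent_mul A)
  rwa [ftMat_mul (mstrict_resolvent A) (mproper_one_sub A), ftMat_one_sub, mul_one, ftMat_one] at h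

/-- `sI - A` evaluates at `z` to `zI - A`, whose determinant is the characteristic polynomial at
`z`, so `EntriesIn.inv` applies away from the eigenvalues. -/
lemma resolvent_regular (A : Matrix n n ℝ) {z : ℂ} (hz : aeval z A.charpoly ≠ 0) :
    EntriesIn (regularRing z) (tfResolvent A) := by
  have hA : EntriesIn (regularRing z)
      ((RatFunc.X : RatFunc ℝ) • (1 : Matrix n n (RatFunc ℝ)) - tfConst A) :=
    EntriesIn.sub (fun i j => (regularRing z).mul_mem (X_mem_regularRing z) (EntriesIn.one i j))
      (fun i j => const_mem_regularRing _ z)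
  refine (EntriesIn.inv (evalAt z) inv_mem_regularRing hA ?_).2
  have h1 : hA.lift.map (evalAt z) = Matrix.scalar n z - A.map (algebraMap ℝ ℂ) := by
    ext i j
    have e1 : evalAt z ⟨RatFunc.X, X_mem_regularRing z⟩ = z := by
      rw [evalAt_apply]; exact RatFunc.eval_X _ _
    have e2 : ∀ c : ℝ, evalAt z ⟨algebraMap ℝ (RatFunc ℝ) c, const_mem_regularRing c z⟩ = c := by
      intro c
      change RatFunc.eval (algebraMap ℝ ℂ) z (algebraMap ℝ (RatFunc ℝ) c) = c
      rw [RatFunc.algebraMap_eq_C]; exact RatFunc.eval_C _ _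
    have e3 : hA.lift i j = ⟨RatFunc.X, X_mem_regularRing z⟩ * (1 : Matrix n n (regularRing z)) i j
        - ⟨algebraMap ℝ (RatFunc ℝ) (A i j), const_mem_regularRing _ z⟩ := by
      apply Subtype.ext
      simp only [EntriesIn.lift, Matrix.of_apply, Matrix.sub_apply, Matrix.smul_apply, smul_eq_mul,
        tfConst, Matrix.map_apply, AddSubgroupClass.coe_sub, Subring.coe_mul, Matrix.one_apply]
      split_ifs <;> simp
    rw [Matrix.map_apply, e3, map_sub, map_mul, e1, e2]
    simp only [Matrix.one_apply, Matrix.scalar_apply, Matrix.sub_apply, Matrix.diagonal_apply,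
      Matrix.map_apply]
    split_ifs <;> simp
  rw [h1, ← Matrix.eval_charpoly, Matrix.charpoly_map,
    Polynomial.eval_map]
  exact hz

lemma IsHurwitz.mstable_resolvent {A : Matrix n n ℝ} (hA : IsHurwitz A) :
    MStable (tfResolvent A) := fun z hz =>
  resolvent_regular A fun h => absurd (hA z h) (not_lt.2 hz)

end Resolvent


/-! Transfer matrices of the design -/

lemma det_ne_zero_of_rank {n : Type*} [Fintype n] [DecidableEq n] {K : Type*} [Field K]
    (A : Matrix n n K) (h : A.rank = Fintype.card n) : A.det ≠ 0 := by
  have h1 : LinearMap.range A.mulVecLin = ⊤ := by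
    apply Submodule.eq_top_of_finrank_eq
    rw [Module.finrank_fintype_fun_eq_card]; exact h
  have h2 : Function.Surjective A.mulVec := LinearMap.range_eq_top.1 h1
  have h3 := (Matrix.isUnit_iff_isUnit_det A).1 (Matrix.mulVec_surjective_iff_isUnit.1 h2)
  exact h3.ne_zero

namespace L1Design

variable {np k no : ℕ} {d : L1Design np k no}

/-- `M⁻¹ P - 1` -/
def Zm (d : L1Design np k no) : Matrix (Fin 2) (Fin 2) (RatFunc ℝ) := d.M⁻¹ * d.P - 1

/-- `M⁻¹ H_in` -/
def Vin (d : L1Design np k no) : Matrix (Fin 2) (Fin np) (RatFunc ℝ) := d.M⁻¹ * d.Hin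

lemma R_strict : MStrict d.R := mstrict_resolvent _

lemma H₀_strict : MStrict d.H₀ := R_strict.mul (MProper.tfConst _)

lemma P_eq : d.P = tfConst d.Cp * d.H₀ := Matrix.mul_assoc _ _ _

lemma P_strict : MStrict d.P := by
  rw [P_eq]; exact MStrict.mul_left (MProper.tfConst _) H₀_strict

lemma M_strict : MStrict d.M :=
  (MStrict.mul_left (MProper.tfConst _) (mstrict_resolvent _)).mul (MProper.tfConst _)

lemma X_smul_tfOf {m n p : Type*} [Fintype n] [DecidableEq n] [Fintype p]
    (A : Matrix n n ℝ) (B : Matrix n p ℝ) (C : Matrix m n ℝ) :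
    (RatFunc.X : RatFunc ℝ) • tfOf A B C =
      tfConst C * ((RatFunc.X : RatFunc ℝ) • tfResolvent A) * tfConst B := by
  rw [tfOf, Matrix.mul_smul, Matrix.smul_mul]

/-- The leading coefficient of `M` at infinity. Its nonsingularity means that `M⁻¹` is improper by
exactly one power of `s`, which any strictly proper factor compensates. -/
lemma ftMat_X_smul_M : ftMat ((RatFunc.X : RatFunc ℝ) • d.M) = d.Cm * d.Bm := by
  have h : MProper ((RatFunc.X : RatFunc ℝ) • tfResolvent d.Am) := mstrict_resolvent d.Am
  rw [M, X_smul_tfOf, ftMat_mul (EntriesIn.mul (MProper.tfConst _) h) (MProper.tfConst _),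
    ftMat_mul (MProper.tfConst _) h, ftMat_X_smul_resolvent, ftMat_tfConst, ftMat_tfConst,
    Matrix.mul_one]

lemma H₂_eq : d.H₂ = d.H₀ - d.H₀ * d.Cf * (d.H₁ * d.Zm) := by
  rw [H₂, Zm, ← Matrix.mul_assoc (d.H₀ * d.Cf)]

lemma G_eq : d.G = d.H₀ - d.H₀ * d.Cf * (d.H₁ * (d.M⁻¹ * d.P)) := by
  rw [G, H₅]; simp only [Matrix.mul_assoc]

lemma H₅Hin_eq : d.H₅ * d.Hin = d.H₀ * d.Cf * (d.H₁ * d.Vin) := by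
  rw [H₅, Vin]; simp only [Matrix.mul_assoc]

namespace Admissible

variable (hd : d.Admissible)
include hd

lemma filter_proper : MProper d.Cf := fun i j => (hd.filter_strictlyProper i j).le

lemma filter_strict : MStrict d.Cf := fun i j =>
  X_mul_mem_properRing (hd.filter_strictlyProper i j)

lemma filter_mstable : MStable d.Cf := fun z hz i j =>
  ratStable_iff.1 (hd.filter_stable i j) z hz

lemma XM_inv : ((RatFunc.X : RatFunc ℝ) • d.M).det ≠ 0 ∧
    MProper ((RatFunc.X : RatFunc ℝ) • d.M)⁻¹ :=
  mproper_inv M_strict (by rw [ftMat_X_smul_M]; exact hd.nonsingular.ne_zero)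

lemma M_det : d.M.det ≠ 0 := by
  have h := hd.XM_inv.1
  rw [Matrix.det_smul] at h
  exact (mul_ne_zero_iff.1 h).2

lemma M_mul_inv : d.M * d.M⁻¹ = 1 := Matrix.mul_nonsing_inv _ (isUnit_iff_ne_zero.2 hd.M_det)

lemma M_inv_mul : d.M⁻¹ * d.M = 1 := Matrix.nonsing_inv_mul _ (isUnit_iff_ne_zero.2 hd.M_det)

lemma M_inv_eq : d.M⁻¹ = (RatFunc.X : RatFunc ℝ) • ((RatFunc.X : RatFunc ℝ) • d.M)⁻¹ := by
  refine Matrix.inv_eq_right_inv ?_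
  rw [Matrix.mul_smul, ← Matrix.smul_mul]
  exact Matrix.mul_nonsing_inv _ (isUnit_iff_ne_zero.2 hd.XM_inv.1)

lemma M_inv_mul_proper {p : Type*} {G : Matrix (Fin 2) p (RatFunc ℝ)} (hG : MStrict G) :
    MProper (d.M⁻¹ * G) := by
  rw [hd.M_inv_eq, Matrix.smul_mul, ← Matrix.mul_smul]
  exact EntriesIn.mul hd.XM_inv.2 hG

lemma M_stable : MStable d.M :=
  ((MStable.tfConst _).mul hd.hurwitz_m.mstable_resolvent).mul (MStable.tfConst _)

/-- `M` has full normal rank, so the absence of a transmission zero at `z` says that `M(z)` is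
invertible; `EntriesIn.inv` then excludes a pole of `M⁻¹`. -/
lemma M_inv_stable : MStable d.M⁻¹ := fun z hz => by
  have hM := hd.M_stable z hz
  refine (EntriesIn.inv (evalAt z) inv_mem_regularRing hM ?_).2
  have h1 : hM.lift.map (evalAt z) = d.M.map (RatFunc.eval (algebraMap ℝ ℂ) z) := rfl
  rw [h1]
  apply det_ne_zero_of_rank
  have h2 := hd.minimumPhase z hz
  unfold IsTransmissionZero at h2
  have h3 : d.M.rank = Fintype.card (Fin 2) :=
    Matrix.rank_of_isUnit _ ((Matrix.isUnit_iff_isUnit_det _).2 (isUnit_iff_ne_zero.2 hd.M_det))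
  rw [h3, not_lt] at h2
  exact le_antisymm (Matrix.rank_le_card_width _) h2

lemma R_stable : MStable d.R := hd.hurwitz_K.mstable_resolvent

lemma H₀_stable : MStable d.H₀ := hd.R_stable.mul (MStable.tfConst _)

lemma P_stable : MStable d.P := by
  rw [P_eq]; exact (MStable.tfConst _).mul hd.H₀_stable

lemma MP_proper : MProper (d.M⁻¹ * d.P) := hd.M_inv_mul_proper P_strict

lemma MP_stable : MStable (d.M⁻¹ * d.P) := hd.M_inv_stable.mul hd.P_stable

lemma Zm_proper : MProper d.Zm := hd.MP_proper.sub EntriesIn.one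

lemma Zm_stable : MStable d.Zm := hd.MP_stable.sub MStable.one

lemma ZC_proper : MProper (1 + d.Zm * d.Cf) :=
  EntriesIn.one.add (hd.Zm_proper.mul hd.filter_proper)

/-- The filter is strictly proper, so the loop matrix is `I` at infinity. This makes it invertible
and `H₁` proper. -/
lemma ftMat_ZC : ftMat (1 + d.Zm * d.Cf) = 1 := by
  rw [ftMat_add EntriesIn.one (hd.Zm_proper.mul hd.filter_proper),
    ftMat_mul hd.Zm_proper hd.filter_proper, hd.filter_strict.ftMat_eq, ftMat_one, Matrix.mul_zero,
    add_zero]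

lemma ZC_det : (1 + d.Zm * d.Cf).det ≠ 0 :=
  (mproper_inv hd.ZC_proper (by rw [hd.ftMat_ZC, Matrix.det_one]; exact one_ne_zero)).1

lemma H₁_proper : MProper d.H₁ :=
  (mproper_inv hd.ZC_proper (by rw [hd.ftMat_ZC, Matrix.det_one]; exact one_ne_zero)).2

lemma H₁_mul : d.H₁ * (1 + d.Zm * d.Cf) = 1 :=
  Matrix.nonsing_inv_mul _ (isUnit_iff_ne_zero.2 hd.ZC_det)

/-- Factoring `M` out of `(P - M) C + M` expresses the operators of the reference system through
`H₁`, the only loop inverse that is assumed stable. -/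
lemma N_eq : d.N = d.H₁ * d.M⁻¹ := by
  have h : (d.P - d.M) * d.Cf + d.M = d.M * (1 + d.Zm * d.Cf) := by
    rw [Zm, Matrix.mul_add, Matrix.mul_one, ← Matrix.mul_assoc, Matrix.mul_sub, ← Matrix.mul_assoc,
      hd.M_mul_inv, Matrix.one_mul, Matrix.mul_one, add_comm]
  rw [N, h, Matrix.mul_inv_rev]; rfl

/-- Nonsingularity of `C_m B_m` forces `C_m` to have full row rank. -/
lemma cm_mul_pinv : d.Cm * rightPinv d.Cm = 1 := by
  have h1 : d.Cm.rank = Fintype.card (Fin 2) := by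
    refine le_antisymm (Matrix.rank_le_card_height _) ?_
    rw [← Matrix.rank_of_isUnit _ ((Matrix.isUnit_iff_isUnit_det _).2 hd.nonsingular)]
    exact Matrix.rank_mul_le_left _ _
  have h2 := det_ne_zero_of_rank (d.Cm * d.Cm.transpose) (by
    rw [Matrix.rank_self_mul_transpose, h1])
  rw [rightPinv, ← Matrix.mul_assoc]
  exact Matrix.mul_nonsing_inv _ (isUnit_iff_ne_zero.2 h2)

/-- The coefficients of `1/s` in the two parts of `H_in` are `C_p` and `C_m C_m† C_p`, and they
cancel. This is the effect of starting the predictor at `C_m† y(0)`, and it leaves `M⁻¹ H_in`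
strictly proper. -/
lemma XHin : MStrict ((RatFunc.X : RatFunc ℝ) • d.Hin) := by
  have e : (RatFunc.X : RatFunc ℝ) • d.Hin =
      tfConst d.Cp * ((RatFunc.X : RatFunc ℝ) • d.R) - tfConst d.Cm *
        ((RatFunc.X : RatFunc ℝ) • tfResolvent d.Am) * tfConst (rightPinv d.Cm * d.Cp) := by
    rw [Hin, smul_sub, Matrix.mul_smul, Matrix.mul_smul, Matrix.smul_mul]
  have hR : MProper ((RatFunc.X : RatFunc ℝ) • d.R) := R_strict
  have hA : MProper ((RatFunc.X : RatFunc ℝ) • tfResolvent d.Am) := mstrict_resolvent d.Am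
  have h1 : MProper (tfConst d.Cp * ((RatFunc.X : RatFunc ℝ) • d.R)) :=
    (MProper.tfConst _).mul hR
  have h2 : MProper (tfConst d.Cm * ((RatFunc.X : RatFunc ℝ) • tfResolvent d.Am)) :=
    (MProper.tfConst _).mul hA
  rw [mstrict_iff, e]
  refine ⟨h1.sub (h2.mul (MProper.tfConst _)), ?_⟩
  have hRf : ftMat ((RatFunc.X : RatFunc ℝ) • d.R) = 1 := ftMat_X_smul_resolvent _
  rw [ftMat_sub h1 (h2.mul (MProper.tfConst _)), ftMat_mul (MProper.tfConst _) hR,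
    ftMat_mul h2 (MProper.tfConst _), ftMat_mul (MProper.tfConst _) hA, hRf,
    ftMat_X_smul_resolvent, ftMat_tfConst, ftMat_tfConst, ftMat_tfConst, Matrix.mul_one,
    Matrix.mul_one, ← Matrix.mul_assoc, hd.cm_mul_pinv, Matrix.one_mul, sub_self]

lemma Hin_stable : MStable d.Hin :=
  ((MStable.tfConst _).mul hd.R_stable).sub
    (((MStable.tfConst _).mul hd.hurwitz_m.mstable_resolvent).mul (MStable.tfConst _))

lemma Vin_strict : MStrict d.Vin := by
  unfold MStrict; rw [Vin, ← Matrix.mul_smul]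
  exact hd.M_inv_mul_proper hd.XHin

lemma Vin_stable : MStable d.Vin := hd.M_inv_stable.mul hd.Hin_stable

lemma O_stable : MStable d.O :=
  ((hd.filter_mstable.mul hd.M_inv_stable).mul (MStable.tfConst _)).mul
    hd.hurwitz_m.mstable_resolvent

lemma H₅Hin_strict : MStrict (d.H₅ * d.Hin) := by
  rw [H₅Hin_eq]
  exact (H₀_strict.mul hd.filter_proper).mul (hd.H₁_proper.mul hd.Vin_strict.mproper)

lemma H₂_proper : MProper d.H₂ := by
  rw [H₂_eq]
  exact H₀_strict.mproper.sub
    ((H₀_strict.mproper.mul hd.filter_proper).mul (hd.H₁_proper.mul hd.Zm_proper))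

lemma G_proper : MProper d.G := by
  rw [G_eq]
  exact H₀_strict.mproper.sub
    ((H₀_strict.mproper.mul hd.filter_proper).mul (hd.H₁_proper.mul hd.MP_proper))

end Admissible

end L1Design


/-! Laplace transforms of continuous functions of exponential growth -/

/-- The Laplace transform. -/
def laplace (g : ℝ → ℂ) (s : ℂ) : ℂ := ∫ t in Set.Ioi (0 : ℝ), Complex.exp (-(s * t)) * g t

/-- `g` is continuous and grows on `[0, ∞)` at most like `e^{a t}` for some `a < σ`. -/
def ExpBounded (σ : ℝ) (g : ℝ → ℂ) : Prop :=
  Continuous g ∧ ∃ C a : ℝ, 0 ≤ C ∧ a < σ ∧ ∀ t, 0 ≤ t → ‖g t‖ ≤ C * Real.exp (a * t)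

lemma ExpBounded.integrableOn {σ : ℝ} {g : ℝ → ℂ} (hg : ExpBounded σ g) {s : ℂ} (hs : σ ≤ s.re) :
    IntegrableOn (fun t : ℝ => Complex.exp (-(s * t)) * g t) (Set.Ioi 0) := by
  obtain ⟨hc, C, a, hC, ha, hb⟩ := hg
  have h1 : IntegrableOn (fun t : ℝ => C * Real.exp ((a - s.re) * t)) (Set.Ioi 0) :=
    (integrableOn_exp_mul_Ioi (by linarith) 0).const_mul C
  refine Integrable.mono' h1 ?_ ?_
  · exact (by fun_prop : Continuous fun t : ℝ => Complex.exp (-(s * t)) * g t).aestronglyMeasurable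
  · refine (ae_restrict_mem measurableSet_Ioi).mono fun t ht => ?_
    have ht' : (0 : ℝ) < t := ht
    rw [norm_mul, Complex.norm_exp]
    have e : (-(s * t)).re = -s.re * t := by simp
    rw [e]
    calc Real.exp (-s.re * t) * ‖g t‖ ≤ Real.exp (-s.re * t) * (C * Real.exp (a * t)) := by
          gcongr; exact hb t ht'.le
      _ = C * Real.exp ((a - s.re) * t) := by
          rw [mul_left_comm, ← Real.exp_add]; congr 2; ring

lemma ExpBounded.add {σ : ℝ} {f g : ℝ → ℂ} (hf : ExpBounded σ f) (hg : ExpBounded σ g) :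
    ExpBounded σ fun t => f t + g t := by
  obtain ⟨hfc, C, a, hC, ha, hb⟩ := hf
  obtain ⟨hgc, C', a', hC', ha', hb'⟩ := hg
  refine ⟨hfc.add hgc, C + C', max a a', by positivity, max_lt ha ha', fun t ht => ?_⟩
  refine (norm_add_le _ _).trans ?_
  rw [add_mul]
  have h1 : a * t ≤ max a a' * t := by gcongr; exact le_max_left _ _
  have h2 : a' * t ≤ max a a' * t := by gcongr; exact le_max_right _ _
  gcongr
  · exact (hb t ht).trans (by gcongr)
  · exact (hb' t ht).trans (by gcongr)

lemma ExpBounded.const_mul {σ : ℝ} {f : ℝ → ℂ} (hf : ExpBounded σ f) (c : ℂ) :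
    ExpBounded σ fun t => c * f t := by
  obtain ⟨hfc, C, a, hC, ha, hb⟩ := hf
  refine ⟨hfc.const_mul c, ‖c‖ * C, a, by positivity, ha, fun t ht => ?_⟩
  rw [norm_mul, mul_assoc]
  gcongr; exact hb t ht

lemma ExpBounded.conv {σ : ℝ} {f g : ℝ → ℂ} (hf : ExpBounded σ f) (hg : ExpBounded σ g) :
    ExpBounded σ fun t => ∫ τ in (0 : ℝ)..t, f τ * g (t - τ) := by
  obtain ⟨hfc, C, a, hC, ha, hb⟩ := hf
  obtain ⟨hgc, C', a', hC', ha', hb'⟩ := hg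
  refine ⟨intervalIntegral.continuous_parametric_intervalIntegral_of_continuous
    (f := fun t τ => f τ * g (t - τ)) (by unfold Function.uncurry; fun_prop) continuous_id, ?_⟩
  set m := max a a' with hm
  have hmσ : m < σ := max_lt ha ha'
  -- If both factors grow at the rate `m`, the convolution carries an extra factor `t`. A slightly
  -- larger rate, still below `σ`, absorbs it.
  set m' := (m + σ) / 2 with hm'
  have h1 : m < m' := by rw [hm']; linarith
  have h2 : m' < σ := by rw [hm']; linarith
  refine ⟨C * C' / (m' - m), m', by have := sub_pos.2 h1; positivity, h2, fun t ht => ?_⟩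
  have h3 : ‖∫ τ in (0 : ℝ)..t, f τ * g (t - τ)‖ ≤ C * C' * Real.exp (m * t) * |t - 0| := by
    refine intervalIntegral.norm_integral_le_of_norm_le_const fun τ hτ => ?_
    rw [Set.uIoc_of_le ht] at hτ
    have h4 : 0 ≤ t - τ := sub_nonneg.2 hτ.2
    have h5 : a * τ ≤ m * τ := by have := hτ.1.le; gcongr; exact le_max_left _ _
    have h6 : a' * (t - τ) ≤ m * (t - τ) := by gcongr; exact le_max_right _ _
    calc ‖f τ * g (t - τ)‖ = ‖f τ‖ * ‖g (t - τ)‖ := norm_mul _ _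
      _ ≤ (C * Real.exp (m * τ)) * (C' * Real.exp (m * (t - τ))) := by
          gcongr
          · exact (hb τ hτ.1.le).trans (by gcongr)
          · exact (hb' _ h4).trans (by gcongr)
      _ = C * C' * (Real.exp (m * τ) * Real.exp (m * (t - τ))) := by ring
      _ = C * C' * Real.exp (m * t) := by rw [← Real.exp_add]; congr 2; ring
  refine h3.trans ?_
  rw [sub_zero, abs_of_nonneg ht]
  have h7 : (m' - m) * t ≤ Real.exp ((m' - m) * t) := by
    have := Real.add_one_le_exp ((m' - m) * t); linarith
  have h8 : Real.exp (m' * t) = Real.exp (m * t) * Real.exp ((m' - m) * t) := by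
    rw [← Real.exp_add]; congr 1; ring
  rw [h8]
  have h9 : 0 < m' - m := sub_pos.2 h1
  calc C * C' * Real.exp (m * t) * t
      = C * C' / (m' - m) * Real.exp (m * t) * ((m' - m) * t) := by field_simp
    _ ≤ C * C' / (m' - m) * Real.exp (m * t) * Real.exp ((m' - m) * t) := by gcongr
    _ = _ := by ring

lemma laplace_conv {f g : ℝ → ℂ} {s : ℂ}
    (hf : IntegrableOn (fun t : ℝ => Complex.exp (-(s * t)) * f t) (Set.Ioi 0))
    (hg : IntegrableOn (fun t : ℝ => Complex.exp (-(s * t)) * g t) (Set.Ioi 0)) :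
    laplace (fun t => ∫ τ in (0 : ℝ)..t, f τ * g (t - τ)) s = laplace f s * laplace g s := by
  have h := integral_posConvolution hf hg (ContinuousLinearMap.mul ℝ ℂ)
  simp only [ContinuousLinearMap.mul_apply'] at h
  unfold laplace
  rw [← h]
  refine integral_congr_ae (Eventually.of_forall fun x => ?_)
  beta_reduce
  rw [← intervalIntegral.integral_const_mul]
  refine intervalIntegral.integral_congr fun τ _ => ?_
  have : Complex.exp (-(s * x)) = Complex.exp (-(s * τ)) * Complex.exp (-(s * ((x - τ : ℝ) : ℂ))) := by
    rw [← Complex.exp_add]; congr 1; push_cast; ring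
  rw [this]; ring

lemma laplace_add {σ : ℝ} {f g : ℝ → ℂ} (hf : ExpBounded σ f) (hg : ExpBounded σ g) {s : ℂ}
    (hs : σ ≤ s.re) : laplace (fun t => f t + g t) s = laplace f s + laplace g s := by
  unfold laplace
  rw [← integral_add (hf.integrableOn hs) (hg.integrableOn hs)]
  simp only [mul_add]

lemma laplace_const_mul (c : ℂ) (f : ℝ → ℂ) (s : ℂ) :
    laplace (fun t => c * f t) s = c * laplace f s := by
  unfold laplace
  rw [← integral_const_mul]
  simp only [mul_left_comm]

lemma expBounded_exp {σ : ℝ} {l : ℂ} (h : l.re < σ) :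
    ExpBounded σ fun t : ℝ => Complex.exp (l * t) := by
  refine ⟨by fun_prop, 1, l.re, zero_le_one, h, fun t _ => ?_⟩
  rw [Complex.norm_exp]; simp

lemma laplace_exp {l s : ℂ} (h : l.re < s.re) :
    laplace (fun t : ℝ => Complex.exp (l * t)) s = (s - l)⁻¹ := by
  unfold laplace
  have e : ∀ t : ℝ, Complex.exp (-(s * t)) * Complex.exp (l * t) = Complex.exp ((l - s) * t) := by
    intro t; rw [← Complex.exp_add]; congr 1; ring
  simp_rw [e]
  rw [integral_exp_mul_complex_Ioi (by simpa using h)]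
  simp only [Complex.ofReal_zero, mul_zero, Complex.exp_zero]
  rw [← neg_sub s l, neg_div_neg_eq, one_div]

/-- A strictly proper complex rational function whose poles satisfy `Re < σ` is the Laplace
transform of a function of growth rate less than `σ`. -/
lemma exists_laplace_eq (σ : ℝ) (l : Multiset ℂ) (hl : ∀ z ∈ l, z.re < σ) (p : ℂ[X])
    (hp : p.degree < Multiset.card l) :
    ∃ g, ExpBounded σ g ∧ ∀ s : ℂ, σ ≤ s.re →
      laplace g s = p.eval s / ((l.map fun z => X - C z).prod).eval s := by
  induction l using Multiset.induction_on generalizing p with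
  | empty =>
    have : p = 0 := by simpa using hp
    refine ⟨fun _ => 0, ⟨continuous_const, 0, σ - 1, le_rfl, by linarith, by simp⟩, ?_⟩
    intro s _; simp [laplace, this]
  | cons z l ih =>
    set q := (l.map fun z => X - C z).prod with hq
    have hqm : q.Monic := monic_multiset_prod_of_monic _ _ fun z _ => monic_X_sub_C z
    have hqd : q.natDegree = Multiset.card l := by
      rw [hq, natDegree_multiset_prod_X_sub_C_eq_card]
    have hqd' : q.degree = Multiset.card l := by
      rw [degree_eq_natDegree hqm.ne_zero, hqd]
    -- Division with remainder `p = p %ₘ q + c q`, with a constant `c`, gives `p / ((s - z) q) = c /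
    -- (s - z) + ((p %ₘ q) / q) / (s - z)`: a multiple of the exponential `e^{zt}` plus the
    -- convolution of the inductive solution with it.
    obtain ⟨g, hg, hgl⟩ := ih (fun w hw => hl w (Multiset.mem_cons_of_mem hw)) (p %ₘ q)
      (by rw [← hqd']; exact degree_modByMonic_lt p hqm)
    have hz : z.re < σ := hl z (Multiset.mem_cons_self z l)
    have hdiv : (p /ₘ q).natDegree = 0 := by
      rw [natDegree_divByMonic p hqm, hqd]
      have : p.natDegree < Multiset.card l + 1 ∨ p = 0 := by
        by_cases h0 : p = 0
        · exact Or.inr h0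
        · left
          rw [degree_eq_natDegree h0, Multiset.card_cons] at hp
          exact_mod_cast hp
      rcases this with h | h
      · omega
      · rw [h]; simp
    rw [natDegree_eq_zero] at hdiv
    obtain ⟨c, hc⟩ := hdiv
    have hpe : ∀ s, p.eval s = (p %ₘ q).eval s + q.eval s * c := by
      intro s
      conv_lhs => rw [← modByMonic_add_div p q, ← hc]
      simp
    have hez := expBounded_exp hz
    refine ⟨fun t => c * Complex.exp (z * t) + ∫ τ in (0 : ℝ)..t, g τ * Complex.exp (z * (t - τ : ℝ)),
      (hez.const_mul c).add (hg.conv hez), fun s hs => ?_⟩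
    rw [laplace_add (hez.const_mul c) (hg.conv hez) hs, laplace_const_mul,
      laplace_conv (hg.integrableOn hs) (hez.integrableOn hs), hgl s hs,
      laplace_exp (hz.trans_le hs), Multiset.map_cons, Multiset.prod_cons, ← hq, eval_mul, hpe s]
    have h1 : s - z ≠ 0 := by
      intro h; have := congrArg Complex.re h; simp at this; linarith
    have h2 : q.eval s ≠ 0 := by
      rw [hq, eval_multiset_prod, Multiset.map_map]
      refine Multiset.prod_ne_zero fun h0 => ?_
      obtain ⟨w, hw, hw0⟩ := Multiset.mem_map.1 h0
      simp only [Function.comp_apply, eval_sub, eval_X, eval_C] at hw0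
      have := hl w (Multiset.mem_cons_of_mem hw)
      have := congrArg Complex.re hw0; simp at this; linarith
    simp only [eval_sub, eval_X, eval_C]
    field_simp
    ring

/-! Existence and uniqueness of impulse responses -/

lemma eval_conj (r : RatFunc ℝ) (s : ℂ) :
    RatFunc.eval (algebraMap ℝ ℂ) (starRingEnd ℂ s) r =
      starRingEnd ℂ (RatFunc.eval (algebraMap ℝ ℂ) s r) := by
  have h : (starRingEnd ℂ).comp (algebraMap ℝ ℂ) = algebraMap ℝ ℂ := by
    ext x; simp
  rw [RatFunc.eval, RatFunc.eval, map_div₀, Polynomial.hom_eval₂, Polynomial.hom_eval₂, h]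

/-- A continuous function of growth rate less than `σ` whose Laplace transform is `r - r(∞)`. -/
def IsNiceImpulse (σ : ℝ) (r : RatFunc ℝ) (g : ℝ → ℝ) : Prop :=
  ExpBounded σ (fun t => (g t : ℂ)) ∧ ∀ s : ℂ, σ ≤ s.re →
    laplace (fun t => (g t : ℂ)) s =
      RatFunc.eval (algebraMap ℝ ℂ) s r - (ratFeedthrough r : ℂ)

lemma IsNiceImpulse.isImpulseResponse {σ : ℝ} {r : RatFunc ℝ} {g : ℝ → ℝ}
    (h : IsNiceImpulse σ r g) : IsImpulseResponse r g := by
  refine ⟨?_, σ, fun s hs => ⟨h.1.integrableOn hs.le, h.2 s hs.le⟩⟩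
  have := Complex.continuous_re.comp h.1.1
  exact Continuous.continuousOn this


/-- Splitting the denominator over `ℂ` gives a complex function with transform `r - r(∞)`. As `r` is
real, the conjugate function has the same transform, so the real part is a representative too. -/
lemma exists_niceImpulse {σ : ℝ} {r : RatFunc ℝ} (hr : RatProper r)
    (hσ : ∀ z : ℂ, aeval z r.denom = 0 → z.re < σ) : ∃ g, IsNiceImpulse σ r g := by
  set q := r.denom.map (algebraMap ℝ ℂ) with hq
  have hqm : q.Monic := (RatFunc.monic_denom r).map _
  set p₀ := r.num - C (ratFeedthrough r) * r.denom with hp₀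
  have hp₀d : p₀.degree < r.denom.natDegree := by
    rw [degree_lt_iff_coeff_zero]
    intro m hm
    rcases hm.lt_or_eq with h | h
    · have h1 : r.num.coeff m = 0 := by
        refine coeff_eq_zero_of_degree_lt (lt_of_le_of_lt hr ?_)
        rw [degree_eq_natDegree r.denom_ne_zero]; exact_mod_cast h
      rw [hp₀, coeff_sub, coeff_C_mul, h1, coeff_eq_zero_of_natDegree_lt h]; simp
    · rw [hp₀, coeff_sub, coeff_C_mul, ← h, coeff_natDegree, (RatFunc.monic_denom r).leadingCoeff]
      simp [ratFeedthrough]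
  have hsplit := IsAlgClosed.splits q
  have hqr : q = (q.roots.map fun z => X - C z).prod := hsplit.eq_prod_roots_of_monic hqm
  have hcard : Multiset.card q.roots = r.denom.natDegree := by
    rw [← hsplit.natDegree_eq_card_roots, hq, natDegree_map]
  have hroots : ∀ z ∈ q.roots, z.re < σ := by
    intro z hz
    refine hσ z ?_
    have := (mem_roots'.1 hz).2
    rwa [hq, IsRoot, eval_map] at this
  obtain ⟨g, hg, hgl⟩ := exists_laplace_eq σ q.roots hroots (p₀.map (algebraMap ℝ ℂ))
    (by rw [degree_map, hcard]; exact hp₀d)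
  have hgl' : ∀ s : ℂ, σ ≤ s.re → laplace g s =
      RatFunc.eval (algebraMap ℝ ℂ) s r - (ratFeedthrough r : ℂ) := by
    intro s hs
    rw [hgl s hs, ← hqr, hq, eval_map, eval_map, RatFunc.eval, hp₀, eval₂_sub, eval₂_mul, eval₂_C]
    have : eval₂ (algebraMap ℝ ℂ) s r.denom ≠ 0 := fun h => absurd (hσ s h) (not_lt.2 hs)
    field_simp
    rw [Complex.coe_algebraMap, mul_comm (eval₂ _ _ r.denom)]
  have hconj : ExpBounded σ fun t => starRingEnd ℂ (g t) := by
    obtain ⟨hc, C, a, hC, ha, hb⟩ := hg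
    exact ⟨Complex.continuous_conj.comp hc, C, a, hC, ha, fun t ht => by
      rw [Complex.norm_conj]; exact hb t ht⟩
  have hre : (fun t => (((g t).re : ℝ) : ℂ)) =
      fun t => (1 / 2 : ℂ) * g t + (1 / 2 : ℂ) * starRingEnd ℂ (g t) := by
    ext t
    have := Complex.add_conj (g t)
    rw [← mul_add, this]; push_cast; ring
  refine ⟨fun t => (g t).re, ?_, fun s hs => ?_⟩
  · rw [hre]; exact (hg.const_mul _).add (hconj.const_mul _)
  · rw [hre, laplace_add (hg.const_mul _) (hconj.const_mul _) hs, laplace_const_mul,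
      laplace_const_mul]
    have h1 : laplace (fun t => starRingEnd ℂ (g t)) s =
        starRingEnd ℂ (laplace g (starRingEnd ℂ s)) := by
      unfold laplace
      rw [← integral_conj]
      refine integral_congr_ae (Eventually.of_forall fun t => ?_)
      simp only [map_mul, ← Complex.exp_conj, map_neg, Complex.conj_conj, Complex.conj_ofReal]
    rw [h1, hgl' s hs, hgl' _ (by simpa using hs), eval_conj, map_sub, Complex.conj_conj,
      Complex.conj_ofReal]
    ring

lemma exists_pole_bound (r : RatFunc ℝ) :
    ∃ σ : ℝ, ∀ z : ℂ, aeval z r.denom = 0 → z.re < σ := by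
  have hfin : (r.denom.rootSet ℂ).Finite := rootSet_finite _ _
  obtain ⟨B, hB⟩ := (hfin.image Complex.re).bddAbove
  refine ⟨B + 1, fun z hz => ?_⟩
  have : z.re ≤ B := hB ⟨z, (mem_rootSet).2 ⟨r.denom_ne_zero, hz⟩, rfl⟩
  linarith

/-- On a vertical line `Re s = a` the transform of `g₁ - g₂` is the Fourier transform of `e^{-at}
(g₁ - g₂)` on the half line. It vanishes, and Fourier inversion at the points of continuity `t > 0`
gives equality there; `t = 0` follows by right continuity. -/
lemma isImpulseResponse_unique {r : RatFunc ℝ} {g₁ g₂ : ℝ → ℝ} (h₁ : IsImpulseResponse r g₁)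
    (h₂ : IsImpulseResponse r g₂) : Set.EqOn g₁ g₂ (Set.Ici 0) := by
  obtain ⟨hc₁, a₁, h₁⟩ := h₁
  obtain ⟨hc₂, a₂, h₂⟩ := h₂
  set a := max a₁ a₂ + 1 with ha
  have ha₁ : a₁ < a := by have := le_max_left a₁ a₂; linarith
  have ha₂ : a₂ < a := by have := le_max_right a₁ a₂; linarith
  set h : ℝ → ℂ := Set.indicator (Set.Ioi 0)
    (fun t => Complex.exp (-((a : ℂ) * t)) * ((g₁ t : ℂ) - g₂ t)) with hh
  have key : ∀ s : ℂ, a ≤ s.re →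
      IntegrableOn (fun t : ℝ => Complex.exp (-(s * t)) * ((g₁ t : ℂ) - g₂ t)) (Set.Ioi 0) ∧
      ∫ t in Set.Ioi (0 : ℝ), Complex.exp (-(s * t)) * ((g₁ t : ℂ) - g₂ t) = 0 := by
    intro s hs
    obtain ⟨i₁, e₁⟩ := h₁ s (by linarith)
    obtain ⟨i₂, e₂⟩ := h₂ s (by linarith)
    simp only [mul_sub]
    exact ⟨i₁.sub i₂, by rw [integral_sub i₁ i₂, e₁, e₂, sub_self]⟩
  have hint : Integrable h := by
    rw [hh, integrable_indicator_iff measurableSet_Ioi]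
    exact (key (a : ℂ) (by simp)).1
  have hF : FourierTransform.fourier h = (0 : ℝ → ℂ) := by
    ext w
    rw [Real.fourier_real_eq_integral_exp_smul]
    have e : ∀ v : ℝ, Complex.exp (↑(-2 * Real.pi * v * w) * Complex.I) • h v =
        Set.indicator (Set.Ioi 0) (fun t : ℝ =>
          Complex.exp (-(((a : ℂ) + 2 * Real.pi * w * Complex.I) * t)) *
            ((g₁ t : ℂ) - g₂ t)) v := by
      intro v
      rw [hh]
      by_cases hv : v ∈ Set.Ioi (0 : ℝ)
      · rw [Set.indicator_of_mem hv, Set.indicator_of_mem hv, smul_eq_mul, ← mul_assoc,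
          ← Complex.exp_add]
        congr 2; push_cast; ring
      · rw [Set.indicator_of_notMem hv, Set.indicator_of_notMem hv, smul_zero]
    simp_rw [e]
    rw [integral_indicator measurableSet_Ioi]
    exact (key _ (by simp)).2
  have hzero : ∀ t : ℝ, 0 < t → g₁ t = g₂ t := by
    intro t ht
    have hct : ContinuousAt h t := by
      have hnhds : Set.Ioi (0 : ℝ) ∈ 𝓝 t := Ioi_mem_nhds ht
      have hI : Set.Ici (0 : ℝ) ∈ 𝓝 t := Ici_mem_nhds ht
      have hc1 : ContinuousAt g₁ t := hc₁.continuousAt hI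
      have hc2 : ContinuousAt g₂ t := hc₂.continuousAt hI
      have hcc : ContinuousAt
          (fun t : ℝ => Complex.exp (-((a : ℂ) * t)) * ((g₁ t : ℂ) - g₂ t)) t := by fun_prop
      refine hcc.congr ?_
      filter_upwards [hnhds] with v hv
      rw [hh, Set.indicator_of_mem hv]
    have hinv := hint.fourierInv_fourier_eq (by rw [hF]; exact integrable_zero _ _ _) hct
    rw [hF, hh, Set.indicator_of_mem (show t ∈ Set.Ioi (0 : ℝ) from ht)] at hinv
    have h0 : FourierTransformInv.fourierInv (0 : ℝ → ℂ) t = 0 := by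
      rw [Real.fourierInv_eq]; simp
    rw [h0] at hinv
    have h1 := (mul_eq_zero.1 hinv.symm).resolve_left (Complex.exp_ne_zero _)
    exact_mod_cast sub_eq_zero.1 h1
  intro t ht
  rcases eq_or_lt_of_le (show (0 : ℝ) ≤ t from ht) with h0 | h0
  · rw [← h0]
    have t1 : Tendsto g₁ (𝓝[>] 0) (𝓝 (g₁ 0)) :=
      (hc₁ 0 Set.self_mem_Ici).mono_left (nhdsWithin_mono _ Set.Ioi_subset_Ici_self)
    have t2 : Tendsto g₂ (𝓝[>] 0) (𝓝 (g₂ 0)) :=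
      (hc₂ 0 Set.self_mem_Ici).mono_left (nhdsWithin_mono _ Set.Ioi_subset_Ici_self)
    refine tendsto_nhds_unique t1 (t2.congr' ?_)
    filter_upwards [self_mem_nhdsWithin] with v hv
    exact (hzero v hv).symm
  · exact hzero t h0

lemma ratImpulse_spec {r : RatFunc ℝ} (hr : RatProper r) : IsImpulseResponse r (ratImpulse r) := by
  obtain ⟨σ, hσ⟩ := exists_pole_bound r
  obtain ⟨g, hg⟩ := exists_niceImpulse hr hσ
  have hex : ∃ g, IsImpulseResponse r g := ⟨g, hg.isImpulseResponse⟩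
  rw [ratImpulse, dif_pos hex]
  exact Classical.choose_spec hex

lemma ratImpulse_eqOn {r : RatFunc ℝ} {g : ℝ → ℝ} (hr : RatProper r) (hg : IsImpulseResponse r g) :
    Set.EqOn (ratImpulse r) g (Set.Ici 0) :=
  isImpulseResponse_unique (ratImpulse_spec hr) hg

/-- The impulse response is `O(e^{a t})` with `a < σ` if all poles satisfy `Re < σ`. -/
lemma exists_nice_eqOn {σ : ℝ} {r : RatFunc ℝ} (hr : RatProper r)
    (hσ : ∀ z : ℂ, aeval z r.denom = 0 → z.re < σ) :
    ∃ g, IsNiceImpulse σ r g ∧ Set.EqOn (ratImpulse r) g (Set.Ici 0) := by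
  obtain ⟨g, hg⟩ := exists_niceImpulse hr hσ
  exact ⟨g, hg, ratImpulse_eqOn hr hg.isImpulseResponse⟩

lemma ratImpulse_continuousOn {r : RatFunc ℝ} (hr : RatProper r) :
    ContinuousOn (ratImpulse r) (Set.Ici 0) := (ratImpulse_spec hr).1

lemma exists_nice_pair {r s : RatFunc ℝ} (hr : RatProper r) (hs : RatProper s) :
    ∃ σ g h, (∀ z : ℂ, aeval z r.denom = 0 → z.re < σ) ∧ (∀ z : ℂ, aeval z s.denom = 0 → z.re < σ) ∧
      IsNiceImpulse σ r g ∧ Set.EqOn (ratImpulse r) g (Set.Ici 0) ∧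
      IsNiceImpulse σ s h ∧ Set.EqOn (ratImpulse s) h (Set.Ici 0) := by
  obtain ⟨σ₁, h₁⟩ := exists_pole_bound r
  obtain ⟨σ₂, h₂⟩ := exists_pole_bound s
  have h₁' : ∀ z : ℂ, aeval z r.denom = 0 → z.re < max σ₁ σ₂ := fun z hz =>
    (h₁ z hz).trans_le (le_max_left _ _)
  have h₂' : ∀ z : ℂ, aeval z s.denom = 0 → z.re < max σ₁ σ₂ := fun z hz =>
    (h₂ z hz).trans_le (le_max_right _ _)
  obtain ⟨g, hg⟩ := exists_nice_eqOn hr h₁'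
  obtain ⟨h, hh⟩ := exists_nice_eqOn hs h₂'
  exact ⟨_, g, h, h₁', h₂', hg.1, hg.2, hh.1, hh.2⟩

lemma ratImpulse_add {r s : RatFunc ℝ} (hr : RatProper r) (hs : RatProper s) {t : ℝ} (ht : 0 ≤ t) :
    ratImpulse (r + s) t = ratImpulse r t + ratImpulse s t := by
  obtain ⟨σ, g, h, hpr, hps, hg, heg, hh, heh⟩ := exists_nice_pair hr hs
  have hrs : RatProper (r + s) := properRing.add_mem hr hs
  have hnice : IsNiceImpulse σ (r + s) fun t => g t + h t := by
    refine ⟨by simpa using hg.1.add hh.1, fun z hz => ?_⟩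
    simp only [Complex.ofReal_add]
    rw [laplace_add hg.1 hh.1 hz, hg.2 z hz, hh.2 z hz, ratFeedthrough_add hr hs,
      RatFunc.eval_add (algebraMap ℝ ℂ) z (fun h => absurd (hpr z h) (not_lt.2 hz))
        (fun h => absurd (hps z h) (not_lt.2 hz))]
    push_cast; ring
  rw [ratImpulse_eqOn hrs hnice.isImpulseResponse ht, heg ht, heh ht]

/-- Each factor is its value at infinity plus a Laplace transform. Expanding the product, applying
the convolution theorem and using uniqueness of impulse responses yields the formula. -/
lemma ratImpulse_mul {r s : RatFunc ℝ} (hr : RatProper r) (hs : RatProper s) {t : ℝ} (ht : 0 ≤ t) :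
    ratImpulse (r * s) t = ratFeedthrough r * ratImpulse s t + ratFeedthrough s * ratImpulse r t +
      ∫ τ in (0 : ℝ)..t, ratImpulse r (t - τ) * ratImpulse s τ := by
  obtain ⟨σ, g, h, hpr, hps, hg, heg, hh, heh⟩ := exists_nice_pair hr hs
  have hrs : RatProper (r * s) := properRing.mul_mem hr hs
  set k : ℝ → ℝ := fun t => ratFeedthrough r * h t + ratFeedthrough s * g t +
    ∫ τ in (0 : ℝ)..t, h τ * g (t - τ) with hk
  have hke : (fun t => (k t : ℂ)) = fun t => ((ratFeedthrough r : ℂ) * (h t : ℂ) +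
      (ratFeedthrough s : ℂ) * (g t : ℂ)) + ∫ τ in (0 : ℝ)..t, (h τ : ℂ) * (g (t - τ) : ℂ) := by
    ext t
    rw [hk]; push_cast
    rw [← intervalIntegral.integral_ofReal]
    simp
  have hnice : IsNiceImpulse σ (r * s) k := by
    have i1 := (hh.1.const_mul (ratFeedthrough r)).add (hg.1.const_mul (ratFeedthrough s))
    have i2 := hh.1.conv hg.1
    refine ⟨?_, fun z hz => ?_⟩
    · rw [hke]; exact i1.add i2
    · rw [hke, laplace_add i1 i2 hz,
        laplace_add (hh.1.const_mul (ratFeedthrough r)) (hg.1.const_mul (ratFeedthrough s)) hz,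
        laplace_const_mul, laplace_const_mul,
        laplace_conv (hh.1.integrableOn hz) (hg.1.integrableOn hz), hg.2 z hz, hh.2 z hz,
        ratFeedthrough_mul hr hs,
        RatFunc.eval_mul (algebraMap ℝ ℂ) z (fun h => absurd (hpr z h) (not_lt.2 hz))
          (fun h => absurd (hps z h) (not_lt.2 hz))]
      push_cast; ring
  rw [ratImpulse_eqOn hrs hnice.isImpulseResponse ht, heg ht, heh ht, hk]
  simp only
  congr 1
  refine intervalIntegral.integral_congr fun τ hτ => ?_
  rw [Set.uIcc_of_le ht] at hτ
  rw [heg (show t - τ ∈ Set.Ici (0 : ℝ) from sub_nonneg.2 hτ.2),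
    heh (show τ ∈ Set.Ici (0 : ℝ) from hτ.1), mul_comm]

lemma ratImpulse_of_constant {r : RatFunc ℝ} {c : ℝ} (h : IsImpulseResponse r fun _ => c)
    (hr : RatProper r) {t : ℝ} (ht : 0 ≤ t) : ratImpulse r t = c := ratImpulse_eqOn hr h ht

lemma ratImpulse_const (c : ℝ) {t : ℝ} (ht : 0 ≤ t) :
    ratImpulse (algebraMap ℝ (RatFunc ℝ) c) t = 0 := by
  refine ratImpulse_of_constant ⟨continuousOn_const, 0, fun s hs => ⟨by simp, ?_⟩⟩
    (ratProper_const c) ht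
  rw [ratFeedthrough_const, RatFunc.algebraMap_eq_C, RatFunc.eval_C]
  simp

lemma ratImpulse_inv_X {t : ℝ} (ht : 0 ≤ t) : ratImpulse (RatFunc.X : RatFunc ℝ)⁻¹ t = 1 := by
  refine ratImpulse_of_constant ⟨continuousOn_const, 0, fun s hs => ?_⟩
    ratStrictlyProper_inv_X.le ht
  have h0 : ExpBounded s.re fun _ : ℝ => ((1 : ℝ) : ℂ) := by
    refine ⟨continuous_const, 1, 0, zero_le_one, hs, by simp⟩
  refine ⟨h0.integrableOn le_rfl, ?_⟩
  rw [(ratStrictlyProper_iff.1 ratStrictlyProper_inv_X).2]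
  have h1 := laplace_exp (l := 0) (s := s) (by simpa using hs)
  unfold laplace at h1
  simp only [zero_mul, Complex.exp_zero, sub_zero] at h1
  have hs0 : s ≠ 0 := by intro h; rw [h] at hs; simp at hs
  have hd : eval₂ (algebraMap ℝ ℂ) s (RatFunc.X : RatFunc ℝ)⁻¹.denom ≠ 0 := by
    have h3 := Polynomial.eval₂_eq_zero_of_dvd_of_eval₂_eq_zero (algebraMap ℝ ℂ) s
      (RatFunc.denom_inv_dvd (K := ℝ) RatFunc.X_ne_zero)
    intro h4
    have := h3 h4
    rw [RatFunc.num_X, eval₂_X] at this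
    exact hs0 this
  have h2 := RatFunc.eval_mul (algebraMap ℝ ℂ) s (x := RatFunc.X) (y := (RatFunc.X : RatFunc ℝ)⁻¹)
    (X_mem_regularRing s) hd
  rw [mul_inv_cancel₀ RatFunc.X_ne_zero, RatFunc.eval_one, RatFunc.eval_X] at h2
  rw [eq_inv_of_mul_eq_one_right h2.symm]
  simpa using h1


/-! Scalar signals on `[0, ∞)` and the action of proper rational functions -/

/-- Measurable locally bounded functions that vanish for negative times. -/
def signals : Submodule ℝ (ℝ → ℝ) where
  carrier := {w | Measurable w ∧ (∀ t < 0, w t = 0) ∧ ∀ T, ∃ C, ∀ t ≤ T, |w t| ≤ C}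
  add_mem' {v w} hv hw := by
    refine ⟨hv.1.add hw.1, fun t ht => by simp [hv.2.1 t ht, hw.2.1 t ht], fun T => ?_⟩
    obtain ⟨C, hC⟩ := hv.2.2 T
    obtain ⟨C', hC'⟩ := hw.2.2 T
    exact ⟨C + C', fun t ht => (abs_add_le _ _).trans (add_le_add (hC t ht) (hC' t ht))⟩
  zero_mem' := ⟨measurable_const, by simp, fun T => ⟨0, by simp⟩⟩
  smul_mem' c w hw := by
    refine ⟨hw.1.const_mul c, fun t ht => by simp [hw.2.1 t ht], fun T => ?_⟩
    obtain ⟨C, hC⟩ := hw.2.2 T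
    refine ⟨|c| * C, fun t ht => ?_⟩
    rw [Pi.smul_apply, smul_eq_mul, abs_mul]
    gcongr; exact hC t ht

lemma signals_bound {w : ℝ → ℝ} (hw : w ∈ signals) (T : ℝ) :
    ∃ C, 0 ≤ C ∧ ∀ t ≤ T, |w t| ≤ C := by
  obtain ⟨C, hC⟩ := hw.2.2 T
  exact ⟨C, (abs_nonneg _).trans (hC T le_rfl), hC⟩

lemma intervalIntegrable_of_bound {f : ℝ → ℝ} {t C : ℝ} (ht : 0 ≤ t) (hf : Measurable f)
    (hC : ∀ s ∈ Set.Icc 0 t, |f s| ≤ C) : IntervalIntegrable f volume 0 t := by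
  rw [intervalIntegrable_iff_integrableOn_Ioc_of_le ht]
  refine Measure.integrableOn_of_bounded (M := C) (by simp) hf.aestronglyMeasurable ?_
  refine (ae_restrict_mem measurableSet_Ioc).mono fun s hs => ?_
  exact hC s ⟨hs.1.le, hs.2⟩

/-- Continuous extension of the impulse response to negative times. -/
def impExt (r : RatFunc ℝ) (t : ℝ) : ℝ := ratImpulse r (max t 0)

lemma impExt_of_nonneg (r : RatFunc ℝ) {t : ℝ} (ht : 0 ≤ t) : impExt r t = ratImpulse r t := by
  rw [impExt, max_eq_left ht]

lemma continuous_impExt {r : RatFunc ℝ} (hr : RatProper r) : Continuous (impExt r) :=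
  (ratImpulse_continuousOn hr).comp_continuous (by fun_prop) fun t => le_max_right t 0

lemma exists_bound_Icc {g : ℝ → ℝ} (hg : Continuous g) (T : ℝ) :
    ∃ C, 0 ≤ C ∧ ∀ t ∈ Set.Icc 0 T, |g t| ≤ C := by
  obtain ⟨C, hC⟩ := (isCompact_Icc (a := (0 : ℝ)) (b := T)).exists_bound_of_continuousOn
    hg.continuousOn
  exact ⟨max C 0, le_max_right _ _, fun t ht => (hC t ht).trans (le_max_left _ _)⟩

/-- `∫₀ᵗ g(t - τ) w(τ) dτ` for `t ≥ 0`, and `0` for `t < 0`. -/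
def causalConv (g w : ℝ → ℝ) (t : ℝ) : ℝ := if 0 ≤ t then ∫ τ in (0 : ℝ)..t, g (t - τ) * w τ else 0

lemma causalConv_integrable {g w : ℝ → ℝ} (hg : Continuous g) (hw : w ∈ signals) {t : ℝ}
    (ht : 0 ≤ t) : IntervalIntegrable (fun τ => g (t - τ) * w τ) volume 0 t := by
  obtain ⟨C, hC, hwC⟩ := signals_bound hw t
  obtain ⟨C', hC', hgC⟩ := exists_bound_Icc hg t
  refine intervalIntegrable_of_bound (C := C' * C) ht
    ((hg.measurable.comp (measurable_const.sub measurable_id)).mul hw.1) fun s hs => ?_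
  rw [abs_mul]
  gcongr
  · exact hgC _ ⟨sub_nonneg.2 hs.2, by linarith [hs.1]⟩
  · exact hwC s hs.2

lemma causalConv_mem {g w : ℝ → ℝ} (hg : Continuous g) (hw : w ∈ signals) :
    causalConv g w ∈ signals := by
  refine ⟨?_, fun t ht => if_neg (not_le.2 ht), fun T => ?_⟩
  · have hF : Measurable (fun q : ℝ × ℝ =>
        if 0 < q.2 ∧ q.2 ≤ q.1 then g (q.1 - q.2) * w q.2 else 0) := by
      refine Measurable.ite ?_ ?_ measurable_const
      · exact (measurableSet_lt measurable_const measurable_snd).inter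
          (measurableSet_le measurable_snd measurable_fst)
      · exact (hg.measurable.comp (measurable_fst.sub measurable_snd)).mul
          (hw.1.comp measurable_snd)
    have h1 := (hF.stronglyMeasurable.integral_prod_right' (ν := (volume : Measure ℝ))).measurable
    have h2 : causalConv g w = fun t =>
        ∫ τ : ℝ, if 0 < τ ∧ τ ≤ t then g (t - τ) * w τ else 0 := by
      ext t
      by_cases ht : 0 ≤ t
      · rw [causalConv, if_pos ht, intervalIntegral.integral_of_le ht,
          ← integral_indicator measurableSet_Ioc]
        refine integral_congr_ae (Eventually.of_forall fun τ => ?_)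
        by_cases hτ : τ ∈ Set.Ioc 0 t
        · rw [Set.indicator_of_mem hτ]; exact (if_pos hτ).symm
        · rw [Set.indicator_of_notMem hτ]; exact (if_neg hτ).symm
      · rw [causalConv, if_neg ht]
        have : ∀ τ : ℝ, (if 0 < τ ∧ τ ≤ t then g (t - τ) * w τ else 0) = 0 := fun τ =>
          if_neg fun h => ht (h.1.le.trans h.2)
        simp [this]
    rw [h2]; exact h1
  · obtain ⟨C, hC, hwC⟩ := signals_bound hw T
    obtain ⟨C', hC', hgC⟩ := exists_bound_Icc hg T
    refine ⟨C' * C * |T|, fun t ht => ?_⟩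
    by_cases h0 : 0 ≤ t
    · rw [causalConv, if_pos h0]
      have h3 : ‖∫ τ in (0 : ℝ)..t, g (t - τ) * w τ‖ ≤ C' * C * |t - 0| := by
        refine intervalIntegral.norm_integral_le_of_norm_le_const fun τ hτ => ?_
        rw [Set.uIoc_of_le h0] at hτ
        rw [norm_mul]
        gcongr
        · exact hgC _ ⟨sub_nonneg.2 hτ.2, by linarith [hτ.1]⟩
        · exact hwC τ (hτ.2.trans ht)
      refine h3.trans ?_
      rw [sub_zero]
      have : |t| ≤ |T| := by rw [abs_of_nonneg h0]; exact ht.trans (le_abs_self T)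
      gcongr
    · rw [causalConv, if_neg h0, abs_zero]; positivity

/-- Fubini on the triangle `u ≤ τ ≤ t`, followed by the substitution `v = τ - u`. -/
lemma conv_assoc {g h w : ℝ → ℝ} (hg : Continuous g) (hh : Continuous h) (hw : w ∈ signals)
    {t : ℝ} (ht : 0 ≤ t) :
    ∫ τ in (0 : ℝ)..t, g (t - τ) * ∫ u in (0 : ℝ)..τ, h (τ - u) * w u =
      ∫ u in (0 : ℝ)..t, (∫ v in (0 : ℝ)..(t - u), g (t - u - v) * h v) * w u := by
  obtain ⟨C, hC, hwC⟩ := signals_bound hw t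
  obtain ⟨A, hA, hgA⟩ := exists_bound_Icc hg t
  obtain ⟨B, hB, hhB⟩ := exists_bound_Icc hh t
  set μ := (volume : Measure ℝ).restrict (Set.Ioc 0 t) with hμ
  set F : ℝ × ℝ → ℝ := fun q => if q.2 ≤ q.1 then g (t - q.1) * (h (q.1 - q.2) * w q.2) else 0
    with hF
  have hFm : Measurable F := by
    refine Measurable.ite (measurableSet_le measurable_snd measurable_fst) ?_ measurable_const
    exact (hg.measurable.comp (measurable_const.sub measurable_fst)).mul
      ((hh.measurable.comp (measurable_fst.sub measurable_snd)).mul (hw.1.comp measurable_snd))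
  have hFi : Integrable F (μ.prod μ) := by
    refine Integrable.of_bound (C := A * (B * C)) hFm.aestronglyMeasurable ?_
    rw [hμ, Measure.prod_restrict]
    refine (ae_restrict_mem (measurableSet_Ioc.prod measurableSet_Ioc)).mono fun q hq => ?_
    obtain ⟨h1, h2⟩ := hq
    rw [hF]
    beta_reduce
    split_ifs with h3
    · rw [norm_mul, norm_mul]
      gcongr
      · exact hgA _ ⟨sub_nonneg.2 h1.2, by linarith [h1.1]⟩
      · exact hhB _ ⟨sub_nonneg.2 h3, by linarith [h2.1, h1.2]⟩
      · exact hwC _ h2.2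
    · rw [norm_zero]; positivity
  have hswap := integral_integral_swap (f := fun a b => F (a, b)) hFi
  have e1 : ∫ τ in (0 : ℝ)..t, g (t - τ) * ∫ u in (0 : ℝ)..τ, h (τ - u) * w u =
      ∫ a, ∫ b, F (a, b) ∂μ ∂μ := by
    rw [intervalIntegral.integral_of_le ht]
    refine setIntegral_congr_fun measurableSet_Ioc fun a ha => ?_
    have h4 : ∀ b, F (a, b) = Set.indicator (Set.Iic a) (fun u => g (t - a) * (h (a - u) * w u)) b := by
      intro b
      rw [hF, Set.indicator_apply]; rfl
    simp only [h4]
    rw [integral_indicator measurableSet_Iic, hμ, Measure.restrict_restrict measurableSet_Iic,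
      integral_const_mul, intervalIntegral.integral_of_le ha.1.le]
    congr 3
    ext u
    simp only [Set.mem_inter_iff, Set.mem_Iic, Set.mem_Ioc]
    constructor
    · rintro ⟨h5, h6⟩; exact ⟨h6, h5, h6.trans ha.2⟩
    · rintro ⟨h5, h6, _⟩; exact ⟨h6, h5⟩
  have e2 : ∫ u in (0 : ℝ)..t, (∫ v in (0 : ℝ)..(t - u), g (t - u - v) * h v) * w u =
      ∫ b, ∫ a, F (a, b) ∂μ ∂μ := by
    rw [intervalIntegral.integral_of_le ht]
    refine setIntegral_congr_fun measurableSet_Ioc fun b hb => ?_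
    have h4 : ∀ a, F (a, b) = Set.indicator (Set.Ici b) (fun a => g (t - a) * h (a - b) * w b) a := by
      intro a
      rw [hF, Set.indicator_apply]
      simp only [Set.mem_Ici, mul_assoc]
    simp only [h4]
    rw [integral_indicator measurableSet_Ici, hμ, Measure.restrict_restrict measurableSet_Ici,
      integral_mul_const]
    congr 1
    have h5 : Set.Ici b ∩ Set.Ioc 0 t = Set.Icc b t := by
      ext u
      simp only [Set.mem_inter_iff, Set.mem_Ici, Set.mem_Ioc, Set.mem_Icc]
      constructor
      · rintro ⟨h5, h6, h7⟩; exact ⟨h5, h7⟩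
      · rintro ⟨h5, h6⟩; exact ⟨h5, hb.1.trans_le h5, h6⟩
    rw [h5, integral_Icc_eq_integral_Ioc, ← intervalIntegral.integral_of_le hb.2]
    have h6 := intervalIntegral.integral_comp_add_right
      (fun a => g (t - a) * h (a - b)) b (a := 0) (b := t - b)
    rw [zero_add, sub_add_cancel] at h6
    rw [← h6]
    refine intervalIntegral.integral_congr fun v _ => ?_
    congr 2 <;> ring
  rw [e1, e2, hswap]

/-- The action of a rational function on a signal. -/
def sAct (r : RatFunc ℝ) (w : ℝ → ℝ) (t : ℝ) : ℝ :=
  ratFeedthrough r * w t + causalConv (impExt r) w t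

lemma sAct_mem {r : RatFunc ℝ} (hr : RatProper r) {w : ℝ → ℝ} (hw : w ∈ signals) :
    sAct r w ∈ signals :=
  signals.add_mem (signals.smul_mem (ratFeedthrough r) hw)
    (causalConv_mem (continuous_impExt hr) hw)

lemma causalConv_congr {g h w : ℝ → ℝ} (H : ∀ t, 0 ≤ t → g t = h t) :
    causalConv g w = causalConv h w := by
  ext t
  by_cases ht : 0 ≤ t
  · rw [causalConv, causalConv, if_pos ht, if_pos ht]
    refine intervalIntegral.integral_congr fun τ hτ => ?_
    rw [Set.uIcc_of_le ht] at hτ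
    rw [H _ (sub_nonneg.2 hτ.2)]
  · rw [causalConv, causalConv, if_neg ht, if_neg ht]

lemma causalConv_add_right {g v w : ℝ → ℝ} (hg : Continuous g) (hv : v ∈ signals)
    (hw : w ∈ signals) (t : ℝ) :
    causalConv g (v + w) t = causalConv g v t + causalConv g w t := by
  by_cases ht : 0 ≤ t
  · rw [causalConv, causalConv, causalConv, if_pos ht, if_pos ht, if_pos ht,
      ← intervalIntegral.integral_add (causalConv_integrable hg hv ht)
        (causalConv_integrable hg hw ht)]
    simp only [Pi.add_apply, mul_add]
  · rw [causalConv, causalConv, causalConv, if_neg ht, if_neg ht, if_neg ht, add_zero]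

lemma causalConv_add_left {g h w : ℝ → ℝ} (hg : Continuous g) (hh : Continuous h)
    (hw : w ∈ signals) (t : ℝ) :
    causalConv (g + h) w t = causalConv g w t + causalConv h w t := by
  by_cases ht : 0 ≤ t
  · rw [causalConv, causalConv, causalConv, if_pos ht, if_pos ht, if_pos ht,
      ← intervalIntegral.integral_add (causalConv_integrable hg hw ht)
        (causalConv_integrable hh hw ht)]
    simp only [Pi.add_apply, add_mul]
  · rw [causalConv, causalConv, causalConv, if_neg ht, if_neg ht, if_neg ht, add_zero]

lemma causalConv_smul_right (g w : ℝ → ℝ) (c t : ℝ) :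
    causalConv g (c • w) t = c * causalConv g w t := by
  unfold causalConv
  split_ifs
  · rw [← intervalIntegral.integral_const_mul]
    simp only [Pi.smul_apply, smul_eq_mul, mul_left_comm]
  · simp

lemma causalConv_smul_left (g w : ℝ → ℝ) (c t : ℝ) :
    causalConv (c • g) w t = c * causalConv g w t := by
  unfold causalConv
  split_ifs
  · rw [← intervalIntegral.integral_const_mul]
    simp only [Pi.smul_apply, smul_eq_mul, mul_assoc]
  · simp

lemma sAct_add {r : RatFunc ℝ} (hr : RatProper r) {v w : ℝ → ℝ} (hv : v ∈ signals)
    (hw : w ∈ signals) : sAct r (v + w) = sAct r v + sAct r w := by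
  ext t
  simp only [sAct, Pi.add_apply, causalConv_add_right (continuous_impExt hr) hv hw]
  ring

lemma sAct_smul (r : RatFunc ℝ) (c : ℝ) (w : ℝ → ℝ) : sAct r (c • w) = c • sAct r w := by
  ext t
  simp only [sAct, Pi.smul_apply, smul_eq_mul, causalConv_smul_right]
  ring

lemma sAct_add_left {r s : RatFunc ℝ} (hr : RatProper r) (hs : RatProper s) {w : ℝ → ℝ}
    (hw : w ∈ signals) : sAct (r + s) w = sAct r w + sAct s w := by
  ext t
  have h : causalConv (impExt (r + s)) w = causalConv (impExt r + impExt s) w :=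
    causalConv_congr fun t ht => by
      rw [Pi.add_apply, impExt_of_nonneg _ ht, impExt_of_nonneg _ ht, impExt_of_nonneg _ ht,
        ratImpulse_add hr hs ht]
  simp only [sAct, Pi.add_apply, h,
    causalConv_add_left (continuous_impExt hr) (continuous_impExt hs) hw,
    ratFeedthrough_add hr hs]
  ring

lemma sAct_const (c : ℝ) (w : ℝ → ℝ) : sAct (algebraMap ℝ (RatFunc ℝ) c) w = c • w := by
  ext t
  have h : causalConv (impExt (algebraMap ℝ (RatFunc ℝ) c)) w = causalConv 0 w :=
    causalConv_congr fun t ht => by rw [impExt_of_nonneg _ ht, ratImpulse_const c ht]; rfl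
  rw [sAct, h, ratFeedthrough_const]
  simp [causalConv]

/-- The product formula for impulse responses combined with associativity of convolution. Through
this lemma identities between proper rational functions become identities between signals. -/
lemma sAct_mul {r s : RatFunc ℝ} (hr : RatProper r) (hs : RatProper s) {w : ℝ → ℝ}
    (hw : w ∈ signals) : sAct (r * s) w = sAct r (sAct s w) := by
  have hcr := continuous_impExt hr
  have hcs := continuous_impExt hs
  set k : ℝ → ℝ := fun t => ∫ v in (0 : ℝ)..t, impExt r (t - v) * impExt s v with hk
  have hkc : Continuous k := intervalIntegral.continuous_parametric_intervalIntegral_of_continuous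
    (f := fun t v => impExt r (t - v) * impExt s v) (by unfold Function.uncurry; fun_prop)
    continuous_id
  have h : causalConv (impExt (r * s)) w = causalConv
      ((ratFeedthrough r • impExt s + ratFeedthrough s • impExt r) + k) w :=
    causalConv_congr fun t ht => by
      simp only [Pi.add_apply, Pi.smul_apply, smul_eq_mul]
      rw [impExt_of_nonneg _ ht, impExt_of_nonneg _ ht, impExt_of_nonneg _ ht,
        ratImpulse_mul hr hs ht]
      congr 1
      refine intervalIntegral.integral_congr fun v hv => ?_
      rw [Set.uIcc_of_le ht] at hv
      rw [impExt_of_nonneg _ hv.1, impExt_of_nonneg _ (sub_nonneg.2 hv.2)]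
  have hassoc : causalConv (impExt r) (causalConv (impExt s) w) = causalConv k w := by
    ext t
    by_cases ht : 0 ≤ t
    · have := conv_assoc hcr hcs hw ht
      rw [causalConv, causalConv, if_pos ht, if_pos ht, ← this]
      refine intervalIntegral.integral_congr fun τ hτ => ?_
      rw [Set.uIcc_of_le ht] at hτ
      rw [causalConv, if_pos hτ.1]
    · rw [causalConv, causalConv, if_neg ht, if_neg ht]
  have hsw : sAct s w = ratFeedthrough s • w + causalConv (impExt s) w := rfl
  have c1 : ∀ (c : ℝ) {g : ℝ → ℝ}, Continuous g → Continuous (c • g) := fun c g hg => hg.const_smul c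
  ext t
  rw [hsw, sAct, sAct, causalConv_add_right hcr (signals.smul_mem _ hw) (causalConv_mem hcs hw),
    hassoc, h, causalConv_add_left ((c1 _ hcs).add (c1 _ hcr)) hkc hw,
    causalConv_add_left (c1 _ hcs) (c1 _ hcr) hw, causalConv_smul_left, causalConv_smul_left,
    causalConv_smul_right, ratFeedthrough_mul hr hs, Pi.add_apply, Pi.smul_apply, smul_eq_mul]
  ring

/-! `L₁` bounds -/

/-- Stability allows `σ = 0` in `exists_nice_eqOn`, so the impulse response decays exponentially;
integrability is read off from the Laplace integral at `s = 0`. -/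
lemma ratL1_ne_top {r : RatFunc ℝ} (hr : RatProper r) (hs : RatStable r) : ratL1 r ≠ ⊤ := by
  obtain ⟨g, hg, he⟩ := exists_nice_eqOn hr hs
  rw [ratL1, if_pos hr]
  refine ENNReal.add_ne_top.2 ⟨ENNReal.ofReal_ne_top, ?_⟩
  have h1 := hg.1.integrableOn (s := 0) (by simp)
  simp only [zero_mul, neg_zero, Complex.exp_zero, one_mul] at h1
  have h2 := h1.2
  have e : ∫⁻ t in Set.Ioi (0 : ℝ), ENNReal.ofReal |ratImpulse r t| =
      ∫⁻ t in Set.Ioi (0 : ℝ), ‖(g t : ℂ)‖ₑ := by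
    refine setLIntegral_congr_fun measurableSet_Ioi fun t ht => ?_
    rw [he (Set.Ioi_subset_Ici_self ht), ← ofReal_norm, Complex.norm_real, Real.norm_eq_abs]
  rw [e]
  exact h2.ne

/-- Only the values of `w` on `[0, t]` enter. The continuation and self-bounding arguments depend on
this causal form of the `L₁`–`L_∞` estimate. -/
lemma sAct_bound {r : RatFunc ℝ} (hr : RatProper r) (hL : ratL1 r ≠ ⊤) {w : ℝ → ℝ} {t m : ℝ}
    (ht : 0 ≤ t) (hm : 0 ≤ m) (hw : ∀ s ∈ Set.Icc 0 t, |w s| ≤ m) :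
    |sAct r w t| ≤ (ratL1 r).toReal * m := by
  have hc := continuous_impExt hr
  rw [ratL1, if_pos hr] at hL ⊢
  obtain ⟨-, hL2⟩ := ENNReal.add_ne_top.1 hL
  rw [ENNReal.toReal_add ENNReal.ofReal_ne_top hL2, ENNReal.toReal_ofReal (abs_nonneg _)]
  have h1 : ∫ u in (0 : ℝ)..t, |impExt r u| ≤
      (∫⁻ t in Set.Ioi (0 : ℝ), ENNReal.ofReal |ratImpulse r t|).toReal := by
    rw [intervalIntegral.integral_of_le ht,
      integral_eq_lintegral_of_nonneg_ae (Eventually.of_forall fun _ => abs_nonneg _)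
        hc.abs.aestronglyMeasurable]
    refine ENNReal.toReal_mono hL2 ?_
    calc ∫⁻ a in Set.Ioc 0 t, ENNReal.ofReal |impExt r a|
        ≤ ∫⁻ a in Set.Ioi 0, ENNReal.ofReal |impExt r a| :=
          lintegral_mono_set Set.Ioc_subset_Ioi_self
      _ = _ := setLIntegral_congr_fun measurableSet_Ioi fun a ha => by
          rw [impExt_of_nonneg _ (le_of_lt ha)]
  have h2 : |causalConv (impExt r) w t| ≤ (∫ u in (0 : ℝ)..t, |impExt r u|) * m := by
    rw [causalConv, if_pos ht, ← intervalIntegral.integral_mul_const]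
    have h3 : ∫ u in (0 : ℝ)..t, |impExt r u| * m = ∫ τ in (0 : ℝ)..t, |impExt r (t - τ)| * m := by
      have := intervalIntegral.integral_comp_sub_left (fun u => |impExt r u| * m) t (a := 0) (b := t)
      rw [this, sub_self, sub_zero]
    rw [h3]
    refine (Real.norm_eq_abs _).symm.le.trans
      (intervalIntegral.norm_integral_le_of_norm_le ht ?_ ?_)
    · refine Eventually.of_forall fun τ hτ => ?_
      rw [norm_mul]
      exact mul_le_mul_of_nonneg_left (hw τ ⟨hτ.1.le, hτ.2⟩) (abs_nonneg _)
    · exact (by fun_prop : Continuous fun τ => |impExt r (t - τ)| * m).intervalIntegrable _ _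
  rw [sAct, add_mul]
  refine (abs_add_le _ _).trans (add_le_add ?_ (h2.trans (by gcongr)))
  rw [abs_mul]
  gcongr
  exact hw t ⟨ht, le_rfl⟩


/-! Vector signals and the action of transfer matrices -/

section VectorSignals

variable {m n p : Type*} [Fintype m] [Fintype n] [Fintype p]

/-- Vector-valued signals. -/
def vsignals (n : Type*) : Submodule ℝ (ℝ → n → ℝ) where
  carrier := {w | ∀ j, (fun t => w t j) ∈ signals}
  add_mem' hv hw j := signals.add_mem (hv j) (hw j)
  zero_mem' _ := signals.zero_mem
  smul_mem' c _ hw j := signals.smul_mem c (hw j)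

/-- Restriction of a function to nonnegative times. -/
def trunc {E : Type*} [Zero E] (w : ℝ → E) (t : ℝ) : E := if 0 ≤ t then w t else 0

lemma trunc_of_nonneg {E : Type*} [Zero E] (w : ℝ → E) {t : ℝ} (ht : 0 ≤ t) : trunc w t = w t :=
  if_pos ht

lemma trunc_of_neg {E : Type*} [Zero E] (w : ℝ → E) {t : ℝ} (ht : t < 0) : trunc w t = 0 :=
  if_neg (not_le.2 ht)

lemma vsignals_neg {w : ℝ → n → ℝ} (hw : w ∈ vsignals n) {t : ℝ} (ht : t < 0) : w t = 0 :=
  funext fun j => (hw j).2.1 t ht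

lemma vsignals_ext {v w : ℝ → n → ℝ} (hv : v ∈ vsignals n) (hw : w ∈ vsignals n)
    (h : ∀ t, 0 ≤ t → v t = w t) : v = w := by
  ext1 t
  rcases lt_or_ge t 0 with ht | ht
  · rw [vsignals_neg hv ht, vsignals_neg hw ht]
  · exact h t ht

lemma vsignals_bound {w : ℝ → n → ℝ} (hw : w ∈ vsignals n) (T : ℝ) :
    ∃ C, 0 ≤ C ∧ ∀ t ≤ T, ‖w t‖ ≤ C := by
  choose C hC0 hC using fun j => signals_bound (hw j) T
  refine ⟨∑ j, C j, Finset.sum_nonneg fun j _ => hC0 j, fun t ht => ?_⟩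
  refine (pi_norm_le_iff_of_nonneg (Finset.sum_nonneg fun j _ => hC0 j)).2 fun j => ?_
  exact (hC j t ht).trans (Finset.single_le_sum (f := C) (fun i _ => hC0 i) (Finset.mem_univ j))

lemma trunc_mem_vsignals {w : ℝ → n → ℝ} (hm : Measurable (trunc w))
    (hb : ∀ T, ∃ C, ∀ t ∈ Set.Icc 0 T, ‖w t‖ ≤ C) : trunc w ∈ vsignals n := by
  intro j
  refine ⟨(measurable_pi_apply j).comp hm, fun t ht => congrFun (trunc_of_neg w ht) j, fun T => ?_⟩
  obtain ⟨C, hC⟩ := hb T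
  refine ⟨max C 0, fun t ht => ?_⟩
  rcases lt_or_ge t 0 with h | h
  · beta_reduce; rw [trunc_of_neg _ h]; simp
  · beta_reduce; rw [trunc_of_nonneg _ h]
    exact (norm_le_pi_norm (w t) j).trans ((hC t ⟨h, ht⟩).trans (le_max_left _ _))

/-- The action of a transfer matrix on a signal. -/
def tfAct (G : Matrix m n (RatFunc ℝ)) (w : ℝ → n → ℝ) : ℝ → m → ℝ :=
  fun t i => ∑ j, sAct (G i j) (fun τ => w τ j) t

lemma tfAct_mem {G : Matrix m n (RatFunc ℝ)} (hG : MProper G) {w : ℝ → n → ℝ}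
    (hw : w ∈ vsignals n) : tfAct G w ∈ vsignals m := by
  intro i
  have : (fun t => tfAct G w t i) = ∑ j, sAct (G i j) (fun τ => w τ j) := by
    ext t; simp [tfAct]
  rw [this]
  exact signals.sum_mem fun j _ => sAct_mem (hG i j) (hw j)

lemma tfAct_add {G : Matrix m n (RatFunc ℝ)} (hG : MProper G) {v w : ℝ → n → ℝ}
    (hv : v ∈ vsignals n) (hw : w ∈ vsignals n) : tfAct G (v + w) = tfAct G v + tfAct G w := by
  ext t i
  simp only [tfAct, Pi.add_apply]
  rw [← Finset.sum_add_distrib]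
  refine Finset.sum_congr rfl fun j _ => ?_
  exact congrFun (sAct_add (hG i j) (hv j) (hw j)) t

lemma tfAct_smul (G : Matrix m n (RatFunc ℝ)) (c : ℝ) (w : ℝ → n → ℝ) :
    tfAct G (c • w) = c • tfAct G w := by
  ext t i
  simp only [tfAct, Pi.smul_apply, smul_eq_mul, Finset.mul_sum]
  refine Finset.sum_congr rfl fun j _ => ?_
  exact congrFun (sAct_smul (G i j) c fun τ => w τ j) t

lemma tfAct_neg (G : Matrix m n (RatFunc ℝ)) (w : ℝ → n → ℝ) : tfAct G (-w) = -tfAct G w := by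
  have := tfAct_smul G (-1) w
  simpa using this

lemma tfAct_sub {G : Matrix m n (RatFunc ℝ)} (hG : MProper G) {v w : ℝ → n → ℝ}
    (hv : v ∈ vsignals n) (hw : w ∈ vsignals n) : tfAct G (v - w) = tfAct G v - tfAct G w := by
  rw [sub_eq_add_neg, tfAct_add hG hv ((vsignals n).neg_mem hw), tfAct_neg, sub_eq_add_neg]

lemma tfAct_add_left {G H : Matrix m n (RatFunc ℝ)} (hG : MProper G) (hH : MProper H)
    {w : ℝ → n → ℝ} (hw : w ∈ vsignals n) : tfAct (G + H) w = tfAct G w + tfAct H w := by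
  ext t i
  simp only [tfAct, Pi.add_apply]
  rw [← Finset.sum_add_distrib]
  refine Finset.sum_congr rfl fun j _ => ?_
  exact congrFun (sAct_add_left (hG i j) (hH i j) (hw j)) t

lemma tfAct_sub_left {G H : Matrix m n (RatFunc ℝ)} (hG : MProper G) (hH : MProper H)
    {w : ℝ → n → ℝ} (hw : w ∈ vsignals n) : tfAct (G - H) w = tfAct G w - tfAct H w := by
  have := tfAct_add_left (EntriesIn.sub hG hH) hH hw
  rw [sub_add_cancel] at this
  rw [this, add_sub_cancel_right]

lemma tfAct_tfConst (A : Matrix m n ℝ) (w : ℝ → n → ℝ) :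
    tfAct (tfConst A) w = fun t => A.mulVec (w t) := by
  ext t i
  simp only [tfAct, tfConst, Matrix.map_apply, sAct_const, Matrix.mulVec, dotProduct,
    Pi.smul_apply, smul_eq_mul]

lemma tfAct_one [DecidableEq n] (w : ℝ → n → ℝ) :
    tfAct (1 : Matrix n n (RatFunc ℝ)) w = w := by
  rw [← tfConst_one, tfAct_tfConst]
  simp

lemma sAct_sum {ι : Type*} {r : RatFunc ℝ} (hr : RatProper r) (s : Finset ι) {w : ι → ℝ → ℝ}
    (hw : ∀ i, w i ∈ signals) : sAct r (∑ i ∈ s, w i) = ∑ i ∈ s, sAct r (w i) := by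
  classical
  induction s using Finset.induction_on with
  | empty =>
    simp only [Finset.sum_empty]
    have := sAct_smul r 0 0
    simpa using this
  | insert a s ha ih =>
    rw [Finset.sum_insert ha, Finset.sum_insert ha, sAct_add hr (hw a)
      (signals.sum_mem fun i _ => hw i), ih]

lemma sAct_sum_left {ι : Type*} (s : Finset ι) {r : ι → RatFunc ℝ} (hr : ∀ i, RatProper (r i))
    {w : ℝ → ℝ} (hw : w ∈ signals) : sAct (∑ i ∈ s, r i) w = ∑ i ∈ s, sAct (r i) w := by
  classical
  induction s using Finset.induction_on with
  | empty =>
    simp only [Finset.sum_empty]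
    have := sAct_const 0 w
    simpa using this
  | insert a s ha ih =>
    rw [Finset.sum_insert ha, Finset.sum_insert ha, sAct_add_left (hr a)
      (properRing.sum_mem fun i _ => hr i) hw, ih]

lemma tfAct_mul {G : Matrix m n (RatFunc ℝ)} {H : Matrix n p (RatFunc ℝ)} (hG : MProper G)
    (hH : MProper H) {w : ℝ → p → ℝ} (hw : w ∈ vsignals p) :
    tfAct (G * H) w = tfAct G (tfAct H w) := by
  ext t i
  have h1 : ∀ l, (fun τ => tfAct H w τ l) = ∑ j, sAct (H l j) (fun τ => w τ j) := by
    intro l; ext t; simp [tfAct]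
  have h2 : ∀ l, sAct (G i l) (fun τ => tfAct H w τ l) =
      ∑ j, sAct (G i l * H l j) (fun τ => w τ j) := by
    intro l
    rw [h1, sAct_sum (hG i l) _ fun j => sAct_mem (hH l j) (hw j)]
    exact Finset.sum_congr rfl fun j _ => (sAct_mul (hG i l) (hH l j) (hw j)).symm
  have h3 : ∀ j, sAct ((G * H) i j) (fun τ => w τ j) =
      ∑ l, sAct (G i l * H l j) (fun τ => w τ j) := fun j => by
    rw [Matrix.mul_apply]
    exact sAct_sum_left _ (fun l => properRing.mul_mem (hG i l) (hH l j)) (hw j)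
  change ∑ j, sAct ((G * H) i j) (fun τ => w τ j) t = ∑ l, sAct (G i l) (fun τ => tfAct H w τ l) t
  simp only [h2, h3, Finset.sum_apply]
  exact Finset.sum_comm

/-- Reduces the vector-valued convolution of the theorem to the componentwise action, for which the
calculus is available. -/
lemma tfApply_eq {G : Matrix m n (RatFunc ℝ)} (hG : MProper G) {w : ℝ → n → ℝ}
    (hw : trunc w ∈ vsignals n) {t : ℝ} (ht : 0 ≤ t) : tfApply G w t = tfAct G (trunc w) t := by
  have hint : ∀ i j, IntervalIntegrable (fun τ => impExt (G i j) (t - τ) * trunc w τ j)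
      volume 0 t := fun i j =>
    causalConv_integrable (w := fun τ => trunc w τ j) (continuous_impExt (hG i j)) (hw j) ht
  have hcongr : Set.EqOn (fun τ => (tfImpulse G (t - τ)).mulVec (w τ))
      (fun τ i => ∑ j, impExt (G i j) (t - τ) * trunc w τ j) (Set.uIcc 0 t) := by
    intro τ hτ
    rw [Set.uIcc_of_le ht] at hτ
    ext i
    simp only [tfImpulse, Matrix.mulVec, dotProduct, Matrix.of_apply]
    refine Finset.sum_congr rfl fun j _ => ?_
    rw [impExt_of_nonneg _ (sub_nonneg.2 hτ.2), trunc_of_nonneg _ hτ.1]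
  ext i
  rw [tfApply, Pi.add_apply, intervalIntegral.integral_congr hcongr]
  have hproj := (ContinuousLinearMap.proj (R := ℝ) (φ := fun _ : m => ℝ) i).intervalIntegral_comp_comm
    (μ := volume) (a := 0) (b := t) (f := fun τ i => ∑ j, impExt (G i j) (t - τ) * trunc w τ j) (by
      rw [intervalIntegrable_iff_integrableOn_Ioc_of_le ht]
      refine Integrable.of_eval fun i => ?_
      rw [← IntegrableOn, ← intervalIntegrable_iff_integrableOn_Ioc_of_le ht]
      have h := IntervalIntegrable.sum (Finset.univ) (fun j _ => hint i j)
      rw [Finset.sum_fn] at h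
      exact h)
  have hproj' : (∫ τ in (0 : ℝ)..t, fun i => ∑ j, impExt (G i j) (t - τ) * trunc w τ j) i =
      ∫ τ in (0 : ℝ)..t, ∑ j, impExt (G i j) (t - τ) * trunc w τ j := hproj.symm
  rw [hproj', intervalIntegral.integral_finsetSum fun j _ => hint i j]
  simp only [Matrix.mulVec, dotProduct, Matrix.of_apply]
  rw [← Finset.sum_add_distrib]
  refine Finset.sum_congr rfl fun j _ => ?_
  rw [sAct, causalConv, if_pos ht, trunc_of_nonneg _ ht]

/-! Impulse response matrices as signals -/

/-- The impulse response `h(t) v` as a signal. -/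
def tfImp (H : Matrix m n (RatFunc ℝ)) (v : n → ℝ) : ℝ → m → ℝ :=
  trunc fun t => (tfImpulse H t).mulVec v

lemma trunc_ratImpulse_mem {r : RatFunc ℝ} (hr : RatProper r) : trunc (ratImpulse r) ∈ signals := by
  have h : trunc (ratImpulse r) = fun t => if 0 ≤ t then impExt r t else 0 := by
    ext t
    by_cases ht : 0 ≤ t
    · rw [trunc_of_nonneg _ ht, if_pos ht, impExt_of_nonneg _ ht]
    · rw [trunc, if_neg ht, if_neg ht]
  refine ⟨?_, fun t ht => trunc_of_neg _ ht, fun T => ?_⟩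
  · rw [h]
    exact Measurable.ite measurableSet_Ici (continuous_impExt hr).measurable measurable_const
  · obtain ⟨C, hC, hb⟩ := exists_bound_Icc (continuous_impExt hr) T
    refine ⟨C, fun t ht => ?_⟩
    rw [h]
    beta_reduce
    split_ifs with h0
    · exact hb t ⟨h0, ht⟩
    · simpa using hC

lemma tfImp_apply (H : Matrix m n (RatFunc ℝ)) (v : n → ℝ) (t : ℝ) (i : m) :
    tfImp H v t i = ∑ j, v j * trunc (ratImpulse (H i j)) t := by
  unfold tfImp trunc
  split_ifs
  · simp [tfImpulse, Matrix.mulVec, dotProduct, mul_comm]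
  · simp

lemma tfImp_mem {H : Matrix m n (RatFunc ℝ)} (hH : MProper H) (v : n → ℝ) :
    tfImp H v ∈ vsignals m := by
  intro i
  have : (fun t => tfImp H v t i) = ∑ j, v j • trunc (ratImpulse (H i j)) := by
    ext t; simp [tfImp_apply]
  rw [this]
  exact signals.sum_mem fun j _ => signals.smul_mem _ (trunc_ratImpulse_mem (hH i j))

/-- A feedthrough of `s` would be a Dirac mass, invisible in `ratImpulse s`, and would contribute a
multiple of `ratImpulse r` to the product; strict properness excludes it. -/
lemma sAct_ratImpulse {r s : RatFunc ℝ} (hr : RatProper r) (hs : RatStrictlyProper s) :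
    sAct r (trunc (ratImpulse s)) = trunc (ratImpulse (r * s)) := by
  ext t
  by_cases ht : 0 ≤ t
  · rw [sAct, causalConv, if_pos ht, trunc_of_nonneg _ ht, trunc_of_nonneg _ ht,
      ratImpulse_mul hr hs.le ht, (ratStrictlyProper_iff.1 hs).2, zero_mul, add_zero]
    congr 1
    refine intervalIntegral.integral_congr fun τ hτ => ?_
    rw [Set.uIcc_of_le ht] at hτ
    rw [impExt_of_nonneg _ (sub_nonneg.2 hτ.2), trunc_of_nonneg _ hτ.1]
  · rw [sAct, causalConv, if_neg ht, trunc_of_neg _ (not_le.1 ht), trunc_of_neg _ (not_le.1 ht)]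
    simp

lemma MStrict.entry {G : Matrix m n (RatFunc ℝ)} (h : MStrict G) (i : m) (j : n) :
    RatStrictlyProper (G i j) :=
  ratStrictlyProper_iff.2 ⟨h.mproper i j, congrFun (congrFun h.ftMat_eq i) j⟩

lemma ratImpulse_sum {ι : Type*} (s : Finset ι) {r : ι → RatFunc ℝ} (hr : ∀ i, RatProper (r i)) :
    trunc (ratImpulse (∑ i ∈ s, r i)) = ∑ i ∈ s, trunc (ratImpulse (r i)) := by
  classical
  induction s using Finset.induction_on with
  | empty =>
    ext t
    by_cases ht : 0 ≤ t
    · have := ratImpulse_const 0 ht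
      rw [map_zero] at this
      simp [trunc_of_nonneg _ ht, this]
    · simp [trunc_of_neg _ (not_le.1 ht)]
  | insert a s ha ih =>
    rw [Finset.sum_insert ha, Finset.sum_insert ha, ← ih]
    ext t
    by_cases ht : 0 ≤ t
    · rw [Pi.add_apply, trunc_of_nonneg _ ht, trunc_of_nonneg _ ht, trunc_of_nonneg _ ht]
      exact ratImpulse_add (hr a) (properRing.sum_mem fun i _ => hr i) ht
    · simp [trunc_of_neg _ (not_le.1 ht)]

lemma tfAct_tfImp {G : Matrix m n (RatFunc ℝ)} {H : Matrix n p (RatFunc ℝ)} (hG : MProper G)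
    (hH : MStrict H) (v : p → ℝ) : tfAct G (tfImp H v) = tfImp (G * H) v := by
  ext t i
  have h1 : ∀ l, (fun τ => tfImp H v τ l) = ∑ j, v j • trunc (ratImpulse (H l j)) := by
    intro l; ext t; simp [tfImp_apply]
  have h2 : ∀ l, sAct (G i l) (fun τ => tfImp H v τ l) =
      ∑ j, v j • trunc (ratImpulse (G i l * H l j)) := by
    intro l
    rw [h1, sAct_sum (hG i l) _ fun j =>
      signals.smul_mem _ (trunc_ratImpulse_mem (hH.mproper l j))]
    refine Finset.sum_congr rfl fun j _ => ?_
    rw [sAct_smul, sAct_ratImpulse (hG i l) (hH.entry l j)]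
  have h3 : ∀ j, trunc (ratImpulse ((G * H) i j)) = ∑ l, trunc (ratImpulse (G i l * H l j)) :=
    fun j => by
      rw [Matrix.mul_apply]
      exact ratImpulse_sum _ fun l => properRing.mul_mem (hG i l) (hH.mproper l j)
  rw [tfImp_apply]
  change ∑ l, sAct (G i l) (fun τ => tfImp H v τ l) t = _
  simp only [h2, h3, Finset.sum_apply, Pi.smul_apply, smul_eq_mul, Finset.mul_sum]
  exact Finset.sum_comm

lemma tfImp_sub {G H : Matrix m n (RatFunc ℝ)} (hG : MProper G) (hH : MProper H) (v : n → ℝ) :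
    tfImp (G - H) v = tfImp G v - tfImp H v := by
  ext t i
  simp only [tfImp_apply, Pi.sub_apply]
  rw [← Finset.sum_sub_distrib]
  refine Finset.sum_congr rfl fun j _ => ?_
  rw [← mul_sub]
  congr 1
  by_cases ht : 0 ≤ t
  · rw [trunc_of_nonneg _ ht, trunc_of_nonneg _ ht, trunc_of_nonneg _ ht]
    have := ratImpulse_add (EntriesIn.sub hG hH i j) (hH i j) ht
    rw [Matrix.sub_apply, sub_add_cancel] at this
    rw [Matrix.sub_apply, this, add_sub_cancel_right]
  · simp [trunc_of_neg _ (not_le.1 ht)]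

lemma mstrict_inv_X_one [DecidableEq n] :
    MStrict ((RatFunc.X : RatFunc ℝ)⁻¹ • (1 : Matrix n n (RatFunc ℝ))) :=
  mstrict_inv_X_smul EntriesIn.one

lemma tfImp_inv_X [DecidableEq n] (v : n → ℝ) :
    tfImp ((RatFunc.X : RatFunc ℝ)⁻¹ • (1 : Matrix n n (RatFunc ℝ))) v = trunc fun _ => v := by
  ext t i
  rw [tfImp_apply]
  by_cases ht : 0 ≤ t
  · have h : ∀ j, trunc (ratImpulse
        (((RatFunc.X : RatFunc ℝ)⁻¹ • (1 : Matrix n n (RatFunc ℝ))) i j)) t =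
        if i = j then 1 else 0 := by
      intro j
      rw [trunc_of_nonneg _ ht, Matrix.smul_apply, Matrix.one_apply]
      split_ifs
      · rw [smul_eq_mul, mul_one, ratImpulse_inv_X ht]
      · rw [smul_zero]
        have := ratImpulse_const 0 ht
        rwa [map_zero] at this
    simp only [h, trunc_of_nonneg _ ht]
    simp
  · simp [trunc_of_neg _ (not_le.1 ht)]

/-- For strictly proper `H`, the impulse response of `H` is the step response of `s H`. -/
lemma tfImp_eq_step [DecidableEq n] {H : Matrix m n (RatFunc ℝ)} (hH : MStrict H) (v : n → ℝ) :
    tfImp H v = tfAct ((RatFunc.X : RatFunc ℝ) • H) (trunc fun _ => v) := by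
  rw [← tfImp_inv_X, tfAct_tfImp hH mstrict_inv_X_one, Matrix.smul_mul, Matrix.mul_smul, smul_smul,
    mul_inv_cancel₀ RatFunc.X_ne_zero, one_smul, Matrix.mul_one]

lemma tfImp_mul_tfConst {H : Matrix m n (RatFunc ℝ)} (hH : MProper H) (B : Matrix n p ℝ)
    (v : p → ℝ) : tfImp (H * tfConst B) v = tfImp H (B.mulVec v) := by
  ext t i
  rw [tfImp_apply, tfImp_apply]
  have h : ∀ j, trunc (ratImpulse ((H * tfConst B) i j)) t =
      ∑ l, B l j * trunc (ratImpulse (H i l)) t := by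
    intro j
    rw [Matrix.mul_apply, ratImpulse_sum _ fun l =>
      properRing.mul_mem (hH i l) (MProper.tfConst B l j), Finset.sum_apply]
    refine Finset.sum_congr rfl fun l _ => ?_
    by_cases ht : 0 ≤ t
    · rw [trunc_of_nonneg _ ht, trunc_of_nonneg _ ht, mul_comm,
        ratImpulse_mul (MProper.tfConst B l j) (hH i l) ht]
      simp only [tfConst, Matrix.map_apply]
      rw [ratImpulse_const _ ht, ratFeedthrough_const]
      have : ∫ τ in (0 : ℝ)..t, ratImpulse ((algebraMap ℝ (RatFunc ℝ)) (B l j)) (t - τ) *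
          ratImpulse (H i l) τ = ∫ τ in (0 : ℝ)..t, (0 : ℝ) := by
        refine intervalIntegral.integral_congr fun τ hτ => ?_
        rw [Set.uIcc_of_le ht] at hτ
        rw [ratImpulse_const _ (sub_nonneg.2 hτ.2), zero_mul]
      rw [this]; simp
    · simp [trunc_of_neg _ (not_le.1 ht)]
  simp only [h, Matrix.mulVec, dotProduct, Finset.mul_sum, Finset.sum_mul]
  rw [Finset.sum_comm]
  refine Finset.sum_congr rfl fun l _ => Finset.sum_congr rfl fun j _ => ?_
  ring

/-! Bounds -/

lemma tfAct_bound_of_stable {G : Matrix m n (RatFunc ℝ)} (hG : MProper G) (hs : MStable G) :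
    ∃ C, 0 ≤ C ∧ ∀ (w : ℝ → n → ℝ) (t c : ℝ), 0 ≤ t → 0 ≤ c → (∀ s ∈ Set.Icc 0 t, ‖w s‖ ≤ c) →
      ‖tfAct G w t‖ ≤ C * c := by
  have hC : 0 ≤ ∑ i, ∑ j, (ratL1 (G i j)).toReal :=
    Finset.sum_nonneg fun i _ => Finset.sum_nonneg fun j _ => ENNReal.toReal_nonneg
  refine ⟨_, hC, fun w t c ht hc hw => ?_⟩
  refine (pi_norm_le_iff_of_nonneg (mul_nonneg hC hc)).2 fun i => ?_
  calc ‖tfAct G w t i‖ ≤ ∑ j, ‖sAct (G i j) (fun τ => w τ j) t‖ := norm_sum_le _ _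
    _ ≤ ∑ j, (ratL1 (G i j)).toReal * c := by
        refine Finset.sum_le_sum fun j _ => ?_
        refine sAct_bound (hG i j) (ratL1_ne_top (hG i j) (ratStable_iff.2 fun z hz => hs z hz i j))
          ht hc fun s hs => (norm_le_pi_norm (w s) j).trans (hw s hs)
    _ = (∑ j, (ratL1 (G i j)).toReal) * c := by rw [Finset.sum_mul]
    _ ≤ _ := by
        gcongr
        exact Finset.single_le_sum (f := fun i => ∑ j, (ratL1 (G i j)).toReal)
          (fun i _ => Finset.sum_nonneg fun j _ => ENNReal.toReal_nonneg) (Finset.mem_univ i)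

end VectorSignals

lemma tfAct_bound {m n : ℕ} {G : Matrix (Fin m) (Fin n) (RatFunc ℝ)} (hG : MProper G)
    (hL : tfL1 G ≠ ⊤) (w : ℝ → Fin n → ℝ) {t c : ℝ} (ht : 0 ≤ t) (hc : 0 ≤ c)
    (hw : ∀ s ∈ Set.Icc 0 t, ‖w s‖ ≤ c) : ‖tfAct G w t‖ ≤ (tfL1 G).toReal * c := by
  refine (pi_norm_le_iff_of_nonneg (mul_nonneg ENNReal.toReal_nonneg hc)).2 fun i => ?_
  have hi : ∑ j, ratL1 (G i j) ≤ tfL1 G := le_iSup (fun i => ∑ j, ratL1 (G i j)) i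
  have hij : ∀ j, ratL1 (G i j) ≠ ⊤ := fun j => ne_top_of_le_ne_top hL
    ((Finset.single_le_sum (f := fun j => ratL1 (G i j)) (fun _ _ => zero_le)
      (Finset.mem_univ j)).trans hi)
  calc ‖tfAct G w t i‖ ≤ ∑ j, ‖sAct (G i j) (fun τ => w τ j) t‖ := norm_sum_le _ _
    _ ≤ ∑ j, (ratL1 (G i j)).toReal * c := by
        refine Finset.sum_le_sum fun j _ => ?_
        exact sAct_bound (hG i j) (hij j) ht hc
          fun s hs => (norm_le_pi_norm (w s) j).trans (hw s hs)
    _ = (∑ j, ratL1 (G i j)).toReal * c := by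
        rw [← Finset.sum_mul, ENNReal.toReal_sum fun j _ => hij j]
    _ ≤ _ := by gcongr


/-! Linear state equations -/

section StateSpace

variable {n m p : Type*} [Fintype n] [DecidableEq n] [Fintype m] [Fintype p]

lemma sAct_inv_X (w : ℝ → ℝ) {t : ℝ} (ht : 0 ≤ t) :
    sAct (RatFunc.X : RatFunc ℝ)⁻¹ w t = ∫ τ in (0 : ℝ)..t, w τ := by
  rw [sAct, causalConv, if_pos ht, (ratStrictlyProper_iff.1 ratStrictlyProper_inv_X).2, zero_mul,
    zero_add]
  refine intervalIntegral.integral_congr fun τ hτ => ?_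
  rw [Set.uIcc_of_le ht] at hτ
  rw [impExt_of_nonneg _ (sub_nonneg.2 hτ.2), ratImpulse_inv_X (sub_nonneg.2 hτ.2), one_mul]

lemma vsignals_intervalIntegrable {w : ℝ → n → ℝ} (hw : w ∈ vsignals n) {a b : ℝ} (hab : a ≤ b) :
    IntervalIntegrable w volume a b := by
  rw [intervalIntegrable_iff_integrableOn_Ioc_of_le hab]
  obtain ⟨C, hC, hb⟩ := vsignals_bound hw b
  have hm : Measurable w := measurable_pi_iff.2 fun j => (hw j).1
  refine Measure.integrableOn_of_bounded (M := C) (by simp) hm.aestronglyMeasurable ?_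
  exact (ae_restrict_mem measurableSet_Ioc).mono fun s hs => hb s hs.2

lemma intervalIntegral_apply {w : ℝ → n → ℝ} {a b : ℝ} (hw : IntervalIntegrable w volume a b)
    (i : n) : (∫ τ in a..b, w τ) i = ∫ τ in a..b, w τ i :=
  ((ContinuousLinearMap.proj (R := ℝ) (φ := fun _ : n => ℝ) i).intervalIntegral_comp_comm hw).symm

lemma mulVec_intervalIntegral (A : Matrix m n ℝ) {w : ℝ → n → ℝ} {a b : ℝ}
    (hw : IntervalIntegrable w volume a b) :
    A.mulVec (∫ τ in a..b, w τ) = ∫ τ in a..b, A.mulVec (w τ) :=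
  ((Matrix.mulVecLin A).toContinuousLinearMap.intervalIntegral_comp_comm hw).symm

lemma tfAct_inv_X {w : ℝ → n → ℝ} (hw : w ∈ vsignals n) {t : ℝ} (ht : 0 ≤ t) :
    tfAct ((RatFunc.X : RatFunc ℝ)⁻¹ • (1 : Matrix n n (RatFunc ℝ))) w t =
      ∫ τ in (0 : ℝ)..t, w τ := by
  ext i
  rw [intervalIntegral_apply (vsignals_intervalIntegrable hw ht)]
  change ∑ j, sAct _ _ t = _
  have h : ∀ j, sAct (((RatFunc.X : RatFunc ℝ)⁻¹ • (1 : Matrix n n (RatFunc ℝ))) i j)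
      (fun τ => w τ j) t = if i = j then ∫ τ in (0 : ℝ)..t, w τ j else 0 := by
    intro j
    rw [Matrix.smul_apply, Matrix.one_apply]
    split_ifs
    · rw [smul_eq_mul, mul_one, sAct_inv_X _ ht]
    · rw [smul_zero, ← map_zero (algebraMap ℝ (RatFunc ℝ)), sAct_const, zero_smul]; rfl
  simp only [h]
  simp

lemma trunc_const_mem (v : n → ℝ) : trunc (fun _ : ℝ => v) ∈ vsignals n := by
  rw [← tfImp_inv_X]; exact tfImp_mem mstrict_inv_X_one.mproper v

/-- Solutions of the integrated state equation are given by the resolvent. -/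
lemma eq_resolvent_of_integral_eq (A : Matrix n n ℝ) {X V : ℝ → n → ℝ} (hX : X ∈ vsignals n)
    (hV : V ∈ vsignals n) (x₀ : n → ℝ)
    (h : ∀ t, 0 ≤ t → X t = x₀ + ∫ τ in (0 : ℝ)..t, (A.mulVec (X τ) + V τ)) :
    X = tfImp (tfResolvent A) x₀ + tfAct (tfResolvent A) V := by
  set J : Matrix n n (RatFunc ℝ) := (RatFunc.X : RatFunc ℝ)⁻¹ • 1 with hJ
  have hJp : MProper J := mstrict_inv_X_one.mproper
  have hAp : MProper (tfConst A) := MProper.tfConst A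
  have hR : MStrict (tfResolvent A) := mstrict_resolvent A
  have hAX : tfAct (tfConst A) X ∈ vsignals n := tfAct_mem hAp hX
  have h1 : X = trunc (fun _ => x₀) + tfAct J (tfAct (tfConst A) X + V) := by
    refine vsignals_ext hX ((vsignals n).add_mem (trunc_const_mem x₀)
      (tfAct_mem hJp ((vsignals n).add_mem hAX hV))) fun t ht => ?_
    rw [Pi.add_apply, tfAct_inv_X ((vsignals n).add_mem hAX hV) ht, trunc_of_nonneg _ ht, h t ht,
      tfAct_tfConst]
    rfl
  have hJA : J * tfConst A = (RatFunc.X : RatFunc ℝ)⁻¹ • tfConst A := by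
    rw [hJ, Matrix.smul_mul, Matrix.one_mul]
  -- The integrated equation reads `(1 - s⁻¹ A) X = s⁻¹ x₀ + s⁻¹ V`. In this form all operators are
  -- proper, in contrast to `sI - A`, and the left-hand side is inverted by the proper matrix `s (sI
  -- - A)⁻¹`.
  have h2 : tfAct (1 - (RatFunc.X : RatFunc ℝ)⁻¹ • tfConst A) X =
      trunc (fun _ => x₀) + tfAct J V := by
    rw [tfAct_sub_left EntriesIn.one (mstrict_inv_X_smul hAp).mproper hX, tfAct_one, ← hJA,
      tfAct_mul hJp hAp hX]
    rw [tfAct_add hJp hAX hV] at h1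
    nth_rewrite 1 [h1]
    abel
  have h3 := congrArg (tfAct ((RatFunc.X : RatFunc ℝ) • tfResolvent A)) h2
  rw [← tfAct_mul hR (mproper_one_sub A) hX, X_smul_resolvent_mul, tfAct_one,
    tfAct_add hR (trunc_const_mem x₀) (tfAct_mem hJp hV), ← tfImp_eq_step hR,
    ← tfAct_mul hR hJp hV, hJ, Matrix.smul_mul, Matrix.mul_smul, smul_smul,
    mul_inv_cancel₀ RatFunc.X_ne_zero, one_smul, Matrix.mul_one] at h3
  exact h3

lemma isUnit_det_of_isHurwitz {A : Matrix n n ℝ} (hA : IsHurwitz A) : IsUnit A.det := by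
  rw [isUnit_iff_ne_zero, Matrix.det_eq_sign_charpoly_coeff]
  refine mul_ne_zero (pow_ne_zero _ (by norm_num)) fun h => ?_
  have := hA 0 (by
    rw [aeval_def, eval₂_eq_eval_map, ← coeff_zero_eq_eval_zero, coeff_map, h, map_zero])
  simp at this

/-! ### Matrix exponentials and variation of constants. -/

open scoped Matrix.Norms.Operator

lemma mulVec_norm_le (A : Matrix m n ℝ) (v : n → ℝ) : ‖A.mulVec v‖ ≤ ‖A‖ * ‖v‖ :=
  Matrix.linfty_opNorm_mulVec A v

lemma hasDerivAt_exp_mulVec (A : Matrix n n ℝ) (v : n → ℝ) (t : ℝ) :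
    HasDerivAt (fun u : ℝ => (NormedSpace.exp (u • A)).mulVec v)
      (A.mulVec ((NormedSpace.exp (t • A)).mulVec v)) t := by
  have h := hasDerivAt_exp_smul_const' A t
  let L : Matrix n n ℝ →L[ℝ] (n → ℝ) :=
    LinearMap.toContinuousLinearMap ((Matrix.mulVecBilin ℝ ℝ).flip v)
  have hl := L.hasFDerivAt.comp_hasDerivAt t h
  have e : L (A * NormedSpace.exp (t • A)) = A.mulVec ((NormedSpace.exp (t • A)).mulVec v) := by
    simp [L]
  exact e ▸ hl

lemma continuous_exp_smul (A : Matrix n n ℝ) :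
    Continuous fun u : ℝ => NormedSpace.exp (u • A) :=
  continuous_iff_continuousAt.2 fun t => (hasDerivAt_exp_smul_const' A t).continuousAt

lemma exp_add_smul (A : Matrix n n ℝ) (s t : ℝ) :
    NormedSpace.exp ((s + t) • A) = NormedSpace.exp (s • A) * NormedSpace.exp (t • A) := by
  rw [add_smul]
  exact Matrix.exp_add_of_commute _ _ ((Commute.refl A).smul_left s |>.smul_right t)

/-- `e^{tA} v` solves the integrated homogeneous equation, whose solution is already known to be
given by the resolvent. -/
lemma tfImp_resolvent (A : Matrix n n ℝ) (v : n → ℝ) :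
    tfImp (tfResolvent A) v = trunc fun t => (NormedSpace.exp (t • A)).mulVec v := by
  have hc : Continuous fun t : ℝ => (NormedSpace.exp (t • A)).mulVec v :=
    continuous_iff_continuousAt.2 fun t => (hasDerivAt_exp_mulVec A v t).continuousAt
  have hX : trunc (fun t : ℝ => (NormedSpace.exp (t • A)).mulVec v) ∈ vsignals n := by
    refine trunc_mem_vsignals (Measurable.ite measurableSet_Ici hc.measurable measurable_const)
      fun T => (isCompact_Icc.exists_bound_of_continuousOn hc.continuousOn)
  have h := eq_resolvent_of_integral_eq A hX (vsignals n).zero_mem v (fun t ht => by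
    have hcongr : Set.EqOn (fun τ => A.mulVec (trunc (fun t : ℝ =>
        (NormedSpace.exp (t • A)).mulVec v) τ) + (0 : ℝ → n → ℝ) τ)
        (fun τ : ℝ => A.mulVec ((NormedSpace.exp (τ • A)).mulVec v)) (Set.uIcc 0 t) := by
      intro τ hτ
      rw [Set.uIcc_of_le ht] at hτ
      beta_reduce
      rw [trunc_of_nonneg _ hτ.1, Pi.zero_apply, add_zero]
    rw [intervalIntegral.integral_congr hcongr,
      intervalIntegral.integral_eq_sub_of_hasDerivAt (fun τ _ => hasDerivAt_exp_mulVec A v τ),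
      trunc_of_nonneg _ ht, zero_smul, NormedSpace.exp_zero, Matrix.one_mulVec]
    · abel
    · exact ((Matrix.mulVecLin A).continuous_of_finiteDimensional.comp hc).intervalIntegrable _ _)
  have h0 : tfAct (tfResolvent A) (0 : ℝ → n → ℝ) = 0 := by
    have := tfAct_smul (tfResolvent A) 0 (0 : ℝ → n → ℝ)
    simpa using this
  rw [h0, add_zero] at h
  exact h.symm

lemma tfImpulse_resolvent (A : Matrix n n ℝ) {t : ℝ} (ht : 0 ≤ t) :
    tfImpulse (tfResolvent A) t = NormedSpace.exp (t • A) := by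
  ext i j
  have h := congrFun (congrFun (tfImp_resolvent A (Pi.single j 1)) t) i
  rw [tfImp, trunc_of_nonneg _ ht, trunc_of_nonneg _ ht] at h
  simpa using h

lemma trunc_eq_self {w : ℝ → n → ℝ} (hw : w ∈ vsignals n) : trunc w = w := by
  ext1 t
  rcases lt_or_ge t 0 with ht | ht
  · rw [trunc_of_neg _ ht, vsignals_neg hw ht]
  · exact trunc_of_nonneg _ ht

lemma tfAct_resolvent (A : Matrix n n ℝ) {V : ℝ → n → ℝ} (hV : V ∈ vsignals n) {t : ℝ}
    (ht : 0 ≤ t) : tfAct (tfResolvent A) V t =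
      ∫ τ in (0 : ℝ)..t, (NormedSpace.exp ((t - τ) • A)).mulVec (V τ) := by
  have hR := mstrict_resolvent A
  have hft : (Matrix.of fun i j => ratFeedthrough (tfResolvent A i j)) = 0 := hR.ftMat_eq
  have h := tfApply_eq hR.mproper (by rwa [trunc_eq_self hV]) ht (w := V)
  rw [trunc_eq_self hV] at h
  rw [← h, tfApply, hft, Matrix.zero_mulVec, zero_add]
  refine intervalIntegral.integral_congr fun τ hτ => ?_
  rw [Set.uIcc_of_le ht] at hτ
  rw [tfImpulse_resolvent A (sub_nonneg.2 hτ.2)]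

lemma exp_mulVec_intervalIntegrable (A : Matrix n n ℝ) {V : ℝ → n → ℝ} (hV : V ∈ vsignals n)
    (c : ℝ) {a b : ℝ} (hab : a ≤ b) :
    IntervalIntegrable (fun τ => (NormedSpace.exp ((c - τ) • A)).mulVec (V τ)) volume a b := by
  rw [intervalIntegrable_iff_integrableOn_Ioc_of_le hab]
  obtain ⟨C, hC, hb⟩ := vsignals_bound hV b
  have hc : Continuous fun τ : ℝ => NormedSpace.exp ((c - τ) • A) :=
    (continuous_exp_smul A).comp (continuous_const.sub continuous_id)
  obtain ⟨B, hB⟩ := (isCompact_Icc (a := a) (b := b)).exists_bound_of_continuousOn hc.continuousOn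
  have hm : Measurable fun τ => (NormedSpace.exp ((c - τ) • A)).mulVec (V τ) := by
    refine measurable_pi_iff.2 fun i => ?_
    simp only [Matrix.mulVec, dotProduct]
    refine Finset.measurable_sum _ fun j _ => Measurable.mul ?_ (hV j).1
    exact ((continuous_apply j).comp ((continuous_apply i).comp hc)).measurable
  refine Measure.integrableOn_of_bounded (M := B * C) (by simp) hm.aestronglyMeasurable ?_
  refine (ae_restrict_mem measurableSet_Ioc).mono fun s hs => ?_
  refine (mulVec_norm_le _ _).trans ?_
  have h1 := hB s ⟨hs.1.le, hs.2⟩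
  exact mul_le_mul h1 (hb s hs.2) (norm_nonneg _) ((norm_nonneg _).trans h1)

/-- Variation of constants over a time step. -/
lemma tfAct_resolvent_step (A : Matrix n n ℝ) {V : ℝ → n → ℝ} (hV : V ∈ vsignals n) {t h : ℝ}
    (ht : 0 ≤ t) (hh : 0 ≤ h) : tfAct (tfResolvent A) V (t + h) =
      (NormedSpace.exp (h • A)).mulVec (tfAct (tfResolvent A) V t) +
        ∫ τ in t..(t + h), (NormedSpace.exp ((t + h - τ) • A)).mulVec (V τ) := by
  rw [tfAct_resolvent A hV (add_nonneg ht hh), tfAct_resolvent A hV ht,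
    mulVec_intervalIntegral _ (exp_mulVec_intervalIntegrable A hV t ht),
    ← intervalIntegral.integral_add_adjacent_intervals
      (exp_mulVec_intervalIntegrable A hV (t + h) ht)
      (exp_mulVec_intervalIntegrable A hV (t + h) (by linarith : t ≤ t + h))]
  congr 1
  refine intervalIntegral.integral_congr fun τ _ => ?_
  rw [Matrix.mulVec_mulVec, ← exp_add_smul]
  congr 3; ring

/-- The response to a held input. It is the input matrix of the controller's recursions, which are
therefore exact samples of continuous-time systems. -/
lemma integral_exp_mulVec_const {A : Matrix n n ℝ} (hA : IsUnit A.det) (c : n → ℝ) (t h : ℝ) :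
    ∫ τ in t..(t + h), (NormedSpace.exp ((t + h - τ) • A)).mulVec c =
      (A⁻¹ * (NormedSpace.exp (h • A) - 1)).mulVec c := by
  have hd : ∀ τ : ℝ, HasDerivAt (fun τ : ℝ => -(A⁻¹.mulVec ((NormedSpace.exp ((t + h - τ) • A)).mulVec c)))
      ((NormedSpace.exp ((t + h - τ) • A)).mulVec c) τ := by
    intro τ
    have h1 : HasDerivAt (fun τ : ℝ => t + h - τ) (-1) τ := by
      simpa using (hasDerivAt_id τ).const_sub (t + h)
    have h2 := (hasDerivAt_exp_mulVec A c (t + h - τ)).scomp τ h1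
    have h3 := ((Matrix.mulVecLin A⁻¹).toContinuousLinearMap.hasFDerivAt.comp_hasDerivAt
      (F := n → ℝ) τ h2).neg
    refine h3.congr_deriv ?_
    simp [Matrix.mulVec_neg, Matrix.nonsing_inv_mul_cancel_left _ _ hA]
  have hc : Continuous fun τ : ℝ => (NormedSpace.exp ((t + h - τ) • A)).mulVec c :=
    (continuous_iff_continuousAt.2 fun t => (hasDerivAt_exp_mulVec A c t).continuousAt).comp
      (continuous_const.sub continuous_id)
  rw [intervalIntegral.integral_eq_sub_of_hasDerivAt (fun τ _ => hd τ) (hc.intervalIntegrable _ _)]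
  rw [sub_self, zero_smul, NormedSpace.exp_zero, add_sub_cancel_left, ← Matrix.mulVec_mulVec,
    Matrix.sub_mulVec, Matrix.mulVec_sub]
  abel

lemma exists_exp_bound (A : Matrix n n ℝ) :
    ∃ E, 0 ≤ E ∧ ∀ h ∈ Set.Icc (0 : ℝ) 1, ‖NormedSpace.exp (h • A)‖ ≤ E := by
  obtain ⟨B, hB⟩ := (isCompact_Icc (a := (0 : ℝ)) (b := 1)).exists_bound_of_continuousOn
    (continuous_exp_smul A).continuousOn
  exact ⟨B, (norm_nonneg _).trans (hB 0 (by simp)), hB⟩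

lemma exists_exp_sub_one_bound (A : Matrix n n ℝ) :
    ∃ E, 0 ≤ E ∧ ∀ h ∈ Set.Icc (0 : ℝ) 1, ‖NormedSpace.exp (h • A) - 1‖ ≤ E * h := by
  obtain ⟨B, hB0, hB⟩ := exists_exp_bound A
  refine ⟨‖A‖ * B, by positivity, fun h hh => ?_⟩
  have h1 := norm_image_sub_le_of_norm_deriv_le_segment'
    (f := fun u : ℝ => NormedSpace.exp (u • A)) (f' := fun u => A * NormedSpace.exp (u • A))
    (a := 0) (b := 1) (C := ‖A‖ * B)
    (fun x _ => (hasDerivAt_exp_smul_const' A x).hasDerivWithinAt)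
    (fun x hx => (norm_mul_le _ _).trans (by
      gcongr; exact hB x ⟨hx.1, hx.2.le⟩)) h hh
  simpa using h1

lemma norm_integral_exp_mulVec_le (A : Matrix n n ℝ) {E : ℝ}
    (hE : ∀ h ∈ Set.Icc (0 : ℝ) 1, ‖NormedSpace.exp (h • A)‖ ≤ E) (hE0 : 0 ≤ E)
    {V : ℝ → n → ℝ} {t h c : ℝ} (hh : h ∈ Set.Icc (0 : ℝ) 1)
    (hV : ∀ s ∈ Set.Ioc t (t + h), ‖V s‖ ≤ c) :
    ‖∫ τ in t..(t + h), (NormedSpace.exp ((t + h - τ) • A)).mulVec (V τ)‖ ≤ E * c * h := by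
  have h1 := intervalIntegral.norm_integral_le_of_norm_le_const (a := t) (b := t + h) (C := E * c)
    (f := fun τ => (NormedSpace.exp ((t + h - τ) • A)).mulVec (V τ)) fun τ hτ => by
      rw [Set.uIoc_of_le (by linarith [hh.1])] at hτ
      refine (mulVec_norm_le _ _).trans ?_
      exact mul_le_mul (hE _ ⟨by linarith [hτ.2], by linarith [hτ.1, hh.2]⟩) (hV τ hτ)
        (norm_nonneg _) hE0
  rwa [add_sub_cancel_left, abs_of_nonneg hh.1] at h1

end StateSpace


/-! Minimal realizations of stable transfer matrices -/

section Minimal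

variable {n : Type*} [Fintype n] [DecidableEq n] {m p : Type*}

lemma resolvent_intertwine {n' : Type*} [Fintype n'] [DecidableEq n'] {A : Matrix n n ℝ}
    {A' : Matrix n' n' ℝ} {W : Matrix n n' ℝ} (h : A * W = W * A') :
    tfResolvent A * tfConst W = tfConst W * tfResolvent A' := by
  have h1 : ((RatFunc.X : RatFunc ℝ) • (1 : Matrix n n (RatFunc ℝ)) - tfConst A) * tfConst W =
      tfConst W * ((RatFunc.X : RatFunc ℝ) • (1 : Matrix n' n' (RatFunc ℝ)) - tfConst A') := by
    rw [Matrix.sub_mul, Matrix.mul_sub, ← tfConst_mul, ← tfConst_mul, h]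
    simp
  calc tfResolvent A * tfConst W
      = tfResolvent A * (tfConst W * (((RatFunc.X : RatFunc ℝ) • (1 : Matrix n' n' (RatFunc ℝ)) -
          tfConst A') * tfResolvent A')) := by rw [mul_resolvent, Matrix.mul_one]
    _ = tfResolvent A * (((RatFunc.X : RatFunc ℝ) • (1 : Matrix n n (RatFunc ℝ)) - tfConst A) *
          tfConst W) * tfResolvent A' := by rw [h1]; simp only [Matrix.mul_assoc]
    _ = _ := by rw [← Matrix.mul_assoc, resolvent_mul, Matrix.one_mul]

lemma resolvent_mul_const (A : Matrix n n ℝ) :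
    tfResolvent A * tfConst A = (RatFunc.X : RatFunc ℝ) • tfResolvent A - 1 := by
  have h := resolvent_mul A
  rw [Matrix.mul_sub, Matrix.mul_smul, Matrix.mul_one] at h
  rw [← h]; abel

lemma const_mul_resolvent (A : Matrix n n ℝ) :
    tfConst A * tfResolvent A = (RatFunc.X : RatFunc ℝ) • tfResolvent A - 1 := by
  have h := mul_resolvent A
  rw [Matrix.sub_mul, Matrix.smul_mul, Matrix.one_mul] at h
  rw [← h]; abel

lemma tfResolvent_transpose (A : Matrix n n ℝ) :
    (tfResolvent A).transpose = tfResolvent A.transpose := by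
  rw [tfResolvent, Matrix.transpose_nonsing_inv, tfResolvent, Matrix.transpose_sub,
    Matrix.transpose_smul, Matrix.transpose_one]
  rfl

lemma tfOf_transpose (A : Matrix n n ℝ) (B : Matrix n p ℝ) (C : Matrix m n ℝ) :
    (tfOf A B C).transpose = tfOf A.transpose C.transpose B.transpose := by
  rw [tfOf, tfOf, Matrix.transpose_mul, Matrix.transpose_mul, tfResolvent_transpose,
    Matrix.mul_assoc]
  rfl

lemma IsMinimalRealization.transpose {n : ℕ} {A : Matrix (Fin n) (Fin n) ℝ}
    {B : Matrix (Fin n) p ℝ} {C : Matrix m (Fin n) ℝ} {G : Matrix m p (RatFunc ℝ)}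
    (h : IsMinimalRealization A B C G) :
    IsMinimalRealization A.transpose C.transpose B.transpose G.transpose := by
  refine ⟨by rw [← tfOf_transpose, h.1], fun n' A' B' C' h' => ?_⟩
  refine h.2 n' A'.transpose C'.transpose B'.transpose ?_
  rw [← tfOf_transpose, h', Matrix.transpose_transpose]

/-- The reachable subspace is `A`-invariant and contains the columns of `B`. If it were proper,
restricting the system to it would realize the same transfer matrix with a smaller order. -/
lemma IsMinimalRealization.isControllable {n : ℕ} {A : Matrix (Fin n) (Fin n) ℝ}
    {B : Matrix (Fin n) p ℝ} {C : Matrix m (Fin n) ℝ} {G : Matrix m p (RatFunc ℝ)}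
    (h : IsMinimalRealization A B C G) : IsControllable A B := by
  set V := Submodule.span ℝ (Set.range fun q : ℕ × p => fun i => (A ^ q.1 * B) i q.2) with hV
  by_contra hne
  change ¬ V = ⊤ at hne
  have hlt : Module.finrank ℝ V < n := by
    have := Submodule.finrank_lt hne
    simpa using this
  have hinv : ∀ v ∈ V, A.mulVec v ∈ V := by
    intro v hv
    induction hv using Submodule.span_induction with
    | mem x hx =>
      obtain ⟨⟨q, j⟩, rfl⟩ := hx
      refine Submodule.subset_span ⟨(q + 1, j), ?_⟩
      ext i
      simp only [pow_succ', Matrix.mul_assoc]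
      rfl
    | zero => rw [Matrix.mulVec_zero]; exact V.zero_mem
    | add x y _ _ hx hy => rw [Matrix.mulVec_add]; exact V.add_mem hx hy
    | smul a x _ hx => rw [Matrix.mulVec_smul]; exact V.smul_mem a hx
  have hB : ∀ j, (fun i => B i j) ∈ V := fun j =>
    Submodule.subset_span ⟨(0, j), by ext i; simp⟩
  let b := Module.finBasis ℝ V
  let W : Matrix (Fin n) (Fin (Module.finrank ℝ V)) ℝ := Matrix.of fun i l => (b l : Fin n → ℝ) i
  have hrep : ∀ v (hv : v ∈ V), W.mulVec (b.repr ⟨v, hv⟩) = v := by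
    intro v hv
    have h1 := congrArg Subtype.val (b.sum_repr ⟨v, hv⟩)
    rw [AddSubmonoidClass.coe_finsetSum] at h1
    ext i
    have h2 := congrFun h1 i
    simp only [Finset.sum_apply] at h2
    rw [← h2]
    simp [W, Matrix.mulVec, dotProduct, mul_comm]
  let A' : Matrix (Fin (Module.finrank ℝ V)) (Fin (Module.finrank ℝ V)) ℝ :=
    Matrix.of fun i l => b.repr ⟨A.mulVec (b l), hinv _ (b l).2⟩ i
  let B' : Matrix (Fin (Module.finrank ℝ V)) p ℝ := Matrix.of fun i j => b.repr ⟨_, hB j⟩ i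
  have hAW : A * W = W * A' := by
    ext i l
    exact (congrFun (hrep _ (hinv _ (b l).2)) i).symm
  have hBW : B = W * B' := by
    ext i j
    exact (congrFun (hrep _ (hB j)) i).symm
  have hreal : tfOf A' B' (C * W) = G := by
    rw [← h.1, tfOf, tfOf, hBW, tfConst_mul, tfConst_mul, Matrix.mul_assoc (tfConst C),
      ← resolvent_intertwine hAW]
    simp only [Matrix.mul_assoc]
  exact absurd (h.2 _ A' B' (C * W) hreal) (not_le.2 hlt)

/-- Since `A (sI - A)⁻¹ = s (sI - A)⁻¹ - I`, each further factor `A` amounts to multiplying by `s`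
and subtracting a constant matrix, which creates no finite poles. -/
lemma regular_markov {A : Matrix n n ℝ} {B : Matrix n p ℝ} {C : Matrix m n ℝ} {z : ℂ}
    (h : EntriesIn (regularRing z) (tfOf A B C)) (l q : ℕ) :
    EntriesIn (regularRing z) (tfConst (C * A ^ l) * tfResolvent A * tfConst (A ^ q * B)) := by
  have hX : ∀ {S : Matrix m p (RatFunc ℝ)} (T : Matrix m p ℝ), EntriesIn (regularRing z) S →
      EntriesIn (regularRing z) ((RatFunc.X : RatFunc ℝ) • S - tfConst T) := fun T hS =>
    EntriesIn.sub (fun i j => (regularRing z).mul_mem (X_mem_regularRing z) (hS i j))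
      (fun i j => const_mem_regularRing _ z)
  induction l with
  | zero =>
    induction q with
    | zero => simpa [tfOf] using h
    | succ q ih =>
      have e : tfConst (C * A ^ 0) * tfResolvent A * tfConst (A ^ (q + 1) * B) =
          (RatFunc.X : RatFunc ℝ) • (tfConst (C * A ^ 0) * tfResolvent A * tfConst (A ^ q * B)) -
            tfConst (C * A ^ 0 * (A ^ q * B)) := by
        rw [pow_succ', Matrix.mul_assoc A, tfConst_mul A, Matrix.mul_assoc, ← Matrix.mul_assoc _ _
          (tfConst (A ^ q * B)), resolvent_mul_const, Matrix.sub_mul, Matrix.one_mul,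
          Matrix.mul_sub, Matrix.smul_mul, Matrix.mul_smul, ← tfConst_mul,
          ← Matrix.mul_assoc (tfConst _)]
      rw [e]; exact hX _ ih
  | succ l ih =>
    have e : tfConst (C * A ^ (l + 1)) * tfResolvent A * tfConst (A ^ q * B) =
        (RatFunc.X : RatFunc ℝ) • (tfConst (C * A ^ l) * tfResolvent A * tfConst (A ^ q * B)) -
          tfConst (C * A ^ l * (A ^ q * B)) := by
      rw [pow_succ, ← Matrix.mul_assoc C, tfConst_mul _ A, Matrix.mul_assoc (tfConst (C * A ^ l)),
        const_mul_resolvent, Matrix.mul_sub, Matrix.mul_one, Matrix.mul_smul, Matrix.sub_mul,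
        Matrix.smul_mul, ← tfConst_mul]
    rw [e]; exact hX _ ih

/-- `uᵀ (s I - A)⁻¹ v` has no pole at `z`. -/
def RegularPair (A : Matrix n n ℝ) (z : ℂ) (u v : n → ℝ) : Prop :=
  (∑ i, algebraMap ℝ (RatFunc ℝ) (u i) * ∑ j, tfResolvent A i j * algebraMap ℝ (RatFunc ℝ) (v j)) ∈
    regularRing z

/-- Regularity is preserved by linear combinations in each argument separately, so two spanning
families suffice. -/
lemma regularPair_of_span {A : Matrix n n ℝ} {z : ℂ} {S T : Set (n → ℝ)}
    (h : ∀ u ∈ S, ∀ v ∈ T, RegularPair A z u v) (hS : Submodule.span ℝ S = ⊤)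
    (hT : Submodule.span ℝ T = ⊤) (u v : n → ℝ) : RegularPair A z u v := by
  have h1 : ∀ u ∈ S, ∀ v, RegularPair A z u v := by
    intro u hu v
    have hv : v ∈ Submodule.span ℝ T := hT ▸ Submodule.mem_top
    induction hv using Submodule.span_induction with
    | mem x hx => exact h u hu x hx
    | zero => simp [RegularPair, (regularRing z).zero_mem]
    | add x y _ _ hx hy =>
      have := (regularRing z).add_mem hx hy
      simpa only [RegularPair, Pi.add_apply, map_add, mul_add, Finset.sum_add_distrib] using this
    | smul a x _ hx =>
      have := (regularRing z).mul_mem (const_mem_regularRing a z) hx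
      simpa only [RegularPair, Pi.smul_apply, smul_eq_mul, map_mul, Finset.mul_sum,
        mul_left_comm] using this
  have hu : u ∈ Submodule.span ℝ S := hS ▸ Submodule.mem_top
  induction hu using Submodule.span_induction with
  | mem x hx => exact h1 x hx v
  | zero => simp [RegularPair, (regularRing z).zero_mem]
  | add x y _ _ hx hy =>
    have := (regularRing z).add_mem hx hy
    simpa only [RegularPair, Pi.add_apply, map_add, add_mul, Finset.sum_add_distrib] using this
  | smul a x _ hx =>
    have := (regularRing z).mul_mem (const_mem_regularRing a z) hx
    simpa only [RegularPair, Pi.smul_apply, smul_eq_mul, map_mul, Finset.mul_sum,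
      mul_assoc] using this

/-- If the resolvent has no pole at `z`, then `(sI - A) (sI - A)⁻¹ = I` can be evaluated at `z`, and
taking determinants shows that `zI - A` is invertible. -/
lemma charpoly_ne_zero_of_regular {A : Matrix n n ℝ} {z : ℂ}
    (h : EntriesIn (regularRing z) (tfResolvent A)) : aeval z A.charpoly ≠ 0 := by
  intro h0
  have hmap : (Matrix.scalar n z - A.map (algebraMap ℝ ℂ)).det = 0 := by
    rw [← Matrix.eval_charpoly, Matrix.charpoly_map, eval_map]; exact h0
  have hX : evalAt z ⟨RatFunc.X, X_mem_regularRing z⟩ = z := by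
    rw [evalAt_apply]; exact RatFunc.eval_X _ _
  have hc : ∀ c : ℝ, evalAt z ⟨algebraMap ℝ (RatFunc ℝ) c, const_mem_regularRing c z⟩ = c := by
    intro c
    change RatFunc.eval (algebraMap ℝ ℂ) z (algebraMap ℝ (RatFunc ℝ) c) = c
    rw [RatFunc.algebraMap_eq_C]; exact RatFunc.eval_C _ _
  let A' : Matrix n n (regularRing z) :=
    Matrix.of fun i j => ⟨algebraMap ℝ (RatFunc ℝ) (A i j), const_mem_regularRing _ z⟩
  let x : regularRing z := ⟨RatFunc.X, X_mem_regularRing z⟩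
  have h1 : (Matrix.scalar n x - A') * h.lift = 1 := by
    have h2 : Function.Injective fun Q : Matrix n n (regularRing z) =>
        (regularRing z).subtype.mapMatrix Q := fun P Q hPQ => by
      ext i j
      exact congrFun (congrFun hPQ i) j
    apply h2
    simp only [map_mul, map_one]
    have h3 : (regularRing z).subtype.mapMatrix (Matrix.scalar n x - A') =
        (RatFunc.X : RatFunc ℝ) • (1 : Matrix n n (RatFunc ℝ)) - tfConst A := by
      ext i j
      simp only [RingHom.mapMatrix_apply, Matrix.map_apply, Matrix.sub_apply, Matrix.scalar_apply,
        Matrix.diagonal_apply, Matrix.smul_apply, Matrix.one_apply, map_sub]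
      congr 1
      split_ifs <;> simp [x]
    rw [h3, RingHom.mapMatrix_apply, h.map_lift, mul_resolvent]
  have h4 := congrArg (fun Q => ((evalAt z).mapMatrix Q).det) h1
  simp only [map_mul, map_one, Matrix.det_mul, Matrix.det_one] at h4
  have h5 : (evalAt z).mapMatrix (Matrix.scalar n x - A') =
      Matrix.scalar n z - A.map (algebraMap ℝ ℂ) := by
    ext i j
    simp only [RingHom.mapMatrix_apply, Matrix.map_apply, Matrix.sub_apply, Matrix.scalar_apply,
      Matrix.diagonal_apply, map_sub]
    congr 1
    · split_ifs
      · exact hX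
      · exact map_zero _
    · exact hc _
  rw [h5, hmap, zero_mul] at h4
  exact zero_ne_one h4

/-- By minimality the vectors `A^q B` span, and so do `(Aᵀ)^l Cᵀ`, by passing to the transpose.
Regularity of `C A^l (sI - A)⁻¹ A^q B` at `z` therefore passes to the whole resolvent: there are no
hidden unstable modes. -/
lemma IsMinimalRealization.isHurwitz {n : ℕ} {A : Matrix (Fin n) (Fin n) ℝ}
    {B : Matrix (Fin n) p ℝ} {C : Matrix m (Fin n) ℝ} {G : Matrix m p (RatFunc ℝ)}
    (h : IsMinimalRealization A B C G) (hG : MStable G) : IsHurwitz A := by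
  intro z hz
  by_contra hre
  have hGz := hG z (not_lt.1 hre)
  rw [← h.1] at hGz
  refine charpoly_ne_zero_of_regular (A := A) (z := z) ?_ hz
  have key := regularPair_of_span (A := A) (z := z) (fun u hu v hv => ?_)
    h.transpose.isControllable h.isControllable
  · intro i j
    have := key (Pi.single i 1) (Pi.single j 1)
    unfold RegularPair at this
    rwa [Finset.sum_eq_single i (by intro b _ hb; simp [Pi.single_eq_of_ne hb]) (by simp),
      Finset.sum_eq_single j (by intro b _ hb; simp [Pi.single_eq_of_ne hb]) (by simp),
      Pi.single_eq_same, Pi.single_eq_same, map_one, one_mul, mul_one] at this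
  · obtain ⟨⟨l, i⟩, rfl⟩ := hu
    obtain ⟨⟨q, j⟩, rfl⟩ := hv
    have h1 := regular_markov hGz l q i j
    rw [Matrix.mul_assoc] at h1
    have h2 : ∀ a, (A.transpose ^ l * C.transpose) a i = (C * A ^ l) i a := fun a => by
      rw [← Matrix.transpose_pow, ← Matrix.transpose_mul, Matrix.transpose_apply]
    unfold RegularPair
    simp only [h2]
    exact h1

end Minimal


/-! Quadratic Lyapunov functions and sampling -/

section Lyapunov

open Matrix
open scoped Matrix.Norms.Operator

variable {n m : Type*} [Fintype n] [DecidableEq n] [Fintype m] [DecidableEq m]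

lemma dotProduct_self_nonneg' (v : n → ℝ) : 0 ≤ v ⬝ᵥ v :=
  Finset.sum_nonneg fun i _ => mul_self_nonneg (v i)

lemma norm_sq_le_dotProduct_self (v : n → ℝ) : ‖v‖ ^ 2 ≤ v ⬝ᵥ v := by
  rw [← Real.sqrt_le_sqrt_iff (dotProduct_self_nonneg' v), Real.sqrt_sq (norm_nonneg _)]
  refine (pi_norm_le_iff_of_nonneg (Real.sqrt_nonneg _)).2 fun i => ?_
  rw [Real.norm_eq_abs]
  refine Real.abs_le_sqrt ?_
  rw [sq]
  exact Finset.single_le_sum (f := fun i => v i * v i) (fun i _ => mul_self_nonneg (v i))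
    (Finset.mem_univ i)

lemma abs_dotProduct_le (v w : n → ℝ) : |v ⬝ᵥ w| ≤ Fintype.card n * (‖v‖ * ‖w‖) := by
  refine (Finset.abs_sum_le_sum_abs _ _).trans ?_
  rw [← nsmul_eq_mul]
  refine Finset.sum_le_card_nsmul _ _ _ fun i _ => ?_
  rw [abs_mul]
  exact mul_le_mul (norm_le_pi_norm v i) (norm_le_pi_norm w i) (abs_nonneg _) (norm_nonneg _)

lemma dotProduct_self_le (v : n → ℝ) : v ⬝ᵥ v ≤ Fintype.card n * ‖v‖ ^ 2 := by
  have := abs_dotProduct_le v v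
  rw [← sq] at this
  exact (le_abs_self _).trans this

lemma abs_dotProduct_mulVec_le (A : Matrix n n ℝ) (v : n → ℝ) :
    |v ⬝ᵥ A *ᵥ v| ≤ Fintype.card n * ‖A‖ * ‖v‖ ^ 2 := by
  refine (abs_dotProduct_le _ _).trans ?_
  calc (Fintype.card n : ℝ) * (‖v‖ * ‖A *ᵥ v‖) ≤ Fintype.card n * (‖v‖ * (‖A‖ * ‖v‖)) := by
        gcongr; exact mulVec_norm_le A v
    _ = Fintype.card n * ‖A‖ * ‖v‖ ^ 2 := by ring

lemma posDef_lower_bound {Q : Matrix n n ℝ} (hQ : Q.PosDef) :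
    ∃ q : ℝ, 0 < q ∧ ∀ z : n → ℝ, q * ‖z‖ ^ 2 ≤ z ⬝ᵥ Q *ᵥ z := by
  have hpos : ∀ z : n → ℝ, z ≠ 0 → 0 < z ⬝ᵥ Q *ᵥ z := fun z hz => by
    simpa using hQ.dotProduct_mulVec_pos hz
  have hc : Continuous fun z : n → ℝ => z ⬝ᵥ Q *ᵥ z := by fun_prop
  rcases (Metric.sphere (0 : n → ℝ) 1).eq_empty_or_nonempty with h | h
  · refine ⟨1, one_pos, fun z => ?_⟩
    have hz : z = 0 := by
      by_contra hz
      have : ‖z‖⁻¹ • z ∈ Metric.sphere (0 : n → ℝ) 1 := by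
        simp [norm_smul, norm_ne_zero_iff.2 hz]
      rw [h] at this
      exact this
    simp [hz]
  · obtain ⟨z₀, hz₀, hmin⟩ := (isCompact_sphere (0 : n → ℝ) 1).exists_isMinOn h hc.continuousOn
    have hz₀' : ‖z₀‖ = 1 := by simpa using hz₀
    refine ⟨z₀ ⬝ᵥ Q *ᵥ z₀, hpos _ (by rw [← norm_ne_zero_iff, hz₀']; norm_num), fun z => ?_⟩
    rcases eq_or_ne z 0 with rfl | hz
    · simp
    have hz' : ‖z‖ ≠ 0 := norm_ne_zero_iff.2 hz
    have h1 := hmin (show ‖z‖⁻¹ • z ∈ Metric.sphere (0 : n → ℝ) 1 by simp [norm_smul, hz'])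
    simp only [Set.mem_ofPred_eq, mulVec_smul, dotProduct_smul, smul_dotProduct, smul_eq_mul] at h1
    calc _ ≤ (‖z‖⁻¹ * (‖z‖⁻¹ * (z ⬝ᵥ Q *ᵥ z))) * ‖z‖ ^ 2 := by gcongr
      _ = _ := by field_simp

/-- A Lyapunov equation makes the matrix exponential a contraction over short times. -/
lemma lyapunov_contraction {A P Q S : Matrix n n ℝ} (hQ : Q.PosDef) (hP : P = Sᵀ * S)
    (hL : Aᵀ * P + P * A = -Q) :
    ∃ c : ℝ, 0 < c ∧ ∀ᶠ T in 𝓝[>] (0 : ℝ), ∀ z : n → ℝ,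
      (S *ᵥ (NormedSpace.exp (T • A) *ᵥ z)) ⬝ᵥ (S *ᵥ (NormedSpace.exp (T • A) *ᵥ z)) ≤
        (1 - c * T) * ((S *ᵥ z) ⬝ᵥ (S *ᵥ z)) := by
  obtain ⟨q, hq, hqz⟩ := posDef_lower_bound hQ
  set N : ℝ := (Fintype.card n : ℝ) with hN
  have hN0 : 0 ≤ N := Nat.cast_nonneg _
  set a : ℝ := N * ‖S‖ ^ 2 + 1 with ha
  have ha0 : 0 < a := by positivity
  -- The quadratic form of `Θ T` is the Lyapunov function after time `T`. Its derivative at `0` is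
  -- `-Q` by the Lyapunov equation.
  set Θ : ℝ → Matrix n n ℝ := fun T => NormedSpace.exp (T • Aᵀ) * P * NormedSpace.exp (T • A)
  have hΘ : HasDerivAt Θ (-Q) 0 := by
    have h1 := ((hasDerivAt_exp_smul_const' Aᵀ (0 : ℝ)).mul_const P).mul
      (hasDerivAt_exp_smul_const' A (0 : ℝ))
    refine h1.congr_deriv ?_
    simp [NormedSpace.exp_zero, hL]
  have hΘ0 : Θ 0 = P := by simp [Θ, NormedSpace.exp_zero]
  have hSz : ∀ z : n → ℝ, (S *ᵥ z) ⬝ᵥ (S *ᵥ z) = z ⬝ᵥ P *ᵥ z := fun z => by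
    rw [hP, ← mulVec_mulVec, dotProduct_mulVec z, vecMul_transpose]
  have hΘz : ∀ T (z : n → ℝ), (S *ᵥ (NormedSpace.exp (T • A) *ᵥ z)) ⬝ᵥ
      (S *ᵥ (NormedSpace.exp (T • A) *ᵥ z)) = z ⬝ᵥ Θ T *ᵥ z := fun T z => by
    rw [hSz]
    simp only [Θ]
    rw [← transpose_smul, exp_transpose, ← mulVec_mulVec, ← mulVec_mulVec, dotProduct_mulVec z,
      vecMul_transpose]
  -- To first order the form drops by at least `q T ‖z‖²`. Half of this absorbs the remainder
  -- `o(T)`; as the form of `P` is at most `a ‖z‖²`, the other half is at least `q T / (2a)` times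
  -- the form.
  refine ⟨q / (2 * a), by positivity, ?_⟩
  have ho := (hasDerivAt_iff_isLittleO_nhds_zero.1 hΘ).def
    (show (0 : ℝ) < q / (2 * (N + 1)) by positivity)
  filter_upwards [nhdsWithin_le_nhds ho, self_mem_nhdsWithin] with T hT hT0 z
  rw [Set.mem_Ioi] at hT0
  rw [zero_add, hΘ0, Real.norm_eq_abs, abs_of_pos hT0] at hT
  rw [hΘz, hSz]
  set R := Θ T - P - T • -Q with hR
  have e1 : z ⬝ᵥ Θ T *ᵥ z = z ⬝ᵥ P *ᵥ z - T * (z ⬝ᵥ Q *ᵥ z) + z ⬝ᵥ R *ᵥ z := by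
    have : Θ T = P - T • Q + R := by rw [hR, smul_neg]; abel
    rw [this]
    simp only [add_mulVec, sub_mulVec, dotProduct_add, dotProduct_sub, smul_mulVec,
      dotProduct_smul, smul_eq_mul]
  have e2 : z ⬝ᵥ R *ᵥ z ≤ q * T / 2 * ‖z‖ ^ 2 := by
    refine (le_abs_self _).trans ((abs_dotProduct_mulVec_le R z).trans ?_)
    gcongr
    calc N * ‖R‖ ≤ N * (q / (2 * (N + 1)) * T) := by gcongr
      _ ≤ (N + 1) * (q / (2 * (N + 1)) * T) := by gcongr; linarith
      _ = q * T / 2 := by field_simp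
  have e3 : z ⬝ᵥ P *ᵥ z ≤ a * ‖z‖ ^ 2 := by
    rw [← hSz]
    refine (dotProduct_self_le _).trans ?_
    calc N * ‖S *ᵥ z‖ ^ 2 ≤ N * (‖S‖ * ‖z‖) ^ 2 := by gcongr; exact mulVec_norm_le S z
      _ = (N * ‖S‖ ^ 2) * ‖z‖ ^ 2 := by ring
      _ ≤ a * ‖z‖ ^ 2 := by gcongr; linarith
  have e4 := mul_le_mul_of_nonneg_left (hqz z) hT0.le
  have e5 : q / (2 * a) * T * (z ⬝ᵥ P *ᵥ z) ≤ q * T / 2 * ‖z‖ ^ 2 := by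
    calc _ ≤ q / (2 * a) * T * (a * ‖z‖ ^ 2) := by gcongr
      _ = _ := by field_simp
  rw [e1, sub_mul, one_mul]
  linarith

lemma tendsto_sampled_input {A : Matrix n n ℝ} (hA : IsUnit A.det) :
    Tendsto (fun T : ℝ => T⁻¹ • (A⁻¹ * (NormedSpace.exp (T • A) - 1))) (𝓝[>] 0) (𝓝 1) := by
  have h := (hasDerivAt_exp_smul_const' A (0 : ℝ)).tendsto_slope_zero_right
  simp only [zero_add, zero_smul, NormedSpace.exp_zero, mul_one] at h
  have h2 := (tendsto_const_nhds (x := A⁻¹)).mul h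
  rw [nonsing_inv_mul _ hA] at h2
  exact h2.congr fun T => mul_smul_comm _ _ _

/-- After division by `T` the matrix tends to `1`, where inversion is continuous. The resulting
`T⁻¹` is the size of the adaptation gain. -/
lemma sampled_input_inverse_bound {A : Matrix n n ℝ} (hA : IsUnit A.det) :
    ∃ C : ℝ, 0 ≤ C ∧ ∀ᶠ T in 𝓝[>] (0 : ℝ),
      IsUnit (A⁻¹ * (NormedSpace.exp (T • A) - 1)).det ∧
      ‖(A⁻¹ * (NormedSpace.exp (T • A) - 1))⁻¹‖ ≤ C * T⁻¹ := by
  have h := tendsto_sampled_input hA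
  have hu : ∀ᶠ T in 𝓝[>] (0 : ℝ), IsUnit (T⁻¹ • (A⁻¹ * (NormedSpace.exp (T • A) - 1))) :=
    h.eventually (Units.isOpen.mem_nhds isUnit_one)
  have hi := (NormedRing.inverse_continuousAt (1 : (Matrix n n ℝ)ˣ)).tendsto.comp h
  have hb := hi.norm.eventually (gt_mem_nhds (lt_add_one _))
  refine ⟨‖Ring.inverse ((1 : (Matrix n n ℝ)ˣ) : Matrix n n ℝ)‖ + 1, by positivity, ?_⟩
  filter_upwards [hu, hb, self_mem_nhdsWithin] with T h1 h2 hT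
  rw [Set.mem_Ioi] at hT
  set Y := A⁻¹ * (NormedSpace.exp (T • A) - 1)
  have hY : Y = T • (T⁻¹ • Y) := by rw [smul_smul, mul_inv_cancel₀ hT.ne', one_smul]
  have hdet : IsUnit Y.det := by
    rw [hY, det_smul]
    exact (isUnit_iff_ne_zero.2 (pow_ne_zero _ hT.ne')).mul ((isUnit_iff_isUnit_det _).1 h1)
  refine ⟨hdet, ?_⟩
  have e : Y⁻¹ = T⁻¹ • (T⁻¹ • Y)⁻¹ := by
    refine inv_eq_left_inv ?_
    have hd1 : IsUnit (T⁻¹ • Y).det := (isUnit_iff_isUnit_det _).1 h1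
    rw [smul_mul_assoc, ← mul_smul_comm, nonsing_inv_mul _ hd1]
  rw [e, norm_smul, Real.norm_eq_abs, abs_of_pos (inv_pos.2 hT), mul_comm, nonsing_inv_eq_ringInverse]
  gcongr
  exact h2.le

end Lyapunov


/-! The adaptation law -/

section Adaptation

open Matrix
open scoped Matrix.Norms.Operator

lemma mul_rightPinv_of_rank {m n : Type*} [Fintype m] [DecidableEq m] [Fintype n]
    {T : Matrix m n ℝ} (h : T.rank = Fintype.card m) : T * rightPinv T = 1 := by
  rw [rightPinv, ← Matrix.mul_assoc]
  refine mul_nonsing_inv _ (isUnit_iff_ne_zero.2 (det_ne_zero_of_rank _ ?_))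
  rw [rank_self_mul_transpose, h]

lemma rank_eq_card_of_mul_eq_one {m n : Type*} [Fintype m] [DecidableEq m] [Fintype n]
    {T : Matrix m n ℝ} {X : Matrix n m ℝ} (h : T * X = 1) : T.rank = Fintype.card m := by
  refine le_antisymm (rank_le_card_height _) ?_
  rw [← rank_one (R := ℝ) (n := m), ← h]
  exact rank_mul_le_left _ _

/-- Orthogonal projections do not increase the Euclidean norm. -/
lemma dotProduct_sub_rightPinv_le {m n : Type*} [Fintype m] [DecidableEq m] [Fintype n]
    {T : Matrix m n ℝ} (h : T * rightPinv T = 1) (w : n → ℝ) :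
    (w - rightPinv T *ᵥ (T *ᵥ w)) ⬝ᵥ (w - rightPinv T *ᵥ (T *ᵥ w)) ≤ w ⬝ᵥ w := by
  set p := rightPinv T *ᵥ (T *ᵥ w) with hp
  set a := w - p with ha
  have h1 : T *ᵥ a = 0 := by
    rw [ha, hp, mulVec_sub, mulVec_mulVec, h, one_mulVec, sub_self]
  have h2 : a ⬝ᵥ p = 0 := by
    rw [hp, rightPinv, ← mulVec_mulVec, dotProduct_mulVec, vecMul_transpose, h1, zero_dotProduct]
  have h3 : w = a + p := by rw [ha]; abel
  have h4 : 0 ≤ p ⬝ᵥ p := Finset.sum_nonneg fun i _ => mul_self_nonneg (p i)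
  have h5 : w ⬝ᵥ w = (a + p) ⬝ᵥ (a + p) := by rw [← h3]
  rw [h5, add_dotProduct, dotProduct_add, dotProduct_add, dotProduct_comm p a, h2]
  linarith

namespace L1Design

variable {np k no : ℕ} (d : L1Design np k no)

/-- The gain of the correction of the predictor error: `Λ⁻¹ 1_{n_m 2}`. -/
def corr : Matrix (Fin 2 ⊕ Fin k) (Fin 2) ℝ := d.sqrtP⁻¹ * rightPinv (d.Cm * d.sqrtP⁻¹)

/-- The input matrix of the sampled desired system. -/
def Psi (T : ℝ) : Matrix (Fin 2 ⊕ Fin k) (Fin 2 ⊕ Fin k) ℝ :=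
  d.Am⁻¹ * (NormedSpace.exp (T • d.Am) - 1)

/-- The predictor error after the correction. -/
def proj : Matrix (Fin 2 ⊕ Fin k) (Fin 2 ⊕ Fin k) ℝ := 1 - d.corr * d.Cm

namespace Admissible

variable {d} (hd : d.Admissible)
include hd

lemma Am_det : IsUnit d.Am.det := isUnit_det_of_isHurwitz hd.hurwitz_m

lemma Ao_hurwitz : IsHurwitz d.Ao := hd.realization.isHurwitz hd.O_stable

lemma output_mul_pinv :
    (d.Cm * d.sqrtP⁻¹) * rightPinv (d.Cm * d.sqrtP⁻¹) = 1 := by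
  refine mul_rightPinv_of_rank (rank_eq_card_of_mul_eq_one (X := d.sqrtP * rightPinv d.Cm) ?_)
  rw [Matrix.mul_assoc, nonsing_inv_mul_cancel_left _ _ hd.sqrtP_unit, hd.cm_mul_pinv]

lemma D_mul_pinv : d.D * rightPinv d.D = 1 :=
  mul_rightPinv_of_rank (by rw [hd.D_rank, Fintype.card_fin])

lemma cm_mul_corr : d.Cm * d.corr = 1 := by
  rw [corr, ← Matrix.mul_assoc, hd.output_mul_pinv]

/-- The rows of `D` are orthogonal to those of `C_m S⁻¹`, so in the coordinates `S z` right
pseudo-inverses of the two blocks give an explicit inverse of `Λ`, with `corr` as its first two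
columns. -/
lemma Lam_mul : d.Lam * Matrix.fromCols d.corr (d.sqrtP⁻¹ * rightPinv d.D) = 1 := by
  have h1 : d.Cm * (d.sqrtP⁻¹ * rightPinv d.D) = 0 := by
    have h := congrArg Matrix.transpose hd.D_null
    rw [transpose_mul, transpose_transpose, transpose_zero] at h
    rw [rightPinv, ← Matrix.mul_assoc, ← Matrix.mul_assoc, h, Matrix.zero_mul]
  have h2 : d.D * d.sqrtP * d.corr = 0 := by
    rw [corr, Matrix.mul_assoc, mul_nonsing_inv_cancel_left _ _ hd.sqrtP_unit, rightPinv,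
      ← Matrix.mul_assoc, hd.D_null, Matrix.zero_mul]
  have h3 : d.D * d.sqrtP * (d.sqrtP⁻¹ * rightPinv d.D) = 1 := by
    rw [Matrix.mul_assoc, mul_nonsing_inv_cancel_left _ _ hd.sqrtP_unit, hd.D_mul_pinv]
  rw [Lam, fromRows_mul_fromCols, hd.cm_mul_corr, h1, h2, h3, fromBlocks_one]

lemma Lam_det : IsUnit d.Lam.det := by
  have h := congrArg Matrix.det hd.Lam_mul
  rw [det_mul, det_one] at h
  exact IsUnit.of_mul_eq_one _ h

lemma Lam_inv_mul : d.Lam⁻¹ * Matrix.fromRows (1 : Matrix (Fin 2) (Fin 2) ℝ)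
    (0 : Matrix (Fin k) (Fin 2) ℝ) = d.corr := by
  rw [inv_eq_right_inv hd.Lam_mul, fromCols_mul_fromRows]
  simp

lemma expLam_eq (t : ℝ) : d.expLam t = d.Lam * NormedSpace.exp (t • d.Am) * d.Lam⁻¹ := by
  rw [expLam, ← exp_conj _ _ ((isUnit_iff_isUnit_det _).2 hd.Lam_det)]
  simp

lemma Phi_eq (T : ℝ) : d.Phi T = d.Lam * d.Psi T := by
  have hL := hd.Lam_det
  ext i j
  have h1 := integral_exp_mulVec_const hd.Am_det (Pi.single j 1) 0 T
  rw [zero_add] at h1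
  have hc : Continuous fun τ : ℝ => (NormedSpace.exp ((T - τ) • d.Am)) *ᵥ Pi.single j (1 : ℝ) :=
    (continuous_iff_continuousAt.2 fun t =>
      (hasDerivAt_exp_mulVec d.Am (Pi.single j 1) t).continuousAt).comp
      (continuous_const.sub continuous_id)
  have h2 := congrFun (mulVec_intervalIntegral d.Lam (hc.intervalIntegrable 0 T)) i
  have hc' : IntervalIntegrable (fun τ : ℝ =>
      d.Lam *ᵥ ((NormedSpace.exp ((T - τ) • d.Am)) *ᵥ Pi.single j (1 : ℝ))) volume 0 T :=
    ((Matrix.mulVecLin d.Lam).continuous_of_finiteDimensional.comp hc).intervalIntegrable _ _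
  rw [intervalIntegral_apply hc', h1, mulVec_mulVec] at h2
  rw [Phi, of_apply]
  have h3 : (d.Lam * d.Psi T) i j = ((d.Lam * d.Psi T) *ᵥ Pi.single j 1) i := by simp
  rw [h3]
  refine Eq.trans ?_ h2.symm
  refine intervalIntegral.integral_congr fun τ _ => ?_
  rw [hd.expLam_eq, nonsing_inv_mul_cancel_right _ _ hL, mulVec_mulVec]
  simp

lemma sigmaHat_eq (T : ℝ) (ey : Fin 2 → ℝ) : d.sigmaHat T ey =
    -(((d.Psi T)⁻¹ * (NormedSpace.exp (T • d.Am) * d.corr)) *ᵥ ey) := by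
  rw [sigmaHat, hd.Phi_eq, hd.expLam_eq, Matrix.mul_inv_rev]
  congr 2
  simp only [Matrix.mul_assoc]
  rw [nonsing_inv_mul_cancel_left _ _ hd.Lam_det, hd.Lam_inv_mul]

/-- The meaning of the adaptation law: held over one step, the estimate displaces the predictor as
if `corr ey` had been subtracted from its error at the beginning of the step. -/
lemma Psi_mulVec_sigmaHat {T : ℝ} (hT : IsUnit (d.Psi T).det) (ey : Fin 2 → ℝ) :
    d.Psi T *ᵥ d.sigmaHat T ey = -(NormedSpace.exp (T • d.Am) *ᵥ (d.corr *ᵥ ey)) := by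
  rw [hd.sigmaHat_eq, mulVec_neg, mulVec_mulVec, mul_nonsing_inv_cancel_left _ _ hT, mulVec_mulVec]

lemma cm_mulVec_proj (z : Fin 2 ⊕ Fin k → ℝ) : d.Cm *ᵥ (d.proj *ᵥ z) = 0 := by
  rw [mulVec_mulVec, proj, Matrix.mul_sub, Matrix.mul_one, ← Matrix.mul_assoc, hd.cm_mul_corr,
    Matrix.one_mul, sub_self, zero_mulVec]

/-- In the coordinates `w = S z` the matrix `proj` is the orthogonal projection onto `ker (C_m
S⁻¹)`. -/
lemma proj_le (z : Fin 2 ⊕ Fin k → ℝ) : (d.sqrtP *ᵥ (d.proj *ᵥ z)) ⬝ᵥ (d.sqrtP *ᵥ (d.proj *ᵥ z)) ≤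
    (d.sqrtP *ᵥ z) ⬝ᵥ (d.sqrtP *ᵥ z) := by
  have h := dotProduct_sub_rightPinv_le hd.output_mul_pinv (d.sqrtP *ᵥ z)
  have e : d.sqrtP *ᵥ (d.proj *ᵥ z) = d.sqrtP *ᵥ z - rightPinv (d.Cm * d.sqrtP⁻¹) *ᵥ
      ((d.Cm * d.sqrtP⁻¹) *ᵥ (d.sqrtP *ᵥ z)) := by
    simp only [mulVec_mulVec]
    rw [← sub_mulVec, proj, corr, Matrix.mul_sub, Matrix.mul_one]
    congr 2
    simp only [Matrix.mul_assoc]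
    rw [mul_nonsing_inv_cancel_left _ _ hd.sqrtP_unit, nonsing_inv_mul _ hd.sqrtP_unit,
      Matrix.mul_one]
  rw [e]
  exact h

end Admissible

end L1Design

end Adaptation


/-! The predictor error -/

section PredictorError

open Matrix
open scoped Matrix.Norms.Operator

/-- Young's inequality for the cross term; `ε` is later taken proportional to the sampling time. -/
lemma dotProduct_sub_self_le {n : Type*} [Fintype n] (x y : n → ℝ) {ε : ℝ} (hε : 0 < ε) :
    (x - y) ⬝ᵥ (x - y) ≤ (1 + ε) * (x ⬝ᵥ x) + (1 + 1 / ε) * (y ⬝ᵥ y) := by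
  simp only [dotProduct, Finset.mul_sum, ← Finset.sum_add_distrib, Pi.sub_apply]
  refine Finset.sum_le_sum fun i _ => ?_
  have h : 0 ≤ (ε * x i + y i) ^ 2 / ε := by positivity
  have e : (ε * x i + y i) ^ 2 / ε = ε * (x i * x i) + 2 * (x i * y i) + 1 / ε * (y i * y i) := by
    field_simp
    ring
  rw [e] at h
  linarith

lemma tfAct_resolvent_zero {n : Type*} [Fintype n] [DecidableEq n] (A : Matrix n n ℝ)
    {V : ℝ → n → ℝ} (hV : V ∈ vsignals n) : tfAct (tfResolvent A) V 0 = 0 := by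
  rw [tfAct_resolvent A hV le_rfl, intervalIntegral.integral_same]

lemma floor_div_mul_le {T t : ℝ} (hT : 0 < T) (ht : 0 ≤ t) : (⌊t / T⌋₊ : ℝ) * T ≤ t :=
  (le_div_iff₀ hT).1 (Nat.floor_le (div_nonneg ht hT.le))

lemma lt_floor_div_mul_add {T t : ℝ} (hT : 0 < T) : t < (⌊t / T⌋₊ : ℝ) * T + T := by
  have := (div_lt_iff₀ hT).1 (Nat.lt_floor_add_one (t / T))
  linarith

lemma floor_div_eq {T t : ℝ} (hT : 0 < T) {i : ℕ} (h1 : i * T ≤ t) (h2 : t < i * T + T) :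
    ⌊t / T⌋₊ = i := by
  rw [Nat.floor_eq_iff (div_nonneg ((by positivity : 0 ≤ i * T).trans h1) hT.le)]
  exact ⟨(le_div_iff₀ hT).2 h1, (div_lt_iff₀ hT).2 (by linarith)⟩

namespace L1Design.Admissible

variable {np k no : ℕ} {d : L1Design np k no} (hd : d.Admissible)
include hd

set_option maxHeartbeats 1000000 in
/-- The predictor error and the adaptive estimate are small compared to the disturbance. -/
lemma predictor_error : ∃ T₀ C : ℝ, 0 < T₀ ∧ T₀ ≤ 1 ∧ 0 ≤ C ∧ ∀ T, 0 < T → T < T₀ →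
    ∀ σ ∈ vsignals (Fin 2), ∀ S ∈ vsignals (Fin 2 ⊕ Fin k), ∀ e : ℝ → Fin 2 ⊕ Fin k → ℝ,
    e = tfAct (tfResolvent d.Am) (S - tfAct (tfConst d.Bm) σ) →
    (∀ t, 0 ≤ t → S t = d.sigmaHat T (d.Cm *ᵥ e (⌊t / T⌋₊ * T))) →
    ∀ t, 0 ≤ t → ∀ s, 0 ≤ s → (∀ u ∈ Set.Icc 0 t, ‖σ u‖ ≤ s) →
      ‖d.Cm *ᵥ e t‖ ≤ C * T * s ∧ ‖S t‖ ≤ C * s := by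
  obtain ⟨c, hc, hcT⟩ := lyapunov_contraction hd.Q_pos hd.sqrtP_sq hd.lyapunov
  obtain ⟨Cψ, hCψ, hψ⟩ := sampled_input_inverse_bound hd.Am_det
  obtain ⟨E, hE0, hE⟩ := exists_exp_bound d.Am
  obtain ⟨E₁, hE₁0, hE₁⟩ := exists_exp_sub_one_bound d.Am
  obtain ⟨T₁, hT₁, hT₁'⟩ := mem_nhdsGT_iff_exists_Ioo_subset.1 (hcT.and hψ)
  rw [Set.mem_Ioi] at hT₁
  obtain ⟨N, hN⟩ : ∃ x : ℝ, x = (Fintype.card (Fin 2 ⊕ Fin k) : ℝ) := ⟨_, rfl⟩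
  obtain ⟨a, ha⟩ : ∃ x : ℝ, x = N * ‖d.sqrtP‖ ^ 2 := ⟨_, rfl⟩
  have hN0 : 0 ≤ N := hN ▸ Nat.cast_nonneg _
  have ha0 : 0 ≤ a := by rw [ha]; positivity
  obtain ⟨b, hb⟩ : ∃ x : ℝ, x = ‖d.Bm‖ := ⟨_, rfl⟩
  have hb0 : 0 ≤ b := hb ▸ norm_nonneg _
  -- `w s²` is the fixed point of the recursion `q ↦ (1 - cT/2) q + 3/(cT) · a (E b s T)²` for the
  -- squared error. The sampling time cancels in it.
  obtain ⟨w, hw⟩ : ∃ x : ℝ, x = 6 * a * E ^ 2 * b ^ 2 / c ^ 2 := ⟨_, rfl⟩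
  have hw0 : 0 ≤ w := by rw [hw]; positivity
  obtain ⟨k₁, hk₁⟩ : ∃ x : ℝ, x = ‖d.sqrtP⁻¹‖ * √w := ⟨_, rfl⟩
  have hk₁0 : 0 ≤ k₁ := by rw [hk₁]; positivity
  obtain ⟨k₂, hk₂⟩ : ∃ x : ℝ, x = ‖d.Cm‖ * (E₁ * ‖d.proj‖ * k₁ + E * b) := ⟨_, rfl⟩
  have hk₂0 : 0 ≤ k₂ := by rw [hk₂]; positivity
  obtain ⟨k₃, hk₃⟩ : ∃ x : ℝ, x = Cψ * E * ‖d.corr‖ * k₂ := ⟨_, rfl⟩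
  have hk₃0 : 0 ≤ k₃ := by rw [hk₃]; positivity
  obtain ⟨k₄, hk₄⟩ : ∃ x : ℝ, x = k₂ + ‖d.Cm‖ * (E₁ * k₁ + E * (k₃ + b)) := ⟨_, rfl⟩
  have hk₄0 : 0 ≤ k₄ := by rw [hk₄]; positivity
  -- `T < 1` makes the bounds on exponentials available, `T < 1/c` keeps `1 - cT` positive, and `T <
  -- T₁` gives the contraction and the bound on `Ψ(T)⁻¹`.
  refine ⟨min (min 1 (1 / c)) T₁, k₃ + k₄, by positivity,
    (min_le_left _ _).trans (min_le_left _ _), by positivity, ?_⟩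
  intro T hT hTlt σ hσ S hS e he hest t ht s hs hσs
  obtain ⟨⟨hT1, hTc⟩, hTT⟩ : (T < 1 ∧ T < 1 / c) ∧ T < T₁ := by simpa using hTlt
  obtain ⟨hcon, hψu, hψb⟩ := hT₁' ⟨hT, hTT⟩
  have hTI : T ∈ Set.Icc (0 : ℝ) 1 := ⟨hT.le, hT1.le⟩
  have hcT1 : c * T < 1 := by rw [lt_div_iff₀ hc] at hTc; linarith
  have hBσ : tfAct (tfConst d.Bm) σ ∈ vsignals (Fin 2 ⊕ Fin k) := tfAct_mem (MProper.tfConst _) hσ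
  have hV := (vsignals (Fin 2 ⊕ Fin k)).sub_mem hS hBσ
  have hBσ' : ∀ u, tfAct (tfConst d.Bm) σ u = d.Bm *ᵥ σ u := fun u => by rw [tfAct_tfConst]
  have hBσs : ∀ u ∈ Set.Icc 0 t, ‖tfAct (tfConst d.Bm) σ u‖ ≤ b * s := fun u hu => by
    rw [hBσ']
    rw [hb]
    exact (mulVec_norm_le _ _).trans (by gcongr; exact hσs u hu)
  have hee : ∀ i : ℕ, ∀ h, 0 ≤ h → e (i * T + h) = NormedSpace.exp (h • d.Am) *ᵥ e (i * T) +
      ∫ τ in (i * T)..(i * T + h), NormedSpace.exp ((i * T + h - τ) • d.Am) *ᵥ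
        (S - tfAct (tfConst d.Bm) σ) τ := fun i h hh => by
    rw [he]; exact tfAct_resolvent_step d.Am hV (by positivity) hh
  -- one sampling step
  have hstep : ∀ i : ℕ, (i + 1 : ℕ) * T ≤ t → ∃ δ, e ((i + 1 : ℕ) * T) =
      NormedSpace.exp (T • d.Am) *ᵥ (d.proj *ᵥ e (i * T)) - δ ∧ ‖δ‖ ≤ E * (b * s) * T := by
    intro i hi
    have hi0 : 0 ≤ (i : ℝ) * T := by positivity
    push_cast at hi
    refine ⟨∫ τ in (i * T)..(i * T + T), NormedSpace.exp ((i * T + T - τ) • d.Am) *ᵥ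
        (tfAct (tfConst d.Bm) σ) τ, ?_, norm_integral_exp_mulVec_le d.Am hE hE0 hTI
        fun u hu => hBσs u ⟨hi0.trans hu.1.le, by linarith [hu.2]⟩⟩
    have e1 : ((i + 1 : ℕ) : ℝ) * T = i * T + T := by push_cast; ring
    rw [e1, hee i T hT.le]
    simp only [Pi.sub_apply, mulVec_sub]
    rw [intervalIntegral.integral_sub
      (exp_mulVec_intervalIntegrable d.Am hS _ (by linarith))
      (exp_mulVec_intervalIntegrable d.Am hBσ _ (by linarith)), ← add_sub_assoc]
    congr 1
    -- The estimate is constant on the step, hence contributes `Ψ(T) σ̂ = -e^{A_m T} corr C_m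
    -- e(iT)`. Together with the free motion this replaces `e(iT)` by its projection.
    have e2 : ∫ τ in (i * T)..(i * T + T), NormedSpace.exp ((i * T + T - τ) • d.Am) *ᵥ S τ =
        ∫ τ in (i * T)..(i * T + T), NormedSpace.exp ((i * T + T - τ) • d.Am) *ᵥ
          d.sigmaHat T (d.Cm *ᵥ e (i * T)) := by
      refine intervalIntegral.integral_congr_Ioo_of_le (by linarith) fun τ hτ => ?_
      rw [hest τ (hi0.trans hτ.1.le), floor_div_eq hT hτ.1.le hτ.2]
    rw [e2, integral_exp_mulVec_const hd.Am_det, ← Psi, hd.Psi_mulVec_sigmaHat hψu,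
      ← sub_eq_add_neg, ← mulVec_sub, proj, sub_mulVec, one_mulVec, mulVec_mulVec _ d.corr]
  have he0 : e ((0 : ℕ) * T) = 0 := by
    rw [he, Nat.cast_zero, zero_mul, tfAct_resolvent_zero _ hV]
  have hVle : ∀ v : Fin 2 ⊕ Fin k → ℝ, (d.sqrtP *ᵥ v) ⬝ᵥ (d.sqrtP *ᵥ v) ≤ a * ‖v‖ ^ 2 := fun v => by
    refine (dotProduct_self_le _).trans ?_
    rw [ha, mul_assoc, ← mul_pow, ← hN]
    gcongr
    exact mulVec_norm_le _ _
  have hq : ∀ i : ℕ, (i : ℝ) * T ≤ t →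
      (d.sqrtP *ᵥ e (i * T)) ⬝ᵥ (d.sqrtP *ᵥ e (i * T)) ≤ w * s ^ 2 := by
    intro i
    induction i with
    | zero => intro _; rw [he0]; simp only [mulVec_zero, dotProduct_zero]; positivity
    | succ i ih =>
      intro hi
      obtain ⟨δ, h1, h2⟩ := hstep i hi
      have hi' : (i : ℝ) * T ≤ t := by push_cast at hi; linarith
      have ih := ih hi'
      set q := (d.sqrtP *ᵥ e (i * T)) ⬝ᵥ (d.sqrtP *ᵥ e (i * T)) with hqdef
      have hq0 : 0 ≤ q := dotProduct_self_nonneg' _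
      rw [h1, mulVec_sub]
      -- With `ε = cT/2`, the bound `(1 + cT/2) (1 - cT) ≤ 1 - cT/2` keeps half of the contraction,
      -- and `1 + 2/(cT) ≤ 3/(cT)` because `cT < 1`.
      have hε : 0 < c * T / 2 := by positivity
      refine (dotProduct_sub_self_le _ _ hε).trans ?_
      have h3 := (hcon (d.proj *ᵥ e (i * T))).trans
        (mul_le_mul_of_nonneg_left (hd.proj_le (e (i * T))) (by linarith))
      rw [← hqdef] at h3
      have h4 : (d.sqrtP *ᵥ δ) ⬝ᵥ (d.sqrtP *ᵥ δ) ≤ a * (E * (b * s) * T) ^ 2 :=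
        (hVle δ).trans (by gcongr)
      calc _ ≤ (1 + c * T / 2) * ((1 - c * T) * q) +
            (1 + 1 / (c * T / 2)) * (a * (E * (b * s) * T) ^ 2) := by gcongr
        _ ≤ (1 - c * T / 2) * q + 3 / (c * T) * (a * (E * (b * s) * T) ^ 2) := by
          refine add_le_add ?_ (mul_le_mul_of_nonneg_right ?_ (by positivity))
          · rw [← mul_assoc]
            refine mul_le_mul_of_nonneg_right ?_ hq0
            have e3 : (1 + c * T / 2) * (1 - c * T) = 1 - c * T / 2 - (c * T) ^ 2 / 2 := by ring
            have e4 := sq_nonneg (c * T)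
            linarith
          · have : (1 : ℝ) ≤ 1 / (c * T) := by rw [le_div_iff₀ (by positivity)]; linarith
            have e3 : 1 / (c * T / 2) = 2 * (1 / (c * T)) := by field_simp
            have e4 : 3 / (c * T) = 3 * (1 / (c * T)) := by field_simp
            rw [e3, e4]; linarith
        _ = (1 - c * T / 2) * q + c * T / 2 * (w * s ^ 2) := by rw [hw]; field_simp; ring
        _ ≤ (1 - c * T / 2) * (w * s ^ 2) + c * T / 2 * (w * s ^ 2) := by
          gcongr; linarith
        _ = w * s ^ 2 := by ring
  have hek : ∀ i : ℕ, (i : ℝ) * T ≤ t → ‖e (i * T)‖ ≤ k₁ * s := by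
    intro i hi
    have h1 : ‖d.sqrtP *ᵥ e (i * T)‖ ≤ √w * s := by
      refine abs_le_of_sq_le_sq' ?_ (by positivity) |>.2
      rw [mul_pow, Real.sq_sqrt hw0]
      exact (norm_sq_le_dotProduct_self _).trans (hq i hi)
    have h2 : e (i * T) = d.sqrtP⁻¹ *ᵥ (d.sqrtP *ᵥ e (i * T)) := by
      rw [mulVec_mulVec, nonsing_inv_mul _ hd.sqrtP_unit, one_mulVec]
    rw [h2, hk₁, mul_assoc]
    exact (mulVec_norm_le _ _).trans (by gcongr)
  have hexp : ∀ h ∈ Set.Icc (0 : ℝ) 1, ∀ z, ‖NormedSpace.exp (h • d.Am) *ᵥ z - z‖ ≤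
      E₁ * h * ‖z‖ := fun h hh z => by
    have : NormedSpace.exp (h • d.Am) *ᵥ z - z = (NormedSpace.exp (h • d.Am) - 1) *ᵥ z := by
      rw [sub_mulVec, one_mulVec]
    rw [this]
    exact (mulVec_norm_le _ _).trans (by gcongr; exact hE₁ h hh)
  -- `C_m` annihilates the projected error, so at the next sample it sees only `(e^{A_m T} - 1) proj
  -- e` and `δ`, both `O(T)`. At time `0` the error vanishes.
  have hcm : ∀ i : ℕ, (i : ℝ) * T ≤ t → ‖d.Cm *ᵥ e (i * T)‖ ≤ k₂ * T * s := by
    intro i hi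
    cases i with
    | zero => rw [he0, mulVec_zero, norm_zero]; positivity
    | succ i =>
      obtain ⟨δ, h1, h2⟩ := hstep i hi
      have h3 := hek i (by push_cast at hi; linarith)
      have h4 : d.Cm *ᵥ e ((i + 1 : ℕ) * T) = d.Cm *ᵥ (NormedSpace.exp (T • d.Am) *ᵥ
          (d.proj *ᵥ e (i * T)) - d.proj *ᵥ e (i * T) - δ) := by
        rw [h1, mulVec_sub, mulVec_sub, mulVec_sub, hd.cm_mulVec_proj, sub_zero]
      rw [h4]
      calc _ ≤ ‖d.Cm‖ * (‖NormedSpace.exp (T • d.Am) *ᵥ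
          (d.proj *ᵥ e (i * T)) - d.proj *ᵥ e (i * T)‖ + ‖δ‖) :=
            (mulVec_norm_le _ _).trans (by gcongr; exact norm_sub_le _ _)
        _ ≤ ‖d.Cm‖ * (E₁ * T * (‖d.proj‖ * (k₁ * s)) + E * (b * s) * T) := by
          gcongr
          refine (hexp T hTI _).trans ?_
          gcongr
          exact (mulVec_norm_le _ _).trans (by gcongr)
        _ = k₂ * T * s := by rw [hk₂]; ring
  -- The factor `T⁻¹` of `Ψ(T)⁻¹` cancels against the factor `T` in the sampled output error.
  have hSb : ∀ u ∈ Set.Icc 0 t, ‖S u‖ ≤ k₃ * s := by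
    intro u hu
    rw [hest u hu.1, hd.sigmaHat_eq, norm_neg, ← mulVec_mulVec, ← mulVec_mulVec]
    have h1 := hcm ⌊u / T⌋₊ ((floor_div_mul_le hT hu.1).trans hu.2)
    calc _ ≤ Cψ * T⁻¹ * (E * (‖d.corr‖ * (k₂ * T * s))) := by
          refine (mulVec_norm_le _ _).trans ?_
          gcongr
          · exact hψb
          refine (mulVec_norm_le _ _).trans ?_
          gcongr
          · exact hE T hTI
          exact (mulVec_norm_le _ _).trans (by gcongr)
      _ = k₃ * s := by rw [hk₃]; field_simp
  refine ⟨?_, (hSb t ⟨ht, le_rfl⟩).trans (by gcongr; linarith)⟩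
  have hfl := floor_div_mul_le hT ht
  have hfl2 := lt_floor_div_mul_add (t := t) hT
  set i := ⌊t / T⌋₊ with hidef
  set h := t - i * T with hh
  have hh0 : 0 ≤ h := by linarith
  have hhT : h ≤ T := by linarith
  have hhI : h ∈ Set.Icc (0 : ℝ) 1 := ⟨hh0, by linarith⟩
  have hi0 : 0 ≤ (i : ℝ) * T := by positivity
  have h1 := hee i h hh0
  have h2 := norm_integral_exp_mulVec_le d.Am hE hE0 hhI (t := i * T) (c := k₃ * s + b * s)
    (V := S - tfAct (tfConst d.Bm) σ) fun u hu => by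
      have hu' : u ∈ Set.Icc 0 t := ⟨hi0.trans hu.1.le, by linarith [hu.2]⟩
      exact (norm_sub_le _ _).trans (add_le_add (hSb u hu') (hBσs u hu'))
  have e1 : (i : ℝ) * T + h = t := by rw [hh]; ring
  rw [e1] at h1 h2
  -- Between samples the output error departs from its last sampled value by `O(T)` only, since
  -- estimate and disturbance are bounded.
  have h3 : d.Cm *ᵥ e t = d.Cm *ᵥ e (i * T) + d.Cm *ᵥ
      ((NormedSpace.exp (h • d.Am) *ᵥ e (i * T) - e (i * T)) +
      ∫ τ in (i * T)..t, NormedSpace.exp ((t - τ) • d.Am) *ᵥ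
        (S - tfAct (tfConst d.Bm) σ) τ) := by
    rw [← mulVec_add, h1]; congr 1; abel
  rw [h3]
  calc _ ≤ k₂ * T * s + ‖d.Cm‖ * (E₁ * h * (k₁ * s) + E * (k₃ * s + b * s) * h) := by
        refine (norm_add_le _ _).trans (add_le_add (hcm i hfl) ((mulVec_norm_le _ _).trans ?_))
        gcongr
        refine (norm_add_le _ _).trans (add_le_add ?_ h2)
        exact (hexp h hhI _).trans (by gcongr; exact hek i hfl)
    _ ≤ k₂ * T * s + ‖d.Cm‖ * (E₁ * T * (k₁ * s) + E * (k₃ * s + b * s) * T) := by gcongr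
    _ = k₄ * T * s := by rw [hk₄]; ring
    _ ≤ (k₃ + k₄) * T * s := by gcongr; linarith

end L1Design.Admissible

end PredictorError


/-! The sampled-data controller as a perturbation of the filtered disturbance estimate -/

section SampledControl

open Matrix
open scoped Matrix.Norms.Operator

lemma tfAct_tfConst_apply {m n : Type*} [Fintype m] [Fintype n] (A : Matrix m n ℝ)
    (w : ℝ → n → ℝ) (t : ℝ) : tfAct (tfConst A) w t = A *ᵥ w t := by
  rw [tfAct_tfConst]

lemma hold_mem_vsignals {n : Type*} [Fintype n] (T : ℝ) (g : ℕ → n → ℝ) :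
    (trunc fun t => g ⌊t / T⌋₊) ∈ vsignals n := by
  have hm : Measurable fun t : ℝ => g ⌊t / T⌋₊ :=
    (measurable_from_nat (f := g)).comp (Nat.measurable_floor.comp (measurable_id.div_const T))
  refine trunc_mem_vsignals (Measurable.ite measurableSet_Ici hm measurable_const) fun t => ?_
  obtain ⟨C, hC⟩ := ((Set.finite_Iic ⌊t / |T|⌋₊).image fun i => ‖g i‖).bddAbove
  refine ⟨C, fun u hu => hC (Set.mem_image_of_mem _ ?_)⟩
  rw [Set.mem_Iic]
  refine Nat.floor_mono ?_
  calc u / T ≤ |u / T| := le_abs_self _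
    _ = u / |T| := by rw [abs_div, abs_of_nonneg hu.1]
    _ ≤ t / |T| := by gcongr; exact hu.2

lemma tfAct_resolvent_hold {n : Type*} [Fintype n] [DecidableEq n] {A : Matrix n n ℝ}
    (hA : IsUnit A.det) {V : ℝ → n → ℝ} (hV : V ∈ vsignals n) {T : ℝ} (hT : 0 < T) {i : ℕ}
    {c : n → ℝ} (hc : ∀ t, i * T ≤ t → t < i * T + T → V t = c) :
    tfAct (tfResolvent A) V ((i + 1 : ℕ) * T) =
      NormedSpace.exp (T • A) *ᵥ tfAct (tfResolvent A) V (i * T) +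
        (A⁻¹ * (NormedSpace.exp (T • A) - 1)) *ᵥ c := by
  have e1 : ((i + 1 : ℕ) : ℝ) * T = i * T + T := by push_cast; ring
  rw [e1, tfAct_resolvent_step A hV (by positivity) hT.le, ← integral_exp_mulVec_const hA c (i * T)]
  congr 1
  refine intervalIntegral.integral_congr_Ioo_of_le (by linarith) fun τ hτ => ?_
  rw [hc τ hτ.1.le hτ.2]

lemma tfImp_resolvent_step {n : Type*} [Fintype n] [DecidableEq n] (A : Matrix n n ℝ) (v : n → ℝ)
    {t h : ℝ} (ht : 0 ≤ t) (hh : 0 ≤ h) : tfImp (tfResolvent A) v (t + h) =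
      NormedSpace.exp (h • A) *ᵥ tfImp (tfResolvent A) v t := by
  rw [tfImp_resolvent, trunc_of_nonneg _ ht, trunc_of_nonneg _ (add_nonneg ht hh), mulVec_mulVec,
    ← exp_add_smul, add_comm]

namespace L1Design

variable {np k no : ℕ} (d : L1Design np k no)

lemma ctrlState_succ (T : ℝ) (y w : ℕ → Fin 2 → ℝ) (i : ℕ) :
    d.ctrlState T y w (i + 1) =
      (NormedSpace.exp (T • d.Am) *ᵥ (d.ctrlState T y w i).1 +
        (d.Am⁻¹ * (NormedSpace.exp (T • d.Am) - 1)) *ᵥ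
          (d.Bm *ᵥ d.uOut (w i) (d.ctrlState T y w i).2 +
            d.sigmaHat T (d.Cm *ᵥ (d.ctrlState T y w i).1 - y i)),
      NormedSpace.exp (T • d.Ao) *ᵥ (d.ctrlState T y w i).2 +
        (d.Ao⁻¹ * (NormedSpace.exp (T • d.Ao) - 1)) *ᵥ
          (d.Bo *ᵥ (NormedSpace.exp (-(T • d.Am)) *ᵥ
            d.sigmaHat T (d.Cm *ᵥ (d.ctrlState T y w i).1 - y i)))) := rfl

/-- The held adaptive estimate. -/
def sigmaHold (T : ℝ) (y w : ℕ → Fin 2 → ℝ) : ℝ → Fin 2 ⊕ Fin k → ℝ :=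
  trunc fun t => d.sigmaHat T (d.Cm *ᵥ (d.ctrlState T y w ⌊t / T⌋₊).1 - y ⌊t / T⌋₊)

lemma sigmaHold_mem (T : ℝ) (y w : ℕ → Fin 2 → ℝ) :
    d.sigmaHold T y w ∈ vsignals (Fin 2 ⊕ Fin k) :=
  hold_mem_vsignals T fun i => d.sigmaHat T (d.Cm *ᵥ (d.ctrlState T y w i).1 - y i)

lemma sigmaHold_eq {T : ℝ} (hT : 0 < T) (y w : ℕ → Fin 2 → ℝ) {i : ℕ} {t : ℝ} (h1 : i * T ≤ t)
    (h2 : t < i * T + T) : d.sigmaHold T y w t =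
      d.sigmaHat T (d.Cm *ᵥ (d.ctrlState T y w i).1 - y i) := by
  rw [sigmaHold, trunc_of_nonneg _ ((by positivity : 0 ≤ i * T).trans h1), floor_div_eq hT h1 h2]

namespace Admissible

variable {d} (hd : d.Admissible)
include hd

/-- The predictor state is a sample of the predictor in continuous time. -/
lemma predictor_sample {T : ℝ} (hT : 0 < T) (y w : ℕ → Fin 2 → ℝ) {U : ℝ → Fin 2 → ℝ}
    (hU : U ∈ vsignals (Fin 2))
    (hUe : ∀ t, 0 ≤ t → U t = d.uOut (w ⌊t / T⌋₊) (d.ctrlState T y w ⌊t / T⌋₊).2) (i : ℕ) :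
    (d.ctrlState T y w i).1 = tfAct (tfResolvent d.Am)
        (tfAct (tfConst d.Bm) U + d.sigmaHold T y w) (i * T) +
      tfImp (tfResolvent d.Am) (rightPinv d.Cm *ᵥ y 0) (i * T) := by
  have hV := (vsignals _).add_mem (tfAct_mem (MProper.tfConst d.Bm) hU) (d.sigmaHold_mem T y w)
  induction i with
  | zero =>
    rw [Nat.cast_zero, zero_mul, tfAct_resolvent_zero _ hV, zero_add, tfImp_resolvent,
      trunc_of_nonneg _ le_rfl, zero_smul, NormedSpace.exp_zero, one_mulVec]
    rfl
  | succ i ih =>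
    have e1 : ((i + 1 : ℕ) : ℝ) * T = i * T + T := by push_cast; ring
    rw [tfAct_resolvent_hold hd.Am_det hV hT (i := i) (c := d.Bm *ᵥ
      d.uOut (w i) (d.ctrlState T y w i).2 + d.sigmaHat T (d.Cm *ᵥ (d.ctrlState T y w i).1 - y i))]
    · rw [e1, tfImp_resolvent_step _ _ (by positivity) hT.le, ctrlState_succ]
      nth_rewrite 1 [ih]
      rw [mulVec_add]
      abel_nf
    · intro t h1 h2
      rw [Pi.add_apply, d.sigmaHold_eq hT y w h1 h2, tfAct_tfConst_apply,
        hUe t ((by positivity : 0 ≤ i * T).trans h1), floor_div_eq hT h1 h2]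

/-- Discretization is exact for the held input, with `e^{-A_m T}` absorbed into the input matrix.
`A_o` is invertible because it is Hurwitz. -/
lemma filter_sample {T : ℝ} (hT : 0 < T) (y w : ℕ → Fin 2 → ℝ) (i : ℕ) :
    (d.ctrlState T y w i).2 = tfAct (tfResolvent d.Ao)
      (tfAct (tfConst (d.Bo * NormedSpace.exp (-(T • d.Am)))) (d.sigmaHold T y w)) (i * T) := by
  have hV := tfAct_mem (MProper.tfConst (d.Bo * NormedSpace.exp (-(T • d.Am))))
    (d.sigmaHold_mem T y w)
  induction i with
  | zero =>
    rw [Nat.cast_zero, zero_mul, tfAct_resolvent_zero _ hV]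
    rfl
  | succ i ih =>
    rw [tfAct_resolvent_hold (isUnit_det_of_isHurwitz hd.Ao_hurwitz) hV hT (i := i)
      (c := (d.Bo * NormedSpace.exp (-(T • d.Am))) *ᵥ
        d.sigmaHat T (d.Cm *ᵥ (d.ctrlState T y w i).1 - y i))]
    · rw [ctrlState_succ]
      rw [ih, mulVec_mulVec _ d.Bo]
    · intro t h1 h2
      rw [tfAct_tfConst_apply, d.sigmaHold_eq hT y w h1 h2]

/-- The sampled control signal is close to the filtered disturbance. -/
lemma control_error (hCM : MProper (d.Cf * d.M⁻¹)) : ∃ T₀ κ : ℝ, 0 < T₀ ∧ 0 ≤ κ ∧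
    ∀ T, 0 < T → T < T₀ → ∀ (y w : ℕ → Fin 2 → ℝ), ∀ σ ∈ vsignals (Fin 2),
    ∀ U ∈ vsignals (Fin 2),
    (∀ t, 0 ≤ t → U t = d.uOut (w ⌊t / T⌋₊) (d.ctrlState T y w ⌊t / T⌋₊).2) →
    (∀ i : ℕ, y i = d.Cm *ᵥ (tfAct (tfResolvent d.Am) (tfAct (tfConst d.Bm) (U + σ)) (i * T) +
      tfImp (tfResolvent d.Am) (rightPinv d.Cm *ᵥ y 0) (i * T))) →
    ∀ t, 0 ≤ t → ∀ s, 0 ≤ s → (∀ u ∈ Set.Icc 0 t, ‖σ u‖ ≤ s) →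
      ‖d.Co *ᵥ (d.ctrlState T y w ⌊t / T⌋₊).2 - tfAct d.Cf σ t‖ ≤ κ * T * s := by
  obtain ⟨T₀, C, hT₀, hT₀1, hC, hpred⟩ := hd.predictor_error
  have hRo := (mstrict_resolvent d.Ao).mproper
  have hRm := (mstrict_resolvent d.Am).mproper
  have hCR : MProper (tfConst d.Cm * tfResolvent d.Am) := (MProper.tfConst _).mul hRm
  have hO : MProper d.O := by
    have : d.O = d.Cf * d.M⁻¹ * (tfConst d.Cm * tfResolvent d.Am) := by rw [O, Matrix.mul_assoc]
    rw [this]; exact hCM.mul hCR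
  obtain ⟨c₁, hc₁, hb₁⟩ := tfAct_bound_of_stable hRo hd.Ao_hurwitz.mstable_resolvent
  obtain ⟨c₂, hc₂, hb₂⟩ := tfAct_bound_of_stable hO hd.O_stable
  obtain ⟨c₃, hc₃, hb₃⟩ := tfAct_bound_of_stable hCM (hd.filter_mstable.mul hd.M_inv_stable)
  obtain ⟨E, hE0, hE⟩ := exists_exp_bound d.Ao
  obtain ⟨E₁, hE₁0, hE₁⟩ := exists_exp_sub_one_bound d.Ao
  obtain ⟨E₂, hE₂0, hE₂⟩ := exists_exp_bound (-d.Am)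
  obtain ⟨E₃, hE₃0, hE₃⟩ := exists_exp_sub_one_bound (-d.Am)
  obtain ⟨β, hβ⟩ : ∃ x : ℝ, x = ‖d.Bo‖ * E₂ * C := ⟨_, rfl⟩
  have hβ0 : 0 ≤ β := by rw [hβ]; positivity
  obtain ⟨κ₁, hκ₁⟩ : ∃ x : ℝ, x = ‖d.Co‖ * (E₁ * (c₁ * β) + E * β) := ⟨_, rfl⟩
  have hκ₁0 : 0 ≤ κ₁ := by rw [hκ₁]; positivity
  refine ⟨T₀, κ₁ + (c₂ * (E₃ * C) + c₃ * C), hT₀, by positivity, ?_⟩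
  intro T hT hTT y w σ hσ U hU hUe hy t ht s hs hσs
  set S := d.sigmaHold T y w with hS
  have hSm : S ∈ vsignals _ := d.sigmaHold_mem T y w
  have hTI : T ∈ Set.Icc (0 : ℝ) 1 := ⟨hT.le, by linarith⟩
  have hBU := tfAct_mem (MProper.tfConst d.Bm) hU
  have hBσ := tfAct_mem (MProper.tfConst d.Bm) hσ
  have hsub := (vsignals _).sub_mem hSm hBσ
  set e := tfAct (tfResolvent d.Am) (S - tfAct (tfConst d.Bm) σ) with he
  have hem : e ∈ vsignals _ := tfAct_mem hRm hsub
  -- the sampled output error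
  have hsplit : tfAct (tfResolvent d.Am) (tfAct (tfConst d.Bm) U + S) =
      tfAct (tfResolvent d.Am) (tfAct (tfConst d.Bm) (U + σ)) + e := by
    rw [he, ← tfAct_add hRm (tfAct_mem (MProper.tfConst d.Bm) ((vsignals _).add_mem hU hσ)) hsub,
      tfAct_add (MProper.tfConst d.Bm) hU hσ]
    congr 1; abel
  -- The samples `y` come from the desired system driven by `U + σ`, with the initial state of the
  -- predictor. The input `U` and the initial state cancel in `C_m x̂ - y`, which leaves a sample of
  -- `C_m e`.
  have hSe : ∀ t, 0 ≤ t → S t = d.sigmaHat T (d.Cm *ᵥ e (⌊t / T⌋₊ * T)) := by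
    intro t ht
    rw [hS, d.sigmaHold_eq hT y w (floor_div_mul_le hT ht) (lt_floor_div_mul_add hT),
      hd.predictor_sample hT y w hU hUe, ← hS, hsplit]
    congr 1
    rw [hy ⌊t / T⌋₊, ← mulVec_sub, Pi.add_apply]
    congr 1; abel
  have hbound := hpred T hT hTT σ hσ S hSm e he hSe
  have hmono : ∀ u ∈ Set.Icc 0 t, ‖d.Cm *ᵥ e u‖ ≤ C * T * s ∧ ‖S u‖ ≤ C * s := fun u hu =>
    hbound u hu.1 s hs fun v hv => hσs v ⟨hv.1, hv.2.trans hu.2⟩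
  set V := tfAct (tfConst (d.Bo * NormedSpace.exp (-(T • d.Am)))) S with hV
  have hVm : V ∈ vsignals _ := tfAct_mem (MProper.tfConst _) hSm
  have hVb : ∀ u ∈ Set.Icc 0 t, ‖V u‖ ≤ β * s := fun u hu => by
    rw [hV, tfAct_tfConst_apply, ← mulVec_mulVec, hβ, mul_assoc, mul_assoc, ← smul_neg]
    refine (mulVec_norm_le _ _).trans ?_
    gcongr
    refine (mulVec_norm_le _ _).trans ?_
    gcongr
    · exact hE₂ T hTI
    · exact (hmono u hu).2
  set z := tfAct (tfResolvent d.Ao) V with hz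
  have hzb : ∀ u ∈ Set.Icc 0 t, ‖z u‖ ≤ c₁ * (β * s) := fun u hu =>
    hb₁ V u (β * s) hu.1 (by positivity) fun v hv => hVb v ⟨hv.1, hv.2.trans hu.2⟩
  have hfl := floor_div_mul_le hT ht
  have hfl2 := lt_floor_div_mul_add (t := t) hT
  rw [hd.filter_sample hT y w, ← hS, ← hV, ← hz]
  obtain ⟨i, hi⟩ : ∃ i, i = ⌊t / T⌋₊ := ⟨_, rfl⟩
  rw [← hi] at hfl hfl2 ⊢
  obtain ⟨h, hh⟩ : ∃ h, h = t - i * T := ⟨_, rfl⟩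
  have hi0 : 0 ≤ (i : ℝ) * T := by positivity
  have hhI : h ∈ Set.Icc (0 : ℝ) 1 := ⟨by linarith, by linarith [hTI.2]⟩
  have e1 : (i : ℝ) * T + h = t := by rw [hh]; ring
  have hstep := tfAct_resolvent_step d.Ao hVm hi0 hhI.1
  have hint := norm_integral_exp_mulVec_le d.Ao hE hE0 hhI (t := i * T) (c := β * s)
    (V := V) fun u hu => hVb u ⟨hi0.trans hu.1.le, by linarith [hu.2]⟩
  rw [← hz, e1] at hstep
  rw [e1] at hint
  -- The hold of the control signal: the filter state moves by `O(T)` between the last sample and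
  -- `t`.
  have hd1 : ‖d.Co *ᵥ z t - d.Co *ᵥ z (i * T)‖ ≤ κ₁ * T * s := by
    rw [← mulVec_sub]
    have e2 : z t - z (i * T) = (NormedSpace.exp (h • d.Ao) - 1) *ᵥ z (i * T) +
        ∫ τ in (i * T)..t, NormedSpace.exp ((t - τ) • d.Ao) *ᵥ V τ := by
      rw [hstep, sub_mulVec, one_mulVec]; abel
    calc _ ≤ ‖d.Co‖ * (E₁ * h * (c₁ * (β * s)) + E * (β * s) * h) := by
          refine (mulVec_norm_le _ _).trans ?_
          gcongr
          rw [e2]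
          refine (norm_add_le _ _).trans (add_le_add ((mulVec_norm_le _ _).trans ?_) hint)
          have h1 := hE₁ h hhI
          have h2 := hzb (i * T) ⟨hi0, hfl⟩
          have h3 : 0 ≤ E₁ * h := mul_nonneg hE₁0 hhI.1
          gcongr
      _ ≤ ‖d.Co‖ * (E₁ * T * (c₁ * (β * s)) + E * (β * s) * T) := by
          have : h ≤ T := by linarith
          gcongr
      _ = κ₁ * T * s := by rw [hκ₁]; ring
  -- the filtered estimate in continuous time
  set X := tfAct (tfConst (NormedSpace.exp (-(T • d.Am)))) S with hX
  have hXm : X ∈ vsignals _ := tfAct_mem (MProper.tfConst _) hSm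
  have hVX : V = tfAct (tfConst d.Bo) X := by
    rw [hV, hX, tfConst_mul, tfAct_mul (MProper.tfConst _) (MProper.tfConst _) hSm]
  have hCz : (fun t => d.Co *ᵥ z t) = tfAct d.O X := by
    rw [← tfAct_tfConst, hz, hVX, ← tfAct_mul hRo (MProper.tfConst _) hXm,
      ← tfAct_mul (MProper.tfConst _) (hRo.mul (MProper.tfConst _)) hXm, ← Matrix.mul_assoc]
    congr 1
    exact hd.realization.1
  -- Splitting `S = (S - B_m σ) + B_m σ`, the operator `C_m (sI - A_m)⁻¹` produces `C_m e + M σ`,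
  -- and `C M⁻¹` turns `M σ` into the ideal signal `C σ`.
  have hOS : tfAct d.O S = tfAct (d.Cf * d.M⁻¹) (fun t => d.Cm *ᵥ e t) + tfAct d.Cf σ := by
    have e3 : tfAct (tfConst d.Cm * tfResolvent d.Am) S =
        (fun t => d.Cm *ᵥ e t) + tfAct d.M σ := by
      have e4 : S = (S - tfAct (tfConst d.Bm) σ) + tfAct (tfConst d.Bm) σ := by abel
      nth_rewrite 1 [e4]
      rw [tfAct_add hCR hsub hBσ, ← tfAct_mul hCR (MProper.tfConst _) hσ,
        tfAct_mul (MProper.tfConst _) hRm hsub, tfAct_tfConst, ← he]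
      rfl
    have hMp : MProper d.M := hCR.mul (MProper.tfConst d.Bm)
    have hCe : (fun t => d.Cm *ᵥ e t) ∈ vsignals (Fin 2) := by
      rw [← tfAct_tfConst]; exact tfAct_mem (MProper.tfConst _) hem
    rw [O, Matrix.mul_assoc, tfAct_mul hCM hCR hSm, e3, tfAct_add hCM hCe (tfAct_mem hMp hσ),
      ← tfAct_mul hCM hMp hσ, Matrix.mul_assoc d.Cf, hd.M_inv_mul, Matrix.mul_one]
  have hXS : tfAct d.O X = tfAct d.O (X - S) + tfAct d.O S := by
    rw [tfAct_sub hO hXm hSm]; abel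
  -- The factor `e^{-A_m T}` in the control law differs from the identity by `O(T)`.
  have hXb : ∀ u ∈ Set.Icc 0 t, ‖(X - S) u‖ ≤ E₃ * T * (C * s) := fun u hu => by
    have : (X - S) u = (NormedSpace.exp (T • -d.Am) - 1) *ᵥ S u := by
      rw [Pi.sub_apply, hX, tfAct_tfConst_apply, sub_mulVec, one_mulVec, smul_neg]
    rw [this]
    refine (mulVec_norm_le _ _).trans ?_
    have h1 := hE₃ T hTI
    have h2 := (hmono u hu).2
    gcongr
  have h1 := hb₂ (X - S) t _ ht (by positivity) hXb
  have h2 := hb₃ (fun t => d.Cm *ᵥ e t) t (C * T * s) ht (by positivity) fun u hu => (hmono u hu).1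
  have h3 : d.Co *ᵥ z t = tfAct d.O (X - S) t +
      (tfAct (d.Cf * d.M⁻¹) (fun t => d.Cm *ᵥ e t) t + tfAct d.Cf σ t) := by
    have := congrFun hCz t
    rw [hXS, hOS] at this
    exact this
  have h4 : d.Co *ᵥ z (i * T) - tfAct d.Cf σ t = -(d.Co *ᵥ z t - d.Co *ᵥ z (i * T)) +
      (tfAct d.O (X - S) t + tfAct (d.Cf * d.M⁻¹) (fun t => d.Cm *ᵥ e t) t) := by
    rw [h3]; abel
  rw [h4]
  calc _ ≤ κ₁ * T * s + (c₂ * (E₃ * T * (C * s)) + c₃ * (C * T * s)) := by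
        refine (norm_add_le _ _).trans (add_le_add ?_ ((norm_add_le _ _).trans (add_le_add h1 h2)))
        rw [norm_neg]; exact hd1
    _ = _ := by ring

end Admissible

end L1Design

end SampledControl


/-! Causal functional differential equations -/

section Picard

variable {E : Type*} [NormedAddCommGroup E] [NormedSpace ℝ E]

/-- The integrated right-hand side, extended by a constant to negative times. -/
def picardStep (F : (ℝ → E) → ℝ → E) (x₀ : E) (x : ℝ → E) (t : ℝ) : E :=
  x₀ + ∫ τ in (0 : ℝ)..max t 0, F x τ

def picardIter (F : (ℝ → E) → ℝ → E) (x₀ : E) : ℕ → ℝ → E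
  | 0 => fun _ => x₀
  | n + 1 => picardStep F x₀ (picardIter F x₀ n)

lemma continuous_picardStep {F : (ℝ → E) → ℝ → E} {x : ℝ → E} (x₀ : E)
    (hF : ∀ t, 0 ≤ t → IntervalIntegrable (F x) volume 0 t) : Continuous (picardStep F x₀ x) := by
  have h : ContinuousOn (fun t => ∫ τ in (0 : ℝ)..t, F x τ) (Set.Ici 0) := by
    intro t ht
    have h1 := intervalIntegral.continuousOn_primitive_interval'
      (hF (t + 1) (by linarith [Set.mem_Ici.1 ht])) Set.left_mem_uIcc
    have ht' : (0 : ℝ) ≤ t := ht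
    rw [Set.uIcc_of_le (by linarith)] at h1
    refine (h1 t ⟨ht, by linarith⟩).mono_of_mem_nhdsWithin ?_
    refine mem_nhdsWithin.2 ⟨Set.Iio (t + 1), isOpen_Iio, by simp, fun s hs => ⟨hs.2, ?_⟩⟩
    exact (Set.mem_Iio.1 hs.1).le
  exact continuous_const.add (h.comp_continuous (continuous_id.max continuous_const)
    fun t => Set.mem_Ici.2 (le_max_right _ _))

/-- Existence of solutions of Lipschitz causal functional differential equations. -/
theorem exists_causal_solution [CompleteSpace E] (F : (ℝ → E) → ℝ → E) (x₀ : E)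
    (hint : ∀ x, Continuous x → ∀ t, 0 ≤ t → IntervalIntegrable (F x) volume 0 t)
    (hlip : ∀ S : ℝ, ∃ L : ℝ, 0 < L ∧ ∀ x y, Continuous x → Continuous y → ∀ τ ∈ Set.Icc 0 S,
      ∀ m, (∀ s ∈ Set.Icc 0 τ, ‖x s - y s‖ ≤ m) → ‖F x τ - F y τ‖ ≤ L * m) :
    ∃ x : ℝ → E, Continuous x ∧ ∀ t, 0 ≤ t → x t = x₀ + ∫ τ in (0 : ℝ)..t, F x τ := by
  set u := picardIter F x₀ with hu
  have huc : ∀ n, Continuous (u n) := by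
    intro n
    induction n with
    | zero => exact continuous_const
    | succ n ih => exact continuous_picardStep x₀ (hint _ ih)
  have hu1 : ∀ n t, u (n + 1) t = x₀ + ∫ τ in (0 : ℝ)..max t 0, F (u n) τ := fun n t => rfl
  have humax : ∀ n t, u n (max t 0) = u n t := by
    intro n t
    cases n with
    | zero => rfl
    | succ n => rw [hu1, hu1, max_eq_left (le_max_right t 0)]
  have hgeo : ∀ S : ℝ, ∃ D : ℝ, 0 ≤ D ∧ ∀ n, ∀ t ≤ S, dist (u n t) (u (n + 1) t) ≤ D / 2 / 2 ^ n := by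
    intro S
    obtain ⟨L, hL, hLip⟩ := hlip S
    obtain ⟨C, hC⟩ := (isCompact_Icc (a := (0 : ℝ)) (b := S)).exists_bound_of_continuousOn
      ((huc 1).sub (huc 0)).continuousOn
    have hC' : ∀ t ∈ Set.Icc 0 S, ‖u 1 t - u 0 t‖ ≤ |C| := fun t ht => (hC t ht).trans (le_abs_self C)
    -- For the weight `e^{2Lt}` one integration of the Lipschitz estimate gains the factor `1/2`, as
    -- `L ∫₀ᵗ e^{2Lτ} dτ ≤ e^{2Lt} / 2`. Hence the iteration contracts on bounded intervals of any
    -- length.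
    have hb : ∀ n, ∀ t ∈ Set.Icc 0 S,
        ‖u (n + 1) t - u n t‖ ≤ |C| * Real.exp (2 * L * t) / 2 ^ n := by
      intro n
      induction n with
      | zero =>
        intro t ht
        rw [pow_zero, div_one]
        refine (hC' t ht).trans (le_mul_of_one_le_right (abs_nonneg C) ?_)
        exact Real.one_le_exp (by have := ht.1; positivity)
      | succ n ih =>
        intro t ht
        have h1 : u (n + 1 + 1) t - u (n + 1) t =
            ∫ τ in (0 : ℝ)..t, (F (u (n + 1)) τ - F (u n) τ) := by
          rw [intervalIntegral.integral_sub (hint _ (huc _) t ht.1) (hint _ (huc _) t ht.1),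
            hu1, hu1, max_eq_left ht.1]
          abel
        have hd : ∀ τ : ℝ, HasDerivAt (fun τ => |C| * Real.exp (2 * L * τ) / 2 ^ (n + 1))
            (L * (|C| * Real.exp (2 * L * τ) / 2 ^ n)) τ := fun τ => by
          have h2 := ((((hasDerivAt_id τ).const_mul (2 * L)).exp).const_mul |C|).div_const
            (2 ^ (n + 1))
          refine h2.congr_deriv ?_
          simp only [id]
          field_simp
          ring
        have hcont : Continuous fun τ => L * (|C| * Real.exp (2 * L * τ) / 2 ^ n) := by fun_prop
        rw [h1]
        refine (intervalIntegral.norm_integral_le_of_norm_le ht.1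
          (ae_of_all _ fun τ hτ => ?_) (hcont.intervalIntegrable 0 t)).trans ?_
        · have hτS : τ ∈ Set.Icc 0 S := ⟨hτ.1.le, hτ.2.trans ht.2⟩
          refine hLip _ _ (huc _) (huc _) τ hτS _ fun s hs => ?_
          refine (ih s ⟨hs.1, hs.2.trans hτS.2⟩).trans ?_
          gcongr
          exact hs.2
        · rw [intervalIntegral.integral_eq_sub_of_hasDerivAt (fun τ _ => hd τ)
            (hcont.intervalIntegrable 0 t)]
          refine sub_le_self _ (by positivity)
    refine ⟨2 * (|C| * Real.exp (2 * L * |S|)), by positivity, fun n t ht => ?_⟩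
    rw [mul_div_cancel_left₀ _ (two_ne_zero), dist_comm, dist_eq_norm]
    rcases le_or_gt 0 S with hS | hS
    · rw [← humax (n + 1) t, ← humax n t]
      refine (hb n (max t 0) ⟨le_max_right _ _, max_le ht hS⟩).trans ?_
      gcongr
      exact (max_le ht hS).trans (le_abs_self S)
    · have ht0 : max t 0 = 0 := max_eq_right (ht.trans hS.le)
      have e : u (n + 1) t = u n t := by
        rw [← humax (n + 1) t, ← humax n t, ht0]
        have : ∀ n, u n 0 = x₀ := fun n => by
          cases n with
          | zero => rfl
          | succ n => rw [hu1, max_self, intervalIntegral.integral_same, add_zero]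
        rw [this, this]
      rw [e, sub_self, norm_zero]
      positivity
  have hlim : ∀ t, ∃ y, Tendsto (fun n => u n t) atTop (𝓝 y) := fun t => by
    obtain ⟨D, hD, h⟩ := hgeo t
    exact cauchySeq_tendsto_of_complete (cauchySeq_of_le_geometric_two fun n => h n t le_rfl)
  choose x hx using hlim
  have hxu : ∀ S : ℝ, ∃ D : ℝ, 0 ≤ D ∧ ∀ n, ∀ t ≤ S, dist (u n t) (x t) ≤ D / 2 ^ n := fun S => by
    obtain ⟨D, hD, h⟩ := hgeo S
    exact ⟨D, hD, fun n t ht => dist_le_of_le_geometric_two_of_tendsto (fun n => h n t ht) (hx t) n⟩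
  have hpow : ∀ D : ℝ, Tendsto (fun n : ℕ => D / 2 ^ n) atTop (𝓝 0) := fun D => by
    have := (tendsto_pow_atTop_nhds_zero_of_lt_one (r := (1 / 2 : ℝ)) (by norm_num)
      (by norm_num)).const_mul D
    rw [mul_zero] at this
    refine this.congr fun n => ?_
    rw [one_div, inv_pow, div_eq_mul_inv]
  have hxc : Continuous x := by
    have hloc : TendstoLocallyUniformly u x atTop := by
      rw [Metric.tendstoLocallyUniformly_iff]
      intro ε hε t
      obtain ⟨D, hD, h⟩ := hxu (t + 1)
      refine ⟨Set.Iio (t + 1), Iio_mem_nhds (by linarith), ?_⟩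
      filter_upwards [(hpow D).eventually (gt_mem_nhds hε)] with n hn s hs
      rw [dist_comm]
      exact (h n s (Set.mem_Iio.1 hs).le).trans_lt hn
    exact hloc.continuous (Frequently.of_forall huc)
  refine ⟨x, hxc, fun t ht => ?_⟩
  obtain ⟨D, hD, h⟩ := hxu t
  obtain ⟨L, hL, hLip⟩ := hlip t
  refine tendsto_nhds_unique ((tendsto_add_atTop_iff_nat 1).2 (hx t)) ?_
  rw [tendsto_iff_dist_tendsto_zero]
  have hz := (hpow (L * D * t))
  refine squeeze_zero (fun n => dist_nonneg) (fun n => ?_) hz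
  rw [hu1, max_eq_left ht, dist_add_left, dist_eq_norm,
    ← intervalIntegral.integral_sub (hint _ (huc _) t ht) (hint _ hxc t ht)]
  refine (intervalIntegral.norm_integral_le_of_norm_le_const (C := L * (D / 2 ^ n))
    fun τ hτ => ?_).trans_eq ?_
  · rw [Set.uIoc_of_le ht] at hτ
    refine hLip _ _ (huc _) hxc τ ⟨hτ.1.le, hτ.2⟩ _ fun s hs => ?_
    rw [← dist_eq_norm]
    exact h n s (hs.2.trans hτ.2)
  · rw [sub_zero, abs_of_nonneg ht]; ring

/-- A continuous function that cannot reach the boundary of a ball stays in the ball. -/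
lemma norm_lt_of_continuation {x : ℝ → E} (hx : ContinuousOn x (Set.Ici 0)) {r : ℝ}
    (h0 : ‖x 0‖ < r) (h : ∀ t, 0 ≤ t → (∀ s ∈ Set.Icc 0 t, ‖x s‖ ≤ r) → ‖x t‖ < r) :
    ∀ t, 0 ≤ t → ‖x t‖ < r := by
  intro t ht
  by_contra! hcon
  have hc : ∀ s, 0 ≤ s → ContinuousOn (fun τ => ‖x τ‖) (Set.Icc 0 s) := fun s _ =>
    (hx.mono fun τ hτ => hτ.1).norm
  have hivt : ∀ s, 0 ≤ s → r ≤ ‖x s‖ → ∃ τ ∈ Set.Icc 0 s, ‖x τ‖ = r := fun s hs hr =>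
    intermediate_value_Icc hs (hc s hs) ⟨h0.le, hr⟩
  have hK : IsCompact (Set.Icc 0 t ∩ (fun τ => ‖x τ‖) ⁻¹' {r}) :=
    isCompact_Icc.of_isClosed_subset
      ((hc t ht).preimage_isClosed_of_isClosed isClosed_Icc isClosed_singleton)
      Set.inter_subset_left
  obtain ⟨τ, hτ, hτr⟩ := hivt t ht hcon
  -- `t₁` is the first time at which the norm equals `r`. Up to `t₁` the norm cannot exceed `r`, by
  -- the intermediate value theorem, so `h` contradicts the equality.
  obtain ⟨t₁, ⟨ht₁, ht₁r⟩, hmin⟩ := hK.exists_isLeast ⟨τ, hτ, hτr⟩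
  have ht₁r' : ‖x t₁‖ = r := ht₁r
  refine absurd (h t₁ ht₁.1 fun s hs => ?_) (not_lt.2 ht₁r'.ge)
  by_contra! hs'
  obtain ⟨τ, hτ, hτr⟩ := hivt s hs.1 hs'.le
  have h1 := hmin ⟨⟨hτ.1, hτ.2.trans (hs.2.trans ht₁.2)⟩, hτr⟩
  have h2 : s = t₁ := le_antisymm hs.2 (h1.trans hτ.2)
  rw [h2, ht₁r'] at hs'
  exact lt_irrefl _ hs'

end Picard


/-! Closed-loop signals -/

namespace L1Design

variable {np k no : ℕ} (d : L1Design np k no)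

/-- The matched disturbance `M⁻¹ ((P - M) U + P ν + H_in x₀)` seen by the desired system. -/
def matched (U ν : ℝ → Fin 2 → ℝ) (x₀ : Fin np → ℝ) : ℝ → Fin 2 → ℝ :=
  tfAct d.Zm U + tfAct (d.M⁻¹ * d.P) ν + tfImp d.Vin x₀

/-- The matched disturbance when `U = V - C σ`. -/
def matchedLoop (V ν : ℝ → Fin 2 → ℝ) (x₀ : Fin np → ℝ) : ℝ → Fin 2 → ℝ :=
  tfAct (d.H₁ * d.Zm) V + tfAct (d.H₁ * (d.M⁻¹ * d.P)) ν + tfImp (d.H₁ * d.Vin) x₀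

namespace Admissible

variable {d} (hd : d.Admissible)
include hd

lemma matched_mem {U ν : ℝ → Fin 2 → ℝ} (hU : U ∈ vsignals (Fin 2)) (hν : ν ∈ vsignals (Fin 2))
    (x₀ : Fin np → ℝ) : d.matched U ν x₀ ∈ vsignals (Fin 2) :=
  (vsignals _).add_mem ((vsignals _).add_mem (tfAct_mem hd.Zm_proper hU)
    (tfAct_mem hd.MP_proper hν)) (tfImp_mem hd.Vin_strict.mproper x₀)

lemma matchedLoop_mem {V ν : ℝ → Fin 2 → ℝ} (hV : V ∈ vsignals (Fin 2)) (hν : ν ∈ vsignals (Fin 2))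
    (x₀ : Fin np → ℝ) : d.matchedLoop V ν x₀ ∈ vsignals (Fin 2) :=
  (vsignals _).add_mem ((vsignals _).add_mem (tfAct_mem (hd.H₁_proper.mul hd.Zm_proper) hV)
    (tfAct_mem (hd.H₁_proper.mul hd.MP_proper) hν))
    (tfImp_mem (hd.H₁_proper.mul hd.Vin_strict.mproper) x₀)

lemma matchedLoop_eq {V ν : ℝ → Fin 2 → ℝ} (hV : V ∈ vsignals (Fin 2)) (hν : ν ∈ vsignals (Fin 2))
    (x₀ : Fin np → ℝ) : d.matchedLoop V ν x₀ = tfAct d.H₁ (d.matched V ν x₀) := by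
  have h1 := tfAct_mem hd.Zm_proper hV
  have h2 := tfAct_mem hd.MP_proper hν
  rw [matched, tfAct_add hd.H₁_proper ((vsignals _).add_mem h1 h2)
    (tfImp_mem hd.Vin_strict.mproper x₀), tfAct_add hd.H₁_proper h1 h2,
    tfAct_tfImp hd.H₁_proper hd.Vin_strict, ← tfAct_mul hd.H₁_proper hd.Zm_proper hV,
    ← tfAct_mul hd.H₁_proper hd.MP_proper hν, matchedLoop]

/-- The matched disturbance of the closed loop with `U = V - C σ`. -/
lemma matched_eq_matchedLoop {U V ν : ℝ → Fin 2 → ℝ} (hU : U ∈ vsignals (Fin 2))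
    (hV : V ∈ vsignals (Fin 2)) (hν : ν ∈ vsignals (Fin 2)) (x₀ : Fin np → ℝ)
    (h : U = V - tfAct d.Cf (d.matched U ν x₀)) :
    d.matched U ν x₀ = d.matchedLoop V ν x₀ := by
  have hσ := hd.matched_mem hU hν x₀
  obtain ⟨σ, hσe⟩ : ∃ σ, σ = d.matched U ν x₀ := ⟨_, rfl⟩
  rw [← hσe] at h hσ ⊢
  -- Inserting `U = V - C σ` into the definition of `σ` makes the equation implicit; moving the term
  -- `(M⁻¹ P - 1) C σ` to the left gives a matrix that `H₁` inverts.
  have h1 : tfAct (1 + d.Zm * d.Cf) σ = d.matched V ν x₀ := by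
    rw [tfAct_add_left EntriesIn.one (hd.Zm_proper.mul hd.filter_proper) hσ, tfAct_one,
      tfAct_mul hd.Zm_proper hd.filter_proper hσ]
    nth_rewrite 1 [hσe]
    rw [matched, matched, h, tfAct_sub hd.Zm_proper hV (tfAct_mem hd.filter_proper hσ)]
    abel
  rw [hd.matchedLoop_eq hV hν, ← h1, ← tfAct_mul hd.H₁_proper hd.ZC_proper hσ, hd.H₁_mul, tfAct_one]

/-- The plant state in closed loop. -/
lemma state_eq {X U V ν : ℝ → _ → ℝ} (hV : V ∈ vsignals (Fin 2))
    (hν : ν ∈ vsignals (Fin 2)) (x₀ : Fin np → ℝ)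
    (hU : U = V - tfAct d.Cf (d.matchedLoop V ν x₀))
    (hX : X = tfImp d.R x₀ + tfAct d.H₀ (U + ν)) :
    X = tfAct d.H₂ V + tfAct d.G ν + tfImp (d.R - d.H₅ * d.Hin) x₀ := by
  have hH := d.H₀_strict.mproper
  have hHC := hH.mul hd.filter_proper
  have hZ := hd.H₁_proper.mul hd.Zm_proper
  have hW := hd.H₁_proper.mul hd.MP_proper
  have hI : MStrict (d.H₁ * d.Vin) := MStrict.mul_left hd.H₁_proper hd.Vin_strict
  have hσ := hd.matchedLoop_mem hV hν x₀
  have e1 : tfAct d.H₀ (tfAct d.Cf (d.matchedLoop V ν x₀)) =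
      tfAct (d.H₀ * d.Cf * (d.H₁ * d.Zm)) V + tfAct (d.H₀ * d.Cf * (d.H₁ * (d.M⁻¹ * d.P))) ν +
        tfImp (d.H₅ * d.Hin) x₀ := by
    have m1 := tfAct_mem hZ hV
    have m2 := tfAct_mem hW hν
    rw [← tfAct_mul hH hd.filter_proper hσ, matchedLoop,
      tfAct_add hHC ((vsignals _).add_mem m1 m2) (tfImp_mem hI.mproper x₀), tfAct_add hHC m1 m2,
      tfAct_tfImp hHC hI, ← tfAct_mul hHC hZ hV, ← tfAct_mul hHC hW hν, ← H₅Hin_eq]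
  have hCσ := tfAct_mem hd.filter_proper hσ
  rw [hX, tfAct_add hH (hU ▸ (vsignals _).sub_mem hV hCσ) hν, hU, tfAct_sub hH hV hCσ, e1,
    tfImp_sub d.R_strict.mproper hd.H₅Hin_strict.mproper, H₂_eq, G_eq,
    tfAct_sub_left hH (hHC.mul hZ) hV, tfAct_sub_left hH (hHC.mul hW) hν]
  abel

/-- The plant output is the output of the desired system driven by the matched disturbance. -/
lemma output_eq {X U ν : ℝ → _ → ℝ} (hU : U ∈ vsignals (Fin 2)) (hν : ν ∈ vsignals (Fin 2))
    (x₀ : Fin np → ℝ) (hX : X = tfImp d.R x₀ + tfAct d.H₀ (U + ν)) (t : ℝ) :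
    d.Cp.mulVec (X t) = d.Cm.mulVec
      (tfAct (tfResolvent d.Am) (tfAct (tfConst d.Bm) (U + d.matched U ν x₀)) t +
        tfImp (tfResolvent d.Am) ((rightPinv d.Cm).mulVec (d.Cp.mulVec x₀)) t) := by
  have hRm : MStrict (tfResolvent d.Am) := mstrict_resolvent d.Am
  have hCp : MProper (tfConst d.Cp) := MProper.tfConst _
  have hCm : MProper (tfConst d.Cm) := MProper.tfConst _
  have hBm : MProper (tfConst d.Bm) := MProper.tfConst _
  have hB : MProper (tfConst (rightPinv d.Cm * d.Cp)) := MProper.tfConst _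
  have hσ := hd.matched_mem hU hν x₀
  have hUσ := (vsignals _).add_mem hU hσ
  have hUν := (vsignals _).add_mem hU hν
  have hM := d.M_strict.mproper
  have h1 : tfAct (tfConst d.Cp) X = tfImp (tfConst d.Cp * d.R) x₀ + tfAct d.P (U + ν) := by
    rw [hX, tfAct_add hCp (tfImp_mem d.R_strict.mproper x₀) (tfAct_mem d.H₀_strict.mproper hUν),
      tfAct_tfImp hCp d.R_strict, ← tfAct_mul hCp d.H₀_strict.mproper hUν, ← P_eq]
  have h2 : tfAct (tfConst d.Cm) (tfAct (tfResolvent d.Am)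
      (tfAct (tfConst d.Bm) (U + d.matched U ν x₀))) = tfAct d.P (U + ν) + tfImp d.Hin x₀ := by
    have m1 := tfAct_mem hd.Zm_proper hU
    have m2 := tfAct_mem hd.MP_proper hν
    have e1 : d.M * d.Zm = d.P - d.M := by
      rw [Zm, Matrix.mul_sub, ← Matrix.mul_assoc, hd.M_mul_inv, Matrix.one_mul, Matrix.mul_one]
    have e2 : d.M * (d.M⁻¹ * d.P) = d.P := by
      rw [← Matrix.mul_assoc, hd.M_mul_inv, Matrix.one_mul]
    have e3 : d.M * d.Vin = d.Hin := by
      rw [Vin, ← Matrix.mul_assoc, hd.M_mul_inv, Matrix.one_mul]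
    rw [← tfAct_mul hRm.mproper hBm hUσ, ← tfAct_mul hCm (hRm.mproper.mul hBm) hUσ,
      ← Matrix.mul_assoc, ← tfOf, ← M, tfAct_add hM hU hσ, matched,
      tfAct_add hM ((vsignals _).add_mem m1 m2) (tfImp_mem hd.Vin_strict.mproper x₀),
      tfAct_add hM m1 m2, ← tfAct_mul hM hd.Zm_proper hU, ← tfAct_mul hM hd.MP_proper hν,
      tfAct_tfImp hM hd.Vin_strict, e1, e2, e3, tfAct_sub_left d.P_strict.mproper hM hU,
      tfAct_add d.P_strict.mproper hU hν]
    abel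
  have h3 : tfAct (tfConst d.Cm) (tfImp (tfResolvent d.Am)
      ((rightPinv d.Cm).mulVec (d.Cp.mulVec x₀))) =
      tfImp (tfConst d.Cm * tfResolvent d.Am * tfConst (rightPinv d.Cm * d.Cp)) x₀ := by
    rw [Matrix.mulVec_mulVec, ← tfImp_mul_tfConst hRm.mproper, tfAct_tfImp hCm (hRm.mul hB),
      Matrix.mul_assoc]
  have h4 : tfImp d.Hin x₀ = tfImp (tfConst d.Cp * d.R) x₀ -
      tfImp (tfConst d.Cm * tfResolvent d.Am * tfConst (rightPinv d.Cm * d.Cp)) x₀ :=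
    tfImp_sub (hCp.mul d.R_strict.mproper) ((hCm.mul hRm.mproper).mul hB) x₀
  have h5 := congrFun h1 t
  have h6 := congrFun h2 t
  have h7 := congrFun h3 t
  rw [tfAct_tfConst_apply] at h5 h6 h7
  rw [Matrix.mulVec_add, h5, h6, h7, h4]
  simp only [Pi.add_apply, Pi.sub_apply]
  abel

end Admissible

end L1Design


/-! Trajectories as signals -/

section Trajectories

lemma trunc_mem_of_continuousOn {n : Type*} [Fintype n] {x : ℝ → n → ℝ}
    (hx : ContinuousOn x (Set.Ici 0)) : trunc x ∈ vsignals n := by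
  refine trunc_mem_vsignals ?_ fun T =>
    isCompact_Icc.exists_bound_of_continuousOn (hx.mono fun t ht => ht.1)
  classical
  have h : trunc x = (Set.Ici (0 : ℝ)).piecewise x 0 := by
    ext1 t
    by_cases ht : 0 ≤ t
    · rw [trunc_of_nonneg _ ht, Set.piecewise_eq_of_mem _ _ _ (Set.mem_Ici.2 ht)]
    · rw [trunc_of_neg _ (not_le.1 ht),
        Set.piecewise_eq_of_notMem _ _ _ (fun h => ht (Set.mem_Ici.1 h))]; rfl
  rw [h]
  exact hx.measurable_piecewise continuousOn_const measurableSet_Ici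

lemma trunc_add {n : Type*} (v w : ℝ → n → ℝ) : trunc (fun t => v t + w t) = trunc v + trunc w := by
  ext1 t
  rcases lt_or_ge t 0 with ht | ht
  · rw [Pi.add_apply, trunc_of_neg _ ht, trunc_of_neg _ ht, trunc_of_neg _ ht, add_zero]
  · rw [Pi.add_apply, trunc_of_nonneg _ ht, trunc_of_nonneg _ ht, trunc_of_nonneg _ ht]

lemma tfAct_tfConst_trunc {m n : Type*} [Fintype m] [Fintype n] (A : Matrix m n ℝ)
    (w : ℝ → n → ℝ) : tfAct (tfConst A) (trunc w) = trunc fun t => A.mulVec (w t) := by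
  ext1 t
  rw [tfAct_tfConst_apply]
  rcases lt_or_ge t 0 with ht | ht
  · rw [trunc_of_neg _ ht, trunc_of_neg _ ht, Matrix.mulVec_zero]
  · rw [trunc_of_nonneg _ ht, trunc_of_nonneg _ ht]

lemma matInfNorm_nonneg {m n : ℕ} (A : Matrix (Fin m) (Fin n) ℝ) : 0 ≤ matInfNorm A :=
  Real.iSup_nonneg fun _ => Finset.sum_nonneg fun _ _ => abs_nonneg _

lemma mulVec_norm_le_matInfNorm {m n : ℕ} (A : Matrix (Fin m) (Fin n) ℝ) (v : Fin n → ℝ) :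
    ‖A.mulVec v‖ ≤ matInfNorm A * ‖v‖ := by
  have h0 := matInfNorm_nonneg A
  refine (pi_norm_le_iff_of_nonneg (by positivity)).2 fun i => ?_
  calc ‖A.mulVec v i‖ ≤ ∑ j, |A i j * v j| :=
        Finset.abs_sum_le_sum_abs (fun j => A i j * v j) Finset.univ
    _ ≤ ∑ j, |A i j| * ‖v‖ := by
      refine Finset.sum_le_sum fun j _ => ?_
      rw [abs_mul]
      exact mul_le_mul_of_nonneg_left (norm_le_pi_norm v j) (abs_nonneg _)
    _ = (∑ j, |A i j|) * ‖v‖ := (Finset.sum_mul _ _ _).symm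
    _ ≤ _ := by
      gcongr
      exact le_ciSup (f := fun i => ∑ j, |A i j|) (Set.finite_range _).bddAbove i

namespace IsUncertainty

variable {np : ℕ} {F : ℝ → ℝ} {L₀ : ℝ} {f : ℝ → (Fin np → ℝ) → Fin 2 → ℝ}

lemma norm_le (hf : IsUncertainty F L₀ f) {δ t : ℝ} (ht : 0 ≤ t) {z : Fin np → ℝ} (hz : ‖z‖ < δ) :
    ‖f t z‖ ≤ F δ * ‖z‖ + L₀ := by
  have hδ := (norm_nonneg z).trans_lt hz
  have h1 := hf.lipschitz δ hδ t ht 0 z (by rwa [norm_zero]) hz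
  rw [sub_zero] at h1
  calc ‖f t z‖ = ‖(f t z - f t 0) + f t 0‖ := by rw [sub_add_cancel]
    _ ≤ _ := (norm_add_le _ _).trans (add_le_add h1 (hf.bound t ht))

lemma continuous (hf : IsUncertainty F L₀ f) {t : ℝ} (ht : 0 ≤ t) : Continuous (f t) := by
  refine continuous_iff_continuousAt.2 fun z => ?_
  have hδ : 0 < ‖z‖ + 1 := by positivity
  have hl : LipschitzOnWith (F (‖z‖ + 1)).toNNReal (f t) (Metric.ball 0 (‖z‖ + 1)) := by
    refine LipschitzOnWith.of_dist_le_mul fun a ha b hb => ?_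
    rw [mem_ball_zero_iff] at ha hb
    rw [dist_eq_norm, dist_eq_norm]
    refine (hf.lipschitz _ hδ t ht b a hb ha).trans ?_
    gcongr
    exact Real.le_coe_toNNReal _
  exact hl.continuousOn.continuousAt (Metric.isOpen_ball.mem_nhds (by simp))

lemma comp_mem (hf : IsUncertainty F L₀ f) {x : ℝ → Fin np → ℝ}
    (hx : ContinuousOn x (Set.Ici 0)) : trunc (fun t => f t (x t)) ∈ vsignals (Fin 2) := by
  have hX := trunc_mem_of_continuousOn hx
  have hXm : Measurable (trunc x) := measurable_pi_iff.2 fun j => (hX j).1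
  refine trunc_mem_vsignals ?_ fun T => ?_
  · have hu := measurable_uncurry_of_continuous_of_measurable
      (u := fun (z : Fin np → ℝ) (t : ℝ) => if 0 ≤ t then f t z else 0) (fun t => by
        by_cases ht : 0 ≤ t
        · simp only [ht, if_true]; exact hf.continuous ht
        · simp only [ht, if_false]; exact continuous_const)
      (fun z => Measurable.ite measurableSet_Ici (hf.measurable z) measurable_const)
    have h := hu.comp (hXm.prodMk measurable_id)
    convert h using 1
    ext1 t
    by_cases ht : 0 ≤ t
    · simp [trunc_of_nonneg _ ht, ht]
    · simp [trunc_of_neg _ (not_le.1 ht), ht]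
  · obtain ⟨C, hC⟩ := isCompact_Icc.exists_bound_of_continuousOn
      (hx.mono fun t (ht : t ∈ Set.Icc 0 T) => ht.1)
    refine ⟨|F (C + 1)| * C + L₀, fun t ht => (hf.norm_le ht.1
      ((hC t ht).trans_lt (lt_add_one C))).trans ?_⟩
    gcongr
    · exact le_abs_self _
    · exact hC t ht

end IsUncertainty

lemma IsCommand.trunc_mem {Mω T e : ℝ} {ω : ℝ → Fin 2 → ℝ} (h : IsCommand Mω T e ω) :
    trunc ω ∈ vsignals (Fin 2) :=
  trunc_mem_vsignals (Measurable.ite measurableSet_Ici h.measurable measurable_const)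
    fun _ => ⟨Mω, fun t ht => h.bound t ht.1⟩

namespace L1Design

variable {np k no : ℕ} (d : L1Design np k no)

/-- The total disturbance `K x + f(t, x)` along `x`. -/
def nu (f : ℝ → (Fin np → ℝ) → Fin 2 → ℝ) (x : ℝ → Fin np → ℝ) : ℝ → Fin 2 → ℝ :=
  trunc fun t => d.K.mulVec (x t) + f t (x t)

variable {d} {F : ℝ → ℝ} {L₀ : ℝ} {f : ℝ → (Fin np → ℝ) → Fin 2 → ℝ} {x₀ : Fin np → ℝ}
  {u : ℝ → Fin 2 → ℝ} {x : ℝ → Fin np → ℝ}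

lemma nu_mem (hf : IsUncertainty F L₀ f) (hx : ContinuousOn x (Set.Ici 0)) :
    d.nu f x ∈ vsignals (Fin 2) := by
  rw [nu, trunc_add, ← tfAct_tfConst_trunc]
  exact (vsignals _).add_mem (tfAct_mem (MProper.tfConst _) (trunc_mem_of_continuousOn hx))
    (hf.comp_mem hx)

lemma IsTrajectory.initial (h : d.IsTrajectory f x₀ u x) : x 0 = x₀ := by
  rw [(h 0 le_rfl).2, intervalIntegral.integral_same, add_zero]

lemma IsTrajectory.continuousOn (h : d.IsTrajectory f x₀ u x) : ContinuousOn x (Set.Ici 0) := by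
  have hc := continuous_picardStep (F := fun x τ => d.Ap.mulVec (x τ) + d.Bp.mulVec (u τ + f τ (x τ)))
    (x := x) x₀ fun t ht => (h t ht).1
  refine hc.continuousOn.congr fun t ht => ?_
  rw [picardStep, max_eq_left ht]
  exact (h t ht).2

/-- Adding and subtracting `B_p K x` moves the analysis gain into `ν` and leaves the state matrix
`A_p - B_p K`, the one that is assumed Hurwitz. -/
lemma IsTrajectory.state_eq (h : d.IsTrajectory f x₀ u x) (hf : IsUncertainty F L₀ f)
    (hu : trunc u ∈ vsignals (Fin 2)) :
    trunc x = tfImp d.R x₀ + tfAct d.H₀ (trunc u + d.nu f x) := by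
  have hB : MProper (tfConst d.Bp) := MProper.tfConst _
  have hX := trunc_mem_of_continuousOn h.continuousOn
  have hV := (vsignals _).add_mem hu (nu_mem (d := d) hf h.continuousOn)
  have hR : MProper (tfResolvent (d.Ap - d.Bp * d.K)) := (mstrict_resolvent _).mproper
  rw [H₀, R, tfAct_mul hR hB hV]
  refine eq_resolvent_of_integral_eq _ hX (tfAct_mem hB hV) x₀ fun t ht => ?_
  rw [trunc_of_nonneg _ ht, (h t ht).2]
  congr 1
  refine intervalIntegral.integral_congr fun τ hτ => ?_
  rw [Set.uIcc_of_le ht] at hτ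
  rw [tfAct_tfConst_apply, Pi.add_apply, nu, trunc_of_nonneg _ hτ.1, trunc_of_nonneg _ hτ.1,
    trunc_of_nonneg _ hτ.1, Matrix.sub_mulVec, ← Matrix.mulVec_mulVec]
  simp only [Matrix.mulVec_add]
  abel

lemma uad_mem (T : ℝ) (ω : ℝ → Fin 2 → ℝ) (x : ℝ → Fin np → ℝ) :
    trunc (d.uad T ω x) ∈ vsignals (Fin 2) :=
  hold_mem_vsignals T fun i => d.uOut (ω ((i : ℝ) * T))
    (d.ctrlState T (fun i => d.Cp.mulVec (x ((i : ℝ) * T))) (fun i => ω ((i : ℝ) * T)) i).2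

namespace Admissible

variable (hd : d.Admissible)
include hd

lemma sigmaRef_eq {ω : ℝ → Fin 2 → ℝ} (hω : trunc ω ∈ vsignals (Fin 2))
    (hf : IsUncertainty F L₀ f) (hx : ContinuousOn x (Set.Ici 0)) :
    trunc (d.sigmaRef f ω x₀ x) =
      d.matchedLoop (tfAct (tfConst d.Kg) (trunc ω)) (d.nu f x) x₀ := by
  have hK : MProper (tfConst d.Kg) := MProper.tfConst _
  have hZ := hd.H₁_proper.mul hd.Zm_proper
  have hW := hd.H₁_proper.mul hd.MP_proper
  have e1 : d.N * (d.P - d.M) = d.H₁ * d.Zm := by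
    rw [hd.N_eq, Matrix.mul_assoc, Matrix.mul_sub, hd.M_inv_mul, Zm]
  have e2 : d.N * d.P = d.H₁ * (d.M⁻¹ * d.P) := by rw [hd.N_eq, Matrix.mul_assoc]
  have e3 : d.N * d.Hin = d.H₁ * d.Vin := by rw [hd.N_eq, Matrix.mul_assoc, Vin]
  have hν := nu_mem (d := d) hf hx
  ext1 t
  rcases lt_or_ge t 0 with ht | ht
  · rw [trunc_of_neg _ ht,
      vsignals_neg (hd.matchedLoop_mem (tfAct_mem hK hω) hν x₀) ht]
  rw [trunc_of_nonneg _ ht, sigmaRef, e1, e2, e3, tfApply_eq (hZ.mul hK) hω ht,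
    tfApply_eq hW hν ht, tfAct_mul hZ hK hω, matchedLoop, Pi.add_apply, Pi.add_apply, tfImp,
    trunc_of_nonneg _ ht]
  rfl

lemma uref_eq {ω : ℝ → Fin 2 → ℝ} (hω : trunc ω ∈ vsignals (Fin 2))
    (hf : IsUncertainty F L₀ f) (hx : ContinuousOn x (Set.Ici 0)) :
    trunc (d.uref f ω x₀ x) = tfAct (tfConst d.Kg) (trunc ω) -
      tfAct d.Cf (d.matchedLoop (tfAct (tfConst d.Kg) (trunc ω)) (d.nu f x) x₀) := by
  have hK : MProper (tfConst d.Kg) := MProper.tfConst _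
  have hσ := hd.matchedLoop_mem (tfAct_mem hK hω) (nu_mem (d := d) hf hx) x₀
  have hσe := hd.sigmaRef_eq (x₀ := x₀) hω hf hx
  ext1 t
  rcases lt_or_ge t 0 with ht | ht
  · rw [trunc_of_neg _ ht, vsignals_neg ((vsignals _).sub_mem (tfAct_mem hK hω)
      (tfAct_mem hd.filter_proper hσ)) ht]
  rw [trunc_of_nonneg _ ht, uref, tfApply_eq hd.filter_proper (by rwa [hσe]) ht, hσe,
    Pi.sub_apply, tfAct_tfConst_apply, trunc_of_nonneg _ ht]

lemma uref_mem {ω : ℝ → Fin 2 → ℝ} (hω : trunc ω ∈ vsignals (Fin 2))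
    (hf : IsUncertainty F L₀ f) (hx : ContinuousOn x (Set.Ici 0)) :
    trunc (d.uref f ω x₀ x) ∈ vsignals (Fin 2) := by
  have hK : MProper (tfConst d.Kg) := MProper.tfConst _
  rw [hd.uref_eq hω hf hx]
  exact (vsignals _).sub_mem (tfAct_mem hK hω) (tfAct_mem hd.filter_proper
    (hd.matchedLoop_mem (tfAct_mem hK hω) (nu_mem (d := d) hf hx) x₀))

end Admissible

end L1Design

end Trajectories


/-! Existence of trajectories for globally Lipschitz uncertainties -/

section Existence

open Matrix
open scoped Matrix.Norms.Operator

namespace L1Design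

variable {np k no : ℕ} (d : L1Design np k no) {ℓ L₀ : ℝ} {f : ℝ → (Fin np → ℝ) → Fin 2 → ℝ}

/-- The input may depend on the whole past of `x`; the causal Lipschitz condition `hlip` covers the
sampled controller and the reference control alike. -/
lemma exists_trajectory (hℓ : 0 ≤ ℓ) (hf : IsUncertainty (fun _ => ℓ) L₀ f) (x₀ : Fin np → ℝ)
    (u : (ℝ → Fin np → ℝ) → ℝ → Fin 2 → ℝ)
    (hu : ∀ x, Continuous x → trunc (u x) ∈ vsignals (Fin 2))
    (hlip : ∀ S : ℝ, ∃ L : ℝ, 0 ≤ L ∧ ∀ x y, Continuous x → Continuous y → ∀ τ ∈ Set.Icc 0 S,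
      ∀ m, (∀ s ∈ Set.Icc 0 τ, ‖x s - y s‖ ≤ m) → ‖u x τ - u y τ‖ ≤ L * m) :
    ∃ x, d.IsTrajectory f x₀ (u x) x := by
  have hint : ∀ x : ℝ → Fin np → ℝ, Continuous x → ∀ t, 0 ≤ t → IntervalIntegrable
      (fun τ => d.Ap.mulVec (x τ) + d.Bp.mulVec (u x τ + f τ (x τ))) volume 0 t := by
    intro x hx t ht
    have hm := (vsignals _).add_mem
      (tfAct_mem (MProper.tfConst d.Ap) (trunc_mem_of_continuousOn hx.continuousOn))
      (tfAct_mem (MProper.tfConst d.Bp) ((vsignals _).add_mem (hu x hx)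
        (hf.comp_mem hx.continuousOn)))
    refine (vsignals_intervalIntegrable hm ht).congr fun τ hτ => ?_
    rw [Set.uIoc_of_le ht] at hτ
    rw [Pi.add_apply, tfAct_tfConst_apply, tfAct_tfConst_apply, Pi.add_apply,
      trunc_of_nonneg _ hτ.1.le, trunc_of_nonneg _ hτ.1.le, trunc_of_nonneg _ hτ.1.le]
  obtain ⟨x, hx, hxe⟩ := exists_causal_solution
    (fun x τ => d.Ap.mulVec (x τ) + d.Bp.mulVec (u x τ + f τ (x τ))) x₀ hint (fun S => by
      obtain ⟨L, hL, h⟩ := hlip S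
      refine ⟨‖d.Ap‖ + ‖d.Bp‖ * (L + ℓ) + 1, by positivity, fun x y hx hy τ hτ m hm => ?_⟩
      have h1 := h x y hx hy τ hτ m hm
      have h2 := hm τ ⟨hτ.1, le_rfl⟩
      have hm0 : 0 ≤ m := (norm_nonneg _).trans h2
      have h3 : ‖f τ (x τ) - f τ (y τ)‖ ≤ ℓ * ‖x τ - y τ‖ :=
        hf.lipschitz (‖x τ‖ + ‖y τ‖ + 1) (by positivity) τ hτ.1 _ _
          (by linarith [norm_nonneg (x τ)]) (by linarith [norm_nonneg (y τ)])
      have e : d.Ap *ᵥ x τ + d.Bp *ᵥ (u x τ + f τ (x τ)) -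
          (d.Ap *ᵥ y τ + d.Bp *ᵥ (u y τ + f τ (y τ))) = d.Ap *ᵥ (x τ - y τ) +
          d.Bp *ᵥ ((u x τ - u y τ) + (f τ (x τ) - f τ (y τ))) := by
        simp only [mulVec_add, mulVec_sub]; abel
      rw [e]
      calc _ ≤ ‖d.Ap‖ * m + ‖d.Bp‖ * (L * m + ℓ * m) := by
            refine (norm_add_le _ _).trans (add_le_add ?_ ?_)
            · exact (mulVec_norm_le _ _).trans (by gcongr)
            · refine (mulVec_norm_le _ _).trans ?_
              gcongr
              exact (norm_add_le _ _).trans (add_le_add h1 (h3.trans (by gcongr)))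
        _ ≤ _ := by linarith)
  exact ⟨x, fun t ht => ⟨hint x hx t ht, hxe t ht⟩⟩

lemma sigmaHat_lipschitz (T : ℝ) : ∃ C : ℝ, 0 ≤ C ∧ ∀ a b : Fin 2 → ℝ,
    ‖d.sigmaHat T a - d.sigmaHat T b‖ ≤ C * ‖a - b‖ := by
  refine ⟨_, norm_nonneg ((d.Phi T)⁻¹ * d.expLam T *
    Matrix.fromRows (1 : Matrix (Fin 2) (Fin 2) ℝ) (0 : Matrix (Fin k) (Fin 2) ℝ)), fun a b => ?_⟩
  rw [sigmaHat, sigmaHat, ← neg_sub', ← mulVec_sub, norm_neg]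
  exact mulVec_norm_le _ _

lemma norm_uOut_sub_le (w : Fin 2 → ℝ) (a b : Fin no → ℝ) :
    ‖d.uOut w a - d.uOut w b‖ ≤ ‖d.Co‖ * ‖a - b‖ := by
  rw [uOut, uOut, sub_sub_sub_cancel_left, ← mulVec_sub, norm_sub_rev a]
  exact mulVec_norm_le _ _

/-- The constant may grow with the number of steps and depend on `T` in any way, since the lemma
only serves existence. What matters is that the state at step `i` uses the outputs up to step `i`
alone. -/
lemma ctrlState_lipschitz (T : ℝ) (n : ℕ) : ∃ L : ℝ, 0 ≤ L ∧ ∀ i ≤ n, ∀ (y y' w : ℕ → Fin 2 → ℝ)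
    (m : ℝ), (∀ j ≤ i, ‖y j - y' j‖ ≤ m) →
      ‖(d.ctrlState T y w i).1 - (d.ctrlState T y' w i).1‖ ≤ L * m ∧
      ‖(d.ctrlState T y w i).2 - (d.ctrlState T y' w i).2‖ ≤ L * m := by
  induction n with
  | zero =>
    refine ⟨‖rightPinv d.Cm‖, norm_nonneg _, fun i hi y y' w m hm => ?_⟩
    obtain rfl := Nat.le_zero.1 hi
    have h0 := hm 0 le_rfl
    have hm0 : 0 ≤ m := (norm_nonneg _).trans h0
    refine ⟨?_, ?_⟩
    · change ‖rightPinv d.Cm *ᵥ y 0 - rightPinv d.Cm *ᵥ y' 0‖ ≤ _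
      rw [← mulVec_sub]
      exact (mulVec_norm_le _ _).trans (by gcongr)
    · change ‖(0 : Fin no → ℝ) - 0‖ ≤ _
      rw [sub_zero, norm_zero]; positivity
  | succ n ih =>
    obtain ⟨L, hL, h⟩ := ih
    obtain ⟨C, hC, hσ⟩ := d.sigmaHat_lipschitz T
    obtain ⟨s, hs⟩ : ∃ s : ℝ, s = C * (‖d.Cm‖ * L + 1) := ⟨_, rfl⟩
    have hs0 : 0 ≤ s := by rw [hs]; positivity
    obtain ⟨a, ha⟩ : ∃ a : ℝ, a = ‖NormedSpace.exp (T • d.Am)‖ * L +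
        ‖d.Am⁻¹ * (NormedSpace.exp (T • d.Am) - 1)‖ * (‖d.Bm‖ * (‖d.Co‖ * L) + s) := ⟨_, rfl⟩
    have ha0 : 0 ≤ a := by rw [ha]; positivity
    obtain ⟨b, hb⟩ : ∃ b : ℝ, b = ‖NormedSpace.exp (T • d.Ao)‖ * L +
        ‖d.Ao⁻¹ * (NormedSpace.exp (T • d.Ao) - 1)‖ * (‖d.Bo‖ *
          (‖NormedSpace.exp (-(T • d.Am))‖ * s)) := ⟨_, rfl⟩
    have hb0 : 0 ≤ b := by rw [hb]; positivity
    refine ⟨L + a + b, by positivity, fun i hi y y' w m hm => ?_⟩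
    have hm0 : 0 ≤ m := (norm_nonneg _).trans (hm 0 (Nat.zero_le _))
    rcases Nat.le_succ_iff.1 hi with hi | rfl
    · obtain ⟨h1, h2⟩ := h i hi y y' w m hm
      have : L * m ≤ (L + a + b) * m := by gcongr; linarith
      exact ⟨h1.trans this, h2.trans this⟩
    · obtain ⟨h1, h2⟩ := h n le_rfl y y' w m fun j hj => hm j (hj.trans (Nat.le_succ n))
      have h3 : ‖d.sigmaHat T (d.Cm *ᵥ (d.ctrlState T y w n).1 - y n) -
          d.sigmaHat T (d.Cm *ᵥ (d.ctrlState T y' w n).1 - y' n)‖ ≤ s * m := by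
        refine (hσ _ _).trans ?_
        rw [hs, mul_assoc]
        gcongr
        have e : d.Cm *ᵥ (d.ctrlState T y w n).1 - y n -
            (d.Cm *ᵥ (d.ctrlState T y' w n).1 - y' n) =
            d.Cm *ᵥ ((d.ctrlState T y w n).1 - (d.ctrlState T y' w n).1) - (y n - y' n) := by
          rw [mulVec_sub]; abel
        rw [e, add_mul, one_mul, mul_assoc]
        refine (norm_sub_le _ _).trans (add_le_add ((mulVec_norm_le _ _).trans ?_)
          (hm n (Nat.le_succ n)))
        gcongr
      have h4 : ‖d.uOut (w n) (d.ctrlState T y w n).2 - d.uOut (w n) (d.ctrlState T y' w n).2‖ ≤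
          ‖d.Co‖ * L * m := by
        refine (d.norm_uOut_sub_le _ _ _).trans ?_
        rw [mul_assoc]
        gcongr
      rw [ctrlState_succ, ctrlState_succ]
      refine ⟨?_, ?_⟩
      · rw [add_sub_add_comm, ← mulVec_sub, ← mulVec_sub, add_sub_add_comm, ← mulVec_sub]
        calc _ ≤ a * m := by
              rw [ha, add_mul, mul_assoc, mul_assoc]
              refine (norm_add_le _ _).trans (add_le_add
                ((mulVec_norm_le _ _).trans (by gcongr)) ((mulVec_norm_le _ _).trans ?_))
              gcongr
              rw [add_mul, mul_assoc]
              refine (norm_add_le _ _).trans (add_le_add ((mulVec_norm_le _ _).trans ?_) h3)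
              gcongr
          _ ≤ _ := by gcongr; linarith
      · rw [add_sub_add_comm, ← mulVec_sub, ← mulVec_sub, ← mulVec_sub, ← mulVec_sub]
        calc _ ≤ b * m := by
              rw [hb, add_mul, mul_assoc, mul_assoc, mul_assoc, mul_assoc]
              refine (norm_add_le _ _).trans (add_le_add
                ((mulVec_norm_le _ _).trans (by gcongr)) ((mulVec_norm_le _ _).trans ?_))
              gcongr
              refine (mulVec_norm_le _ _).trans ?_
              gcongr
              refine (mulVec_norm_le _ _).trans ?_
              gcongr
          _ ≤ _ := by gcongr; linarith

lemma exists_closedLoop (hℓ : 0 ≤ ℓ) (hf : IsUncertainty (fun _ => ℓ) L₀ f) (x₀ : Fin np → ℝ)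
    {T : ℝ} (hT : 0 < T) (ω : ℝ → Fin 2 → ℝ) : ∃ x, d.IsClosedLoop T f ω x₀ x := by
  refine d.exists_trajectory hℓ hf x₀ (d.uad T ω) (fun x _ => uad_mem T ω x) fun S => ?_
  obtain ⟨L, hL, h⟩ := d.ctrlState_lipschitz T ⌊S / T⌋₊
  refine ⟨‖d.Co‖ * (L * ‖d.Cp‖), by positivity, fun x y _ _ τ hτ m hm => ?_⟩
  have hm0 : 0 ≤ m := (norm_nonneg _).trans (hm 0 ⟨le_rfl, hτ.1⟩)
  have h1 := (h ⌊τ / T⌋₊ (Nat.floor_mono (by gcongr; exact hτ.2))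
    (fun i => d.Cp *ᵥ x ((i : ℝ) * T)) (fun i => d.Cp *ᵥ y ((i : ℝ) * T))
    (fun i => ω ((i : ℝ) * T)) (‖d.Cp‖ * m) fun j hj => by
      rw [← mulVec_sub]
      refine (mulVec_norm_le _ _).trans ?_
      gcongr
      refine hm _ ⟨by positivity, ?_⟩
      calc (j : ℝ) * T ≤ ⌊τ / T⌋₊ * T := by gcongr
        _ ≤ τ := floor_div_mul_le hT hτ.1).2
  calc _ ≤ ‖d.Co‖ * (L * (‖d.Cp‖ * m)) :=
        (d.norm_uOut_sub_le _ _ _).trans (mul_le_mul_of_nonneg_left h1 (norm_nonneg _))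
    _ = _ := by ring

variable {d}

lemma nu_sub_le (hℓ : 0 ≤ ℓ) {x y : ℝ → Fin np → ℝ} {τ m : ℝ}
    (hf : ‖f τ (x τ) - f τ (y τ)‖ ≤ ℓ * ‖x τ - y τ‖) (hτ : 0 ≤ τ) (hm : ‖x τ - y τ‖ ≤ m) :
    ‖(d.nu f x - d.nu f y) τ‖ ≤ (matInfNorm d.K + ℓ) * m := by
  have hK := matInfNorm_nonneg d.K
  rw [Pi.sub_apply, nu, nu, trunc_of_nonneg _ hτ, trunc_of_nonneg _ hτ, add_sub_add_comm,
    ← mulVec_sub, add_mul]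
  exact (norm_add_le _ _).trans (add_le_add ((mulVec_norm_le_matInfNorm _ _).trans (by gcongr))
    (hf.trans (by gcongr)))

/-- Along two functions the reference inputs differ by `-C H₁ M⁻¹ P` applied to the difference of
the `ν`'s; commands and initial states drop out. Stability of the operator makes this a causal
Lipschitz bound. -/
lemma Admissible.exists_reference (hd : d.Admissible) (hH₁ : MStable d.H₁) (hℓ : 0 ≤ ℓ)
    (hf : IsUncertainty (fun _ => ℓ) L₀ f) (x₀ : Fin np → ℝ) {ω : ℝ → Fin 2 → ℝ}
    (hω : trunc ω ∈ vsignals (Fin 2)) : ∃ x, d.IsReference f ω x₀ x := by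
  refine d.exists_trajectory hℓ hf x₀ (d.uref f ω x₀)
    (fun x hx => hd.uref_mem hω hf hx.continuousOn) fun S => ?_
  have hW := hd.H₁_proper.mul hd.MP_proper
  obtain ⟨c, hc, hb⟩ := tfAct_bound_of_stable hW (hH₁.mul hd.MP_stable)
  obtain ⟨c', hc', hb'⟩ := tfAct_bound_of_stable hd.filter_proper hd.filter_mstable
  have hK := matInfNorm_nonneg d.K
  refine ⟨c' * (c * (matInfNorm d.K + ℓ)), by positivity, fun x y hx hy τ hτ m hm => ?_⟩
  have hm0 : 0 ≤ m := (norm_nonneg _).trans (hm 0 ⟨le_rfl, hτ.1⟩)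
  have hνx := nu_mem (d := d) hf hx.continuousOn
  have hνy := nu_mem (d := d) hf hy.continuousOn
  have hKω := tfAct_mem (MProper.tfConst d.Kg) hω
  have e1 := congrFun (hd.uref_eq (x₀ := x₀) hω hf hx.continuousOn) τ
  have e2 := congrFun (hd.uref_eq (x₀ := x₀) hω hf hy.continuousOn) τ
  rw [trunc_of_nonneg _ hτ.1] at e1 e2
  have e3 : d.uref f ω x₀ x τ - d.uref f ω x₀ y τ =
      -tfAct d.Cf (tfAct (d.H₁ * (d.M⁻¹ * d.P)) (d.nu f x - d.nu f y)) τ := by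
    have e4 : tfAct (d.H₁ * (d.M⁻¹ * d.P)) (d.nu f x - d.nu f y) =
        d.matchedLoop (tfAct (tfConst d.Kg) (trunc ω)) (d.nu f x) x₀ -
          d.matchedLoop (tfAct (tfConst d.Kg) (trunc ω)) (d.nu f y) x₀ := by
      rw [tfAct_sub hW hνx hνy, matchedLoop, matchedLoop]; abel
    rw [e1, e2, e4, tfAct_sub hd.filter_proper (hd.matchedLoop_mem hKω hνx x₀)
      (hd.matchedLoop_mem hKω hνy x₀)]
    simp only [Pi.sub_apply]
    abel
  rw [e3, norm_neg]
  refine (hb' _ τ (c * ((matInfNorm d.K + ℓ) * m)) hτ.1 (by positivity) fun s hs =>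
    hb _ s ((matInfNorm d.K + ℓ) * m) hs.1 (by positivity) fun r hr =>
      nu_sub_le hℓ ?_ hr.1 (hm r ⟨hr.1, hr.2.trans hs.2⟩)).trans_eq (by ring)
  exact hf.lipschitz (‖x r‖ + ‖y r‖ + 1) (by positivity) r hr.1 _ _
    (by linarith [norm_nonneg (x r)]) (by linarith [norm_nonneg (y r)])

end L1Design

end Existence


/-! Uniform bounds -/

section Bounds

open Matrix
open scoped Matrix.Norms.Operator

lemma tfL1_ne_top {m n : ℕ} {G : Matrix (Fin m) (Fin n) (RatFunc ℝ)} (hG : MProper G)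
    (hs : MStable G) : tfL1 G ≠ ⊤ := by
  refine (iSup_lt_iff.2 ⟨∑ i, ∑ j, ratL1 (G i j), ?_, fun i =>
    Finset.single_le_sum (f := fun i => ∑ j, ratL1 (G i j)) (fun _ _ => zero_le)
      (Finset.mem_univ i)⟩).ne
  refine ENNReal.sum_lt_top.2 fun i _ => ENNReal.sum_lt_top.2 fun j _ => ?_
  exact (ratL1_ne_top (mem_properRing.1 (hG i j))
    (ratStable_iff.2 fun z hz => hs z hz i j)).lt_top

/-- The hypothesis is applied to the supremum `m` of `φ` (or `0`), giving `m ≤ α + β m`. The a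
priori bound `hb` only serves to make `m` finite. -/
lemma le_of_self_bound {φ : ℝ → ℝ} {t α β : ℝ} (hb : ∃ C, ∀ u ∈ Set.Icc 0 t, φ u ≤ C)
    (hα : 0 ≤ α) (hβ : 0 ≤ β) (hβ1 : β < 1)
    (h : ∀ m, 0 ≤ m → (∀ u ∈ Set.Icc 0 t, φ u ≤ m) → ∀ u ∈ Set.Icc 0 t, φ u ≤ α + β * m) :
    ∀ u ∈ Set.Icc 0 t, φ u ≤ α / (1 - β) := by
  obtain ⟨C, hC⟩ := hb
  set m := max (sSup (φ '' Set.Icc 0 t)) 0 with hm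
  have hm0 : 0 ≤ m := le_max_right _ _
  have h1 : ∀ u ∈ Set.Icc 0 t, φ u ≤ m := fun u hu =>
    (le_csSup ⟨C, Set.forall_mem_image.2 hC⟩ (Set.mem_image_of_mem φ hu)).trans (le_max_left _ _)
  have h2 := h m hm0 h1
  intro u hu
  refine (h1 u hu).trans ?_
  have h3 : m ≤ α + β * m := max_le
    (csSup_le ⟨φ u, Set.mem_image_of_mem φ hu⟩ (Set.forall_mem_image.2 h2)) (by positivity)
  rw [le_div_iff₀ (by linarith)]
  linarith

namespace L1Design.Admissible

variable {np k no : ℕ} {d : L1Design np k no} (hd : d.Admissible)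
include hd

lemma H₂_stable (hH₁ : MStable d.H₁) : MStable d.H₂ := by
  rw [H₂_eq]
  exact hd.H₀_stable.sub ((hd.H₀_stable.mul hd.filter_mstable).mul (hH₁.mul hd.Zm_stable))

lemma G_stable (hH₁ : MStable d.H₁) : MStable d.G := by
  rw [G_eq]
  exact hd.H₀_stable.sub ((hd.H₀_stable.mul hd.filter_mstable).mul (hH₁.mul hd.MP_stable))

lemma initial_strict : MStrict (d.R - d.H₅ * d.Hin) := d.R_strict.sub hd.H₅Hin_strict

lemma initial_stable (hH₁ : MStable d.H₁) : MStable (d.R - d.H₅ * d.Hin) := by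
  rw [H₅Hin_eq]
  exact hd.R_stable.sub ((hd.H₀_stable.mul hd.filter_mstable).mul (hH₁.mul hd.Vin_stable))

lemma matchedLoop_bound (hH₁ : MStable d.H₁) : ∃ c₁ c₂ c₃ : ℝ, 0 ≤ c₁ ∧ 0 ≤ c₂ ∧ 0 ≤ c₃ ∧
    (∀ (V : ℝ → Fin 2 → ℝ) (t c : ℝ), 0 ≤ t → 0 ≤ c → (∀ s ∈ Set.Icc 0 t, ‖V s‖ ≤ c) →
      ‖tfAct (d.H₁ * d.Zm) V t‖ ≤ c₁ * c) ∧
    (∀ (ν : ℝ → Fin 2 → ℝ) (t c : ℝ), 0 ≤ t → 0 ≤ c → (∀ s ∈ Set.Icc 0 t, ‖ν s‖ ≤ c) →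
      ‖tfAct (d.H₁ * (d.M⁻¹ * d.P)) ν t‖ ≤ c₂ * c) ∧
    ∀ (x₀ : Fin np → ℝ) (t : ℝ), 0 ≤ t → ‖tfImp (d.H₁ * d.Vin) x₀ t‖ ≤ c₃ * ‖x₀‖ := by
  have hI : MStrict (d.H₁ * d.Vin) := MStrict.mul_left hd.H₁_proper hd.Vin_strict
  obtain ⟨c₁, h₁, b₁⟩ := tfAct_bound_of_stable (hd.H₁_proper.mul hd.Zm_proper)
    (hH₁.mul hd.Zm_stable)
  obtain ⟨c₂, h₂, b₂⟩ := tfAct_bound_of_stable (hd.H₁_proper.mul hd.MP_proper)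
    (hH₁.mul hd.MP_stable)
  -- An impulse response is bounded as the step response of `s H₁ M⁻¹ H_in`, which is proper and
  -- stable.
  obtain ⟨c₃, h₃, b₃⟩ := tfAct_bound_of_stable (G := (RatFunc.X : RatFunc ℝ) • (d.H₁ * d.Vin)) hI
    (hH₁.mul hd.Vin_stable).smul_X
  refine ⟨c₁, c₂, c₃, h₁, h₂, h₃, b₁, b₂, fun x₀ t ht => ?_⟩
  rw [tfImp_eq_step hI]
  refine b₃ _ t ‖x₀‖ ht (norm_nonneg _) fun s hs => ?_
  rw [trunc_of_nonneg _ hs.1]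

/-- The contributions of the command and of the initial state. -/
lemma command_initial_bound (hH₁ : MStable d.H₁) {Ω : ℝ → Fin 2 → ℝ} {x₀ : Fin np → ℝ}
    {Mω ρ₀ : ℝ} (hMω : 0 ≤ Mω) (hΩ : ∀ t, 0 ≤ t → ‖Ω t‖ ≤ Mω) (hx₀ : ‖x₀‖ ≤ ρ₀) {t : ℝ}
    (ht : 0 ≤ t) :
    ‖tfAct (d.H₂ * tfConst d.Kg) Ω t‖ ≤ (tfL1 (d.H₂ * tfConst d.Kg)).toReal * Mω ∧
    ‖tfImp (d.R - d.H₅ * d.Hin) x₀ t‖ ≤ (tfL1 ((RatFunc.X : RatFunc ℝ) • d.R -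
      (RatFunc.X : RatFunc ℝ) • (d.H₅ * d.Hin))).toReal * ρ₀ := by
  have h2 : MProper (d.H₂ * tfConst d.Kg) := hd.H₂_proper.mul (MProper.tfConst _)
  have h3 := (hd.initial_stable hH₁).smul_X
  refine ⟨tfAct_bound h2 (tfL1_ne_top h2 ((hd.H₂_stable hH₁).mul (MStable.tfConst _))) _ ht hMω
    fun s hs => hΩ s hs.1, ?_⟩
  rw [tfImp_eq_step hd.initial_strict, ← smul_sub]
  refine tfAct_bound hd.initial_strict (tfL1_ne_top hd.initial_strict h3) _ ht
    ((norm_nonneg _).trans hx₀) fun s hs => ?_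
  rwa [trunc_of_nonneg _ hs.1]

/-- The deviation of the sampled control signal from the ideal one is an additional input which
is small compared to the matched disturbance. -/
lemma closedLoop_input (hCM : MProper (d.Cf * d.M⁻¹)) : ∃ T₀ κ : ℝ, 0 < T₀ ∧ 0 ≤ κ ∧
    ∀ (T h : ℝ), 0 < T → T < T₀ → ∀ {F : ℝ → ℝ} {L₀ Mω : ℝ} {f : ℝ → (Fin np → ℝ) → Fin 2 → ℝ},
    IsUncertainty F L₀ f → ∀ {ω : ℝ → Fin 2 → ℝ}, IsCommand Mω T h ω → ∀ {x₀ : Fin np → ℝ}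
    {x : ℝ → Fin np → ℝ}, d.IsClosedLoop T f ω x₀ x → ∃ e ∈ vsignals (Fin 2),
      trunc (d.uad T ω x) = tfAct (tfConst d.Kg) (trunc ω) + e -
        tfAct d.Cf (d.matchedLoop (tfAct (tfConst d.Kg) (trunc ω) + e) (d.nu f x) x₀) ∧
      ∀ t, 0 ≤ t → ∀ s, 0 ≤ s → (∀ u ∈ Set.Icc 0 t,
        ‖d.matchedLoop (tfAct (tfConst d.Kg) (trunc ω) + e) (d.nu f x) x₀ u‖ ≤ s) →
        ‖e t‖ ≤ ‖d.Kg‖ * h + κ * T * s := by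
  obtain ⟨T₀, κ, hT₀, hκ, herr⟩ := hd.control_error hCM
  refine ⟨T₀, κ, hT₀, hκ, ?_⟩
  intro T h hT hTT F L₀ Mω f hf ω hω x₀ x hx
  have hU := uad_mem (d := d) T ω x
  have hν := nu_mem (d := d) hf hx.continuousOn
  have hΩ := tfAct_mem (MProper.tfConst d.Kg) hω.trunc_mem
  have hσ := hd.matched_mem hU hν x₀
  have hX := hx.state_eq hf hU
  -- `V` is chosen so that `U = V - C σ` holds by definition. Its deviation `e` from `K_g ω` is then
  -- the hold error of the command together with the error estimated in `control_error`.
  obtain ⟨V, hVdef⟩ : ∃ V, V = trunc (d.uad T ω x) +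
      tfAct d.Cf (d.matched (trunc (d.uad T ω x)) (d.nu f x) x₀) := ⟨_, rfl⟩
  have hV : V ∈ vsignals (Fin 2) := hVdef ▸ (vsignals _).add_mem hU (tfAct_mem hd.filter_proper hσ)
  have hUV : trunc (d.uad T ω x) = V -
      tfAct d.Cf (d.matched (trunc (d.uad T ω x)) (d.nu f x) x₀) := by rw [hVdef]; abel
  have hm := hd.matched_eq_matchedLoop hU hV hν x₀ hUV
  refine ⟨V - tfAct (tfConst d.Kg) (trunc ω), (vsignals _).sub_mem hV hΩ, ?_, ?_⟩
  · rw [add_sub_cancel, ← hm]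
    exact hUV
  intro t ht s hs hb
  rw [add_sub_cancel, ← hm] at hb
  have h0 : d.Cp *ᵥ x ((0 : ℕ) * T) = d.Cp *ᵥ x₀ := by rw [Nat.cast_zero, zero_mul, hx.initial]
  have h1 := herr T hT hTT (fun i => d.Cp *ᵥ x ((i : ℝ) * T)) (fun i => ω ((i : ℝ) * T)) _ hσ _ hU
    (fun t ht => by rw [trunc_of_nonneg _ ht]; rfl) (fun i => by
      have := hd.output_eq hU hν x₀ hX ((i : ℝ) * T)
      rw [trunc_of_nonneg _ (by positivity)] at this
      rw [h0]
      exact this) t ht s hs hb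
  have e1 : (V - tfAct (tfConst d.Kg) (trunc ω)) t =
      -(d.Kg *ᵥ (ω t - ω ((⌊t / T⌋₊ : ℝ) * T))) -
      (d.Co *ᵥ (d.ctrlState T (fun i => d.Cp *ᵥ x ((i : ℝ) * T)) (fun i => ω ((i : ℝ) * T))
        ⌊t / T⌋₊).2 - tfAct d.Cf (d.matched (trunc (d.uad T ω x)) (d.nu f x) x₀) t) := by
    rw [hVdef, Pi.sub_apply, Pi.add_apply, tfAct_tfConst_apply, trunc_of_nonneg (d.uad T ω x) ht,
      trunc_of_nonneg ω ht, uad, uOut, mulVec_sub]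
    abel
  rw [e1]
  refine (norm_sub_le _ _).trans (add_le_add ?_ h1)
  rw [norm_neg]
  exact (mulVec_norm_le _ _).trans (by gcongr; exact hω.hold t ht)

end L1Design.Admissible

end Bounds


/-! Performance bounds -/

section Performance

open Matrix
open scoped Matrix.Norms.Operator

namespace L1Design.Admissible

variable {np k no : ℕ} {d : L1Design np k no} (hd : d.Admissible)
include hd

/-- Trajectories stay in a ball and the closed loop follows the reference system, provided that
the uncertainty is Lipschitz on the ball and that the norm condition holds. -/
lemma performance (hH₁ : MStable d.H₁) (hCM : MProper (d.Cf * d.M⁻¹))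
    {ℓ L₀ Mω ρ₀ ρr γ₁ : ℝ} (hℓ : 0 ≤ ℓ) (hL₀ : 0 ≤ L₀) (hMω : 0 ≤ Mω) (hρ₀ : 0 < ρ₀)
    (hρr : ρ₀ < ρr) (hγ₁ : 0 < γ₁)
    (hcond : (tfL1 d.G).toReal * ((ρr + γ₁) * (ℓ + matInfNorm d.K) + L₀) +
      (tfL1 ((RatFunc.X : RatFunc ℝ) • d.R - (RatFunc.X : RatFunc ℝ) • (d.H₅ * d.Hin))).toReal * ρ₀ +
      (tfL1 (d.H₂ * tfConst d.Kg)).toReal * Mω < ρr) :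
    ∃ T₀ C : ℝ, 0 < T₀ ∧ 0 ≤ C ∧ ∀ (T h : ℝ), 0 < T → T < T₀ → 0 ≤ h → h < T₀ →
    ∀ (F : ℝ → ℝ) (f : ℝ → (Fin np → ℝ) → Fin 2 → ℝ), IsUncertainty F L₀ f →
    (∀ t, 0 ≤ t → ∀ z₁ z₂ : Fin np → ℝ, ‖z₁‖ ≤ ρr → ‖z₂‖ ≤ ρr →
      ‖f t z₂ - f t z₁‖ ≤ ℓ * ‖z₂ - z₁‖) →
    ∀ ω : ℝ → Fin 2 → ℝ, IsCommand Mω T h ω → ∀ x₀ : Fin np → ℝ, ‖x₀‖ < ρ₀ →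
      (∀ xref, d.IsReference f ω x₀ xref → ∀ t, 0 ≤ t → ‖xref t‖ < ρr) ∧
      (∀ x, d.IsClosedLoop T f ω x₀ x → ∀ t, 0 ≤ t → ‖x t‖ < ρr) ∧
      ∀ xref x, d.IsReference f ω x₀ xref → d.IsClosedLoop T f ω x₀ x → ∀ t, 0 ≤ t →
        ‖xref t - x t‖ ≤ C * (T + h) ∧
        ‖d.uref f ω x₀ xref t - d.uad T ω x t‖ ≤ C * (T + h) := by
  obtain ⟨T₁, κ, hT₁, hκ, hloop⟩ := hd.closedLoop_input hCM
  obtain ⟨c₁, c₂, c₃, hc₁, hc₂, hc₃, hb₁, hb₂, hb₃⟩ := hd.matchedLoop_bound hH₁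
  obtain ⟨c₄, hc₄, hb₄⟩ := tfAct_bound_of_stable hd.H₂_proper (hd.H₂_stable hH₁)
  obtain ⟨c₅, hc₅, hb₅⟩ := tfAct_bound_of_stable hd.filter_proper hd.filter_mstable
  have hci := fun (Ω : ℝ → Fin 2 → ℝ) (x₀ : Fin np → ℝ) =>
    hd.command_initial_bound hH₁ (Ω := Ω) (x₀ := x₀) (ρ₀ := ρ₀) hMω
  have hGb := fun (w : ℝ → Fin 2 → ℝ) (t c : ℝ) => tfAct_bound hd.G_proper
    (tfL1_ne_top hd.G_proper (hd.G_stable hH₁)) w (t := t) (c := c)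
  obtain ⟨g, hg⟩ : ∃ g, g = (tfL1 d.G).toReal := ⟨_, rfl⟩
  obtain ⟨r₁, hr₁⟩ : ∃ r, r = (tfL1 ((RatFunc.X : RatFunc ℝ) • d.R -
    (RatFunc.X : RatFunc ℝ) • (d.H₅ * d.Hin))).toReal := ⟨_, rfl⟩
  obtain ⟨r₂, hr₂⟩ : ∃ r, r = (tfL1 (d.H₂ * tfConst d.Kg)).toReal := ⟨_, rfl⟩
  rw [← hg, ← hr₁, ← hr₂] at hcond
  rw [← hr₁, ← hr₂] at hci
  rw [← hg] at hGb
  have hg0 : 0 ≤ g := hg ▸ ENNReal.toReal_nonneg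
  have hr₁0 : 0 ≤ r₁ := hr₁ ▸ ENNReal.toReal_nonneg
  have hr₂0 : 0 ≤ r₂ := hr₂ ▸ ENNReal.toReal_nonneg
  obtain ⟨L, hL⟩ : ∃ L, L = matInfNorm d.K + ℓ := ⟨_, rfl⟩
  have hK0 := matInfNorm_nonneg d.K
  have hL0 : 0 ≤ L := by rw [hL]; positivity
  rw [add_comm ℓ, ← hL] at hcond
  obtain ⟨B, hB⟩ : ∃ B, B = (ρr + γ₁) * L + L₀ := ⟨_, rfl⟩
  rw [← hB] at hcond
  have hρr0 : 0 < ρr := hρ₀.trans hρr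
  have hB0 : 0 ≤ B := by rw [hB]; positivity
  -- Otherwise `ρr + γ₁ ≤ g (ρr + γ₁) L ≤ g B`, contrary to the norm condition, which keeps `g B`
  -- below `ρr`.
  have hgL : g * L < 1 := by
    by_contra! hcon
    have h1 : (ρr + γ₁) * (g * L) ≤ g * B := by
      rw [hB]; linarith [mul_nonneg hg0 hL₀, mul_left_comm g (ρr + γ₁) L]
    have h2 : (ρr + γ₁) * 1 ≤ (ρr + γ₁) * (g * L) := by gcongr
    linarith [mul_nonneg hr₁0 hρ₀.le, mul_nonneg hr₂0 hMω]
  have hgL0 : 0 ≤ g * L := mul_nonneg hg0 hL0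
  -- `μ` is the slack in the norm condition; the contribution of `e` to the state has to fit into
  -- it.
  obtain ⟨μ, hμ⟩ : ∃ μ, μ = ρr - (g * B + r₁ * ρ₀ + r₂ * Mω) := ⟨_, rfl⟩
  have hμ0 : 0 < μ := by rw [hμ]; linarith
  obtain ⟨kg, hkg⟩ : ∃ a, a = ‖d.Kg‖ := ⟨_, rfl⟩
  have hkg0 : 0 ≤ kg := hkg ▸ norm_nonneg _
  obtain ⟨a, ha⟩ : ∃ a, a = c₁ * (kg * Mω) + c₂ * B + c₃ * ρ₀ := ⟨_, rfl⟩
  have ha0 : 0 ≤ a := by rw [ha]; positivity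
  obtain ⟨q, hq⟩ : ∃ q, q = 2 * (κ * a + kg) := ⟨_, rfl⟩
  have hq0 : 0 ≤ q := by rw [hq]; positivity
  obtain ⟨D, hD⟩ : ∃ D, D = c₄ * q / (1 - g * L) := ⟨_, rfl⟩
  have hD0 : 0 ≤ D := by rw [hD]; exact div_nonneg (by positivity) (by linarith)
  -- The second bound gives `κ T c₁ ≤ 1/2`, which accounts for the factor `2` in `q`. The third,
  -- imposed on `T` and on `h`, gives `c₄ q (T + h) < μ`.
  refine ⟨min T₁ (min (1 / (2 * (κ * c₁) + 1)) (μ / (2 * (c₄ * q) + 1))),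
    D + (c₅ * (c₁ * q + c₂ * (L * D)) + q), by positivity, by positivity, ?_⟩
  intro T h hT hTT hh hhT F f hf hloc ω hω x₀ hx₀
  obtain ⟨hTT₁, hTκ, hTμ⟩ : T < T₁ ∧ T < 1 / (2 * (κ * c₁) + 1) ∧ T < μ / (2 * (c₄ * q) + 1) := by
    simpa only [lt_min_iff] using hTT
  have hhμ : h < μ / (2 * (c₄ * q) + 1) := (lt_min_iff.1 (lt_min_iff.1 hhT).2).2
  rw [lt_div_iff₀ (by positivity)] at hTκ hTμ hhμ
  have hκT : κ * T * c₁ ≤ 1 / 2 := by linarith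
  have hε0 : 0 ≤ q * (T + h) := by positivity
  have hsmall : c₄ * (q * (T + h)) < μ := by linarith
  have hΩ := tfAct_mem (MProper.tfConst d.Kg) hω.trunc_mem
  have hΩb : ∀ t, 0 ≤ t → ‖trunc ω t‖ ≤ Mω := fun t ht => by
    rw [trunc_of_nonneg _ ht]; exact hω.bound t ht
  have hKΩb : ∀ t, 0 ≤ t → ‖tfAct (tfConst d.Kg) (trunc ω) t‖ ≤ kg * Mω := fun t ht => by
    rw [tfAct_tfConst_apply, hkg]
    exact (mulVec_norm_le _ _).trans (by gcongr; exact hΩb t ht)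
  -- the disturbance is bounded as long as the trajectory stays in the ball
  have hνb : ∀ (x : ℝ → Fin np → ℝ) (s : ℝ), 0 ≤ s → ‖x s‖ ≤ ρr → ‖d.nu f x s‖ ≤ B := by
    intro x s hs hxs
    have h1 := hloc s hs 0 (x s) (by rw [norm_zero]; exact hρr0.le) hxs
    rw [sub_zero] at h1
    have h2 : ‖f s (x s)‖ ≤ ℓ * ‖x s‖ + L₀ := by
      calc ‖f s (x s)‖ = ‖(f s (x s) - f s 0) + f s 0‖ := by rw [sub_add_cancel]
        _ ≤ _ := (norm_add_le _ _).trans (add_le_add h1 (hf.bound s hs))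
    rw [nu, trunc_of_nonneg _ hs]
    calc _ ≤ matInfNorm d.K * ‖x s‖ + (ℓ * ‖x s‖ + L₀) :=
          (norm_add_le _ _).trans (add_le_add (mulVec_norm_le_matInfNorm _ _) h2)
      _ = L * ‖x s‖ + L₀ := by rw [hL]; ring
      _ ≤ L * (ρr + γ₁) + L₀ := by gcongr; linarith
      _ = B := by rw [hB]; ring
  have hνd : ∀ (x y : ℝ → Fin np → ℝ) (s m : ℝ), 0 ≤ s → ‖x s‖ ≤ ρr → ‖y s‖ ≤ ρr →
      ‖x s - y s‖ ≤ m → ‖(d.nu f x - d.nu f y) s‖ ≤ L * m := by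
    intro x y s m hs hxs hys hm
    rw [hL]
    exact nu_sub_le hℓ (hloc s hs _ _ hys hxs) hs hm
  -- the state for an additional input `e`
  have hstate : ∀ (x : ℝ → Fin np → ℝ) (u e : ℝ → Fin 2 → ℝ), e ∈ vsignals (Fin 2) →
      d.IsTrajectory f x₀ u x →
      trunc u = tfAct (tfConst d.Kg) (trunc ω) + e -
        tfAct d.Cf (d.matchedLoop (tfAct (tfConst d.Kg) (trunc ω) + e) (d.nu f x) x₀) →
      trunc x = tfAct (d.H₂ * tfConst d.Kg) (trunc ω) + tfAct d.H₂ e + tfAct d.G (d.nu f x) +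
        tfImp (d.R - d.H₅ * d.Hin) x₀ := by
    intro x u e he hx hu
    have hV := (vsignals _).add_mem hΩ he
    have hν := nu_mem (d := d) hf hx.continuousOn
    have hum : trunc u ∈ vsignals (Fin 2) := hu ▸ (vsignals _).sub_mem hV
      (tfAct_mem hd.filter_proper (hd.matchedLoop_mem hV hν x₀))
    rw [hd.state_eq hV hν x₀ hu (hx.state_eq hf hum), tfAct_add hd.H₂_proper hΩ he,
      tfAct_mul hd.H₂_proper (MProper.tfConst _) hω.trunc_mem]
  have hball : ∀ (x : ℝ → Fin np → ℝ) (u e : ℝ → Fin 2 → ℝ), e ∈ vsignals (Fin 2) →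
      d.IsTrajectory f x₀ u x →
      trunc u = tfAct (tfConst d.Kg) (trunc ω) + e -
        tfAct d.Cf (d.matchedLoop (tfAct (tfConst d.Kg) (trunc ω) + e) (d.nu f x) x₀) →
      (∀ t, 0 ≤ t → (∀ s ∈ Set.Icc 0 t, ‖x s‖ ≤ ρr) → ∀ s ∈ Set.Icc 0 t, ‖e s‖ ≤ q * (T + h)) →
      ∀ t, 0 ≤ t → ‖x t‖ < ρr := by
    intro x u e he hx hu heb
    -- While the trajectory is in the closed ball, the four contributions to the state add up to
    -- less than `ρr`, so the boundary is never reached.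
    refine norm_lt_of_continuation hx.continuousOn (by rw [hx.initial]; exact hx₀.trans hρr)
      fun t ht hxt => ?_
    have h1 := congrFun (hstate x u e he hx hu) t
    rw [trunc_of_nonneg _ ht] at h1
    obtain ⟨h2, h3⟩ := hci (trunc ω) x₀ hΩb hx₀.le ht
    have h4 := hb₄ e t _ ht hε0 (heb t ht hxt)
    have h5 := hGb (d.nu f x) t B ht hB0 fun s hs => hνb x s hs.1 (hxt s hs)
    rw [h1]
    calc _ ≤ r₂ * Mω + c₄ * (q * (T + h)) + g * B + r₁ * ρ₀ :=
          (norm_add_le _ _).trans (add_le_add ((norm_add_le _ _).trans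
            (add_le_add ((norm_add_le _ _).trans (add_le_add h2 h4)) h5)) h3)
      _ < ρr := by linarith
  have hmatch : ∀ (x : ℝ → Fin np → ℝ) (e : ℝ → Fin 2 → ℝ) (t m : ℝ), 0 ≤ m →
      (∀ s ∈ Set.Icc 0 t, ‖x s‖ ≤ ρr) → (∀ s ∈ Set.Icc 0 t, ‖e s‖ ≤ m) → ∀ s ∈ Set.Icc 0 t,
      ‖d.matchedLoop (tfAct (tfConst d.Kg) (trunc ω) + e) (d.nu f x) x₀ s‖ ≤ a + c₁ * m := by
    intro x e t m hm hx he s hs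
    have h1 := hb₁ (tfAct (tfConst d.Kg) (trunc ω) + e) s (kg * Mω + m) hs.1 (by positivity)
      fun r hr => (norm_add_le _ _).trans (add_le_add (hKΩb r hr.1) (he r ⟨hr.1, hr.2.trans hs.2⟩))
    have h2 := hb₂ (d.nu f x) s B hs.1 hB0 fun r hr => hνb x r hr.1 (hx r ⟨hr.1, hr.2.trans hs.2⟩)
    have h3 := (hb₃ x₀ s hs.1).trans (mul_le_mul_of_nonneg_left hx₀.le hc₃)
    calc _ ≤ c₁ * (kg * Mω + m) + c₂ * B + c₃ * ρ₀ :=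
          (norm_add_le _ _).trans (add_le_add ((norm_add_le _ _).trans (add_le_add h1 h2)) h3)
      _ = a + c₁ * m := by rw [ha]; ring
  have hebound : ∀ (x : ℝ → Fin np → ℝ) (e : ℝ → Fin 2 → ℝ), e ∈ vsignals (Fin 2) →
      (∀ t, 0 ≤ t → ∀ s, 0 ≤ s → (∀ u ∈ Set.Icc 0 t,
        ‖d.matchedLoop (tfAct (tfConst d.Kg) (trunc ω) + e) (d.nu f x) x₀ u‖ ≤ s) →
        ‖e t‖ ≤ kg * h + κ * T * s) →
      ∀ t, 0 ≤ t → (∀ s ∈ Set.Icc 0 t, ‖x s‖ ≤ ρr) → ∀ s ∈ Set.Icc 0 t, ‖e s‖ ≤ q * (T + h) := by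
    intro x e he hes t ht hxt s hs
    obtain ⟨C, _, hC⟩ := vsignals_bound he t
    -- `e` is bounded through the matched disturbance, which itself contains `e`. This inner loop
    -- has gain `κ T c₁ ≤ 1/2`.
    have h1 := le_of_self_bound (φ := fun s => ‖e s‖) (t := t) (α := kg * h + κ * T * a)
      (β := κ * T * c₁) ⟨C, fun u hu => hC u hu.2⟩ (by positivity) (by positivity) (by linarith)
      (fun m hm hem u hu => by
        refine (hes u hu.1 (a + c₁ * m) (by positivity) fun v hv =>
          hmatch x e t m hm hxt hem v ⟨hv.1, hv.2.trans hu.2⟩).trans_eq (by ring)) s hs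
    refine h1.trans ?_
    calc (kg * h + κ * T * a) / (1 - κ * T * c₁) ≤ (kg * h + κ * T * a) / (1 / 2) := by
          gcongr; linarith
      _ = q * (T + h) - 2 * (kg * T + κ * a * h) := by rw [hq]; ring
      _ ≤ q * (T + h) := sub_le_self _ (by positivity)
  have href : ∀ xref, d.IsReference f ω x₀ xref → trunc (d.uref f ω x₀ xref) =
      tfAct (tfConst d.Kg) (trunc ω) + 0 - tfAct d.Cf
        (d.matchedLoop (tfAct (tfConst d.Kg) (trunc ω) + 0) (d.nu f xref) x₀) := fun xref hxref => by
    rw [add_zero]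
    exact hd.uref_eq hω.trunc_mem hf (IsTrajectory.continuousOn hxref)
  have hrefb : ∀ xref, d.IsReference f ω x₀ xref → ∀ t, 0 ≤ t → ‖xref t‖ < ρr :=
    fun xref hxref => hball xref _ 0 (vsignals _).zero_mem hxref (href xref hxref)
      fun t _ _ s _ => by rw [Pi.zero_apply, norm_zero]; exact hε0
  have hclb : ∀ x, d.IsClosedLoop T f ω x₀ x → ∀ t, 0 ≤ t → ‖x t‖ < ρr := fun x hx => by
    obtain ⟨e, he, hu, hes⟩ := hloop T h hT hTT₁ hf hω hx
    rw [← hkg] at hes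
    exact hball x _ e he hx hu (hebound x e he hes)
  refine ⟨hrefb, hclb, fun xref x hxref hx => ?_⟩
  obtain ⟨e, he, hu, hes⟩ := hloop T h hT hTT₁ hf hω hx
  rw [← hkg] at hes
  have hrb := hrefb xref hxref
  have hxb := hclb x hx
  have heb : ∀ t, 0 ≤ t → ‖e t‖ ≤ q * (T + h) := fun t ht =>
    hebound x e he hes t ht (fun s hs => (hxb s hs.1).le) t ⟨ht, le_rfl⟩
  have hνr := nu_mem (d := d) hf (IsTrajectory.continuousOn hxref)
  have hνx := nu_mem (d := d) hf (IsTrajectory.continuousOn hx)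
  have hXr := hstate xref _ 0 (vsignals _).zero_mem hxref (href xref hxref)
  have hXx := hstate x _ e he hx hu
  -- Command and initial state enter both state formulas in the same way and cancel.
  have hdiff : trunc xref - trunc x = tfAct d.G (d.nu f xref - d.nu f x) - tfAct d.H₂ e := by
    have h0 : tfAct d.H₂ (0 : ℝ → Fin 2 → ℝ) = 0 := by
      have := tfAct_smul d.H₂ 0 (0 : ℝ → Fin 2 → ℝ)
      simpa using this
    rw [hXr, hXx, tfAct_sub hd.G_proper hνr hνx, h0]
    abel
  have hxd : ∀ t, 0 ≤ t → ‖xref t - x t‖ ≤ D * (T + h) := by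
    intro t ht
    -- Small gain: the disturbance difference is at most `L` times the state difference, and `g L <
    -- 1`. The a priori bound is that both trajectories stay in the ball.
    have h1 := le_of_self_bound (φ := fun s => ‖xref s - x s‖) (t := t) (α := c₄ * (q * (T + h)))
      (β := g * L) ⟨ρr + ρr, fun u hu => (norm_sub_le _ _).trans
        (add_le_add (hrb u hu.1).le (hxb u hu.1).le)⟩ (by positivity) hgL0 hgL
      (fun m hm hmb u hu => by
        have h2 := congrFun hdiff u
        rw [Pi.sub_apply, Pi.sub_apply, trunc_of_nonneg _ hu.1, trunc_of_nonneg _ hu.1] at h2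
        have h3 := hGb (d.nu f xref - d.nu f x) u (L * m) hu.1 (by positivity) fun s hs =>
          hνd xref x s m hs.1 (hrb s hs.1).le (hxb s hs.1).le (hmb s ⟨hs.1, hs.2.trans hu.2⟩)
        have h4 := hb₄ e u _ hu.1 hε0 fun s hs => heb s hs.1
        rw [h2]
        refine (norm_sub_le _ _).trans ((add_le_add h3 h4).trans_eq (by ring))) t ⟨ht, le_rfl⟩
    refine h1.trans_eq ?_
    rw [hD]; ring
  intro t ht
  refine ⟨(hxd t ht).trans (by gcongr; exact le_add_of_nonneg_right (by positivity)), ?_⟩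
  have hV := (vsignals _).add_mem hΩ he
  have hZp := hd.H₁_proper.mul hd.Zm_proper
  have hWp := hd.H₁_proper.mul hd.MP_proper
  have hσr := hd.matchedLoop_mem hΩ hνr x₀
  have hσx := hd.matchedLoop_mem hV hνx x₀
  have hσd : d.matchedLoop (tfAct (tfConst d.Kg) (trunc ω)) (d.nu f xref) x₀ -
      d.matchedLoop (tfAct (tfConst d.Kg) (trunc ω) + e) (d.nu f x) x₀ =
      tfAct (d.H₁ * (d.M⁻¹ * d.P)) (d.nu f xref - d.nu f x) - tfAct (d.H₁ * d.Zm) e := by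
    rw [matchedLoop, matchedLoop, tfAct_add hZp hΩ he, tfAct_sub hWp hνr hνx]
    abel
  have hud : trunc (d.uref f ω x₀ xref) - trunc (d.uad T ω x) = -tfAct d.Cf
      (tfAct (d.H₁ * (d.M⁻¹ * d.P)) (d.nu f xref - d.nu f x) - tfAct (d.H₁ * d.Zm) e) - e := by
    rw [href xref hxref, hu, add_zero, ← hσd, tfAct_sub hd.filter_proper hσr hσx]
    abel
  have h1 := congrFun hud t
  rw [Pi.sub_apply, trunc_of_nonneg _ ht, trunc_of_nonneg _ ht] at h1
  rw [h1]
  have h2 := hb₅ (tfAct (d.H₁ * (d.M⁻¹ * d.P)) (d.nu f xref - d.nu f x) - tfAct (d.H₁ * d.Zm) e)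
    t (c₂ * (L * (D * (T + h))) + c₁ * (q * (T + h))) ht (by positivity) fun s hs =>
      (norm_sub_le _ _).trans (add_le_add
        (hb₂ _ s _ hs.1 (by positivity) fun r hr =>
          hνd xref x r _ hr.1 (hrb r hr.1).le (hxb r hr.1).le (hxd r hr.1))
        (hb₁ e s _ hs.1 hε0 fun r hr => heb r hr.1))
  calc _ ≤ c₅ * (c₂ * (L * (D * (T + h))) + c₁ * (q * (T + h))) + q * (T + h) := by
        refine (norm_sub_le _ _).trans (add_le_add ?_ (heb t ht))
        rw [Pi.neg_apply, norm_neg]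
        exact h2
    _ = (c₅ * (c₁ * q + c₂ * (L * D)) + q) * (T + h) := by ring
    _ ≤ _ := mul_le_mul_of_nonneg_right (by linarith) (by positivity)

end L1Design.Admissible

end Performance


/-! Truncated uncertainties and the performance theorem -/

section Truncation

/-- The componentwise projection onto `[-r, r]`. -/
def clamp {n : Type*} (r : ℝ) (z : n → ℝ) : n → ℝ := fun i => max (-r) (min (z i) r)

variable {n : Type*} [Fintype n] {r : ℝ}

lemma norm_clamp_le (hr : 0 ≤ r) (z : n → ℝ) : ‖clamp r z‖ ≤ r := by
  refine (pi_norm_le_iff_of_nonneg hr).2 fun i => ?_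
  rw [Real.norm_eq_abs, abs_le]
  exact ⟨le_max_left _ _, max_le (by linarith) (min_le_right _ _)⟩

lemma clamp_eq_self {z : n → ℝ} (hz : ‖z‖ ≤ r) : clamp r z = z := by
  ext i
  have h := abs_le.1 ((norm_le_pi_norm z i).trans hz)
  rw [clamp, min_eq_left h.2, max_eq_right h.1]

lemma norm_clamp_sub_le (a b : n → ℝ) : ‖clamp r a - clamp r b‖ ≤ ‖a - b‖ := by
  refine (pi_norm_le_iff_of_nonneg (norm_nonneg _)).2 fun i => ?_
  refine le_trans ?_ (norm_le_pi_norm (a - b) i)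
  rw [Pi.sub_apply, Pi.sub_apply, Real.norm_eq_abs, Real.norm_eq_abs]
  refine (abs_max_sub_max_le_max _ _ _ _).trans ?_
  rw [sub_self, abs_zero]
  refine max_le (abs_nonneg _) ((abs_min_sub_min_le_max _ _ _ _).trans ?_)
  rw [sub_self, abs_zero]
  exact max_le le_rfl (abs_nonneg _)

/-- In positive dimension a ball contains two distinct points, so a negative Lipschitz constant is
impossible. In dimension zero `F` may be negative, hence the index `i`. -/
lemma IsUncertainty.nonneg {np : ℕ} {F : ℝ → ℝ} {L₀ ρ : ℝ} {f : ℝ → (Fin np → ℝ) → Fin 2 → ℝ}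
    (hf : IsUncertainty F L₀ f) (hρ : 0 < ρ) (i : Fin np) : 0 ≤ F ρ := by
  by_contra! h0
  have hc : ‖(fun _ : Fin np => ρ / 2)‖ = ρ / 2 := by
    have : Nonempty (Fin np) := ⟨i⟩
    rw [pi_norm_const, Real.norm_eq_abs, abs_of_nonneg (by linarith)]
  have h1 := hf.lipschitz ρ hρ 0 le_rfl 0 (fun _ => ρ / 2) (by rw [norm_zero]; exact hρ)
    (by rw [hc]; linarith)
  rw [sub_zero, hc] at h1
  have h2 : F ρ * (ρ / 2) < 0 := mul_neg_of_neg_of_pos h0 (by linarith)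
  linarith [norm_nonneg (f 0 (fun _ => ρ / 2) - f 0 0)]

/-- The projection is nonexpansive for the maximum norm, and its range lies in the open ball of
radius `ρ`, so a single local constant becomes global. -/
lemma IsUncertainty.clamp {np : ℕ} {F : ℝ → ℝ} {L₀ ρ ℓ : ℝ} {f : ℝ → (Fin np → ℝ) → Fin 2 → ℝ}
    (hf : IsUncertainty F L₀ f) (hr : 0 ≤ r) (hρ : r < ρ) (hℓ : F ρ ≤ ℓ) :
    IsUncertainty (fun _ => ℓ) L₀ fun t z => f t (clamp r z) where
  measurable x := hf.measurable _
  lipschitz δ _ t ht x₁ x₂ _ _ := by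
    refine (hf.lipschitz ρ (hr.trans_lt hρ) t ht _ _ ((norm_clamp_le hr _).trans_lt hρ)
      ((norm_clamp_le hr _).trans_lt hρ)).trans ?_
    rcases Nat.eq_zero_or_pos np with rfl | hnp
    · rw [Subsingleton.elim x₁ x₂, sub_self, sub_self, norm_zero, mul_zero, mul_zero]
    · have h0 := hf.nonneg (hr.trans_lt hρ) ⟨0, hnp⟩
      exact mul_le_mul hℓ (norm_clamp_sub_le _ _) (norm_nonneg _) (h0.trans hℓ)
  bound t ht := by
    rw [clamp_eq_self (by rw [norm_zero]; exact hr)]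
    exact hf.bound t ht

end Truncation

/-! ### Changing the uncertainty away from a trajectory. -/

lemma tfApply_congr {m n : Type*} [Fintype m] [Fintype n] (G : Matrix m n (RatFunc ℝ))
    {v w : ℝ → n → ℝ} {t : ℝ} (ht : 0 ≤ t) (h : ∀ s ∈ Set.Icc 0 t, v s = w s) :
    tfApply G v t = tfApply G w t := by
  rw [tfApply, tfApply, h t ⟨ht, le_rfl⟩]
  congr 1
  refine intervalIntegral.integral_congr fun s hs => ?_
  rw [Set.uIcc_of_le ht] at hs
  rw [h s hs]

lemma signalLinf_le {n : ℕ} {ξ : ℝ → Fin n → ℝ} {c : ℝ} (h : ∀ t, 0 ≤ t → ‖ξ t‖ ≤ c) :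
    signalLinf ξ ≤ ENNReal.ofReal c :=
  iSup_le fun i => iSup_le fun t => ENNReal.ofReal_le_ofReal
    ((norm_le_pi_norm (ξ t) i).trans (h t t.2))

namespace L1Design

variable {np k no : ℕ} {d : L1Design np k no} {f f' : ℝ → (Fin np → ℝ) → Fin 2 → ℝ}
  {x₀ : Fin np → ℝ} {x : ℝ → Fin np → ℝ}

lemma IsTrajectory.congr {u u' : ℝ → Fin 2 → ℝ} (h : d.IsTrajectory f x₀ u x)
    (hu : ∀ t, 0 ≤ t → u t = u' t) (hf : ∀ t, 0 ≤ t → f t (x t) = f' t (x t)) :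
    d.IsTrajectory f' x₀ u' x := by
  intro t ht
  obtain ⟨h1, h2⟩ := h t ht
  refine ⟨h1.congr fun τ hτ => ?_, h2.trans ?_⟩
  · rw [Set.uIoc_of_le ht] at hτ
    rw [hu τ hτ.1.le, hf τ hτ.1.le]
  · congr 1
    refine intervalIntegral.integral_congr fun τ hτ => ?_
    rw [Set.uIcc_of_le ht] at hτ
    rw [hu τ hτ.1, hf τ hτ.1]

lemma uref_congr {ω : ℝ → Fin 2 → ℝ} (hf : ∀ t, 0 ≤ t → f t (x t) = f' t (x t)) {t : ℝ}
    (ht : 0 ≤ t) : d.uref f ω x₀ x t = d.uref f' ω x₀ x t := by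
  rw [uref, uref]
  congr 1
  refine tfApply_congr _ ht fun s hs => ?_
  rw [sigmaRef, sigmaRef]
  congr 2
  refine tfApply_congr _ hs.1 fun τ hτ => ?_
  rw [hf τ hτ.1]

lemma IsReference.congr {ω : ℝ → Fin 2 → ℝ} (h : d.IsReference f ω x₀ x)
    (hf : ∀ t, 0 ≤ t → f t (x t) = f' t (x t)) : d.IsReference f' ω x₀ x :=
  IsTrajectory.congr h (fun _ ht => uref_congr hf ht) hf

lemma IsClosedLoop.congr {T : ℝ} {ω : ℝ → Fin 2 → ℝ} (h : d.IsClosedLoop T f ω x₀ x)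
    (hf : ∀ t, 0 ≤ t → f t (x t) = f' t (x t)) : d.IsClosedLoop T f' ω x₀ x :=
  IsTrajectory.congr h (fun _ _ => rfl) hf

/-- The norm condition in terms of real numbers. -/
lemma Admissible.real_normCondition (hd : d.Admissible) (hH₁ : MStable d.H₁) {F : ℝ → ℝ}
    {L₀ Mω ρ₀ γ₁ ρ : ℝ} (hf : IsUncertainty F L₀ f) (hL₀ : 0 ≤ L₀) (hMω : 0 ≤ Mω) (hρ₀ : 0 ≤ ρ₀)
    (hγ₁ : 0 < γ₁) (hρ : 0 < ρ) (h : d.NormCondition F L₀ Mω ρ₀ γ₁ ρ) :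
    (tfL1 d.G).toReal * ((ρ + γ₁) * (max (F (ρ + γ₁)) 0 + matInfNorm d.K) + L₀) +
      (tfL1 ((RatFunc.X : RatFunc ℝ) • d.R - (RatFunc.X : RatFunc ℝ) • (d.H₅ * d.Hin))).toReal * ρ₀ +
      (tfL1 (d.H₂ * tfConst d.Kg)).toReal * Mω < ρ := by
  have hK := matInfNorm_nonneg d.K
  have hB : 0 ≤ (ρ + γ₁) * (max (F (ρ + γ₁)) 0 + matInfNorm d.K) + L₀ := by
    have : 0 ≤ max (F (ρ + γ₁)) 0 := le_max_right _ _
    positivity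
  -- The denominator of `L_ρ` cancels, `L_ρ ρ = (ρ + γ₁) (F + ‖K‖)`. Replacing `F` by its positive
  -- part changes nothing for `np > 0`, and for `np = 0` the matrix `G` has no rows and norm `0`.
  have e1 : tfL1 d.G * ENNReal.ofReal ((ρ + γ₁) * (max (F (ρ + γ₁)) 0 + matInfNorm d.K) + L₀) =
      tfL1 d.G * ENNReal.ofReal (d.Lrho F γ₁ ρ * ρ + L₀) := by
    rcases Nat.eq_zero_or_pos np with rfl | hnp
    · have : tfL1 d.G = 0 := by rw [tfL1, iSup_of_empty]; rfl
      rw [this, zero_mul, zero_mul]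
    · rw [max_eq_left (hf.nonneg (by positivity) ⟨0, hnp⟩), Lrho]
      congr 3
      field_simp
      ring
  have h2 := hd.H₂_proper.mul (MProper.tfConst d.Kg)
  have t1 := tfL1_ne_top hd.G_proper (hd.G_stable hH₁)
  have t2 := tfL1_ne_top h2 ((hd.H₂_stable hH₁).mul (MStable.tfConst d.Kg))
  have t3 := tfL1_ne_top (G := (RatFunc.X : RatFunc ℝ) • d.R -
    (RatFunc.X : RatFunc ℝ) • (d.H₅ * d.Hin))
    (by rw [← smul_sub]; exact hd.initial_strict)
    (by rw [← smul_sub]; exact (hd.initial_stable hH₁).smul_X)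
  rw [NormCondition, rho₁, rho₂, ← e1, ← ENNReal.ofReal_toReal t1, ← ENNReal.ofReal_toReal t2,
    ← ENNReal.ofReal_toReal t3, ← ENNReal.ofReal_mul ENNReal.toReal_nonneg,
    ← ENNReal.ofReal_mul ENNReal.toReal_nonneg, ← ENNReal.ofReal_mul ENNReal.toReal_nonneg,
    ← ENNReal.ofReal_add (by positivity) (by positivity),
    ← ENNReal.ofReal_add (by positivity) (by positivity), ENNReal.ofReal_lt_ofReal_iff hρ] at h
  exact h

end L1Design


end

/-! ### The performance theorem. -/

theorem theorem2 {np k no : ℕ} (d : L1Design np k no) (hd : d.Admissible)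
    (F : ℝ → ℝ) (L₀ Mω ρ₀ ρr γ₁ : ℝ)
    (hMω : 0 < Mω) (hρ₀ : 0 < ρ₀) (hρr : ρ₀ < ρr) (hγ₁ : 0 < γ₁)
    (hH₁ : ∀ i j, RatStable (d.H₁ i j))
    (hCM : ∀ i j, RatProper ((d.Cf * d.M⁻¹) i j))
    (hG : d.NormCondition F L₀ Mω ρ₀ γ₁ ρr)
    (η : ℝ → ℝ) (hη : Tendsto η (𝓝[>] 0) (𝓝 0)) :
    ∃ (Tmax : ℝ) (γx γu : ℝ → ℝ), 0 < Tmax ∧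
      Tendsto γx (𝓝[>] 0) (𝓝 0) ∧ Tendsto γu (𝓝[>] 0) (𝓝 0) ∧
      ∀ Ts : ℝ, 0 < Ts → Ts < Tmax →
        ∀ f : ℝ → (Fin np → ℝ) → Fin 2 → ℝ, IsUncertainty F L₀ f →
        ∀ ω : ℝ → Fin 2 → ℝ, IsCommand Mω Ts (η Ts) ω →
        ∀ x₀ : Fin np → ℝ, ‖x₀‖ < ρ₀ →
          (∃ xref, d.IsReference f ω x₀ xref) ∧
          (∃ x, d.IsClosedLoop Ts f ω x₀ x) ∧
          ∀ xref x : ℝ → Fin np → ℝ,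
            d.IsReference f ω x₀ xref → d.IsClosedLoop Ts f ω x₀ x →
            signalLinf (fun t => xref t - x t) ≤ ENNReal.ofReal (γx Ts) ∧
            signalLinf (fun t => d.uref f ω x₀ xref t - d.uad Ts ω x t) ≤
              ENNReal.ofReal (γu Ts) := by
  -- Without an admissible `f` the claim is vacuous; an admissible `f` supplies `0 ≤ L₀`, and the
  -- sign of `F` in positive dimension.
  by_cases hex : ∃ f : ℝ → (Fin np → ℝ) → Fin 2 → ℝ, IsUncertainty F L₀ f
  swap
  · exact ⟨1, fun _ => 0, fun _ => 0, one_pos, tendsto_const_nhds, tendsto_const_nhds,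
      fun _ _ _ f hf => absurd ⟨f, hf⟩ hex⟩
  obtain ⟨f₀, hf₀⟩ := hex
  have hL₀ : 0 ≤ L₀ := (norm_nonneg _).trans (hf₀.bound 0 le_rfl)
  have hρr0 : 0 < ρr := hρ₀.trans hρr
  have hH₁' : MStable d.H₁ := fun z hz i j => ratStable_iff.1 (hH₁ i j) z hz
  have hCM' : MProper (d.Cf * d.M⁻¹) := fun i j => mem_properRing.2 (hCM i j)
  obtain ⟨T₀, C, hT₀, hC, hperf⟩ := hd.performance hH₁' hCM' (le_max_right (F (ρr + γ₁)) 0) hL₀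
    hMω.le hρ₀ hρr hγ₁ (hd.real_normCondition hH₁' hf₀ hL₀ hMω.le hρ₀.le hγ₁ hρr0 hG)
  -- `η` may be negative; its absolute value serves as the hold error `h` of `performance`, and the
  -- final bounds are `C (T + |η T|)`.
  have hη' : Tendsto (fun T => |η T|) (𝓝[>] 0) (𝓝 0) := by simpa using hη.abs
  obtain ⟨T₁, hT₁, hT₁η⟩ := mem_nhdsGT_iff_exists_Ioo_subset.1 (hη'.eventually (gt_mem_nhds hT₀))
  rw [Set.mem_Ioi] at hT₁
  have hγ : Tendsto (fun T => C * (T + |η T|)) (𝓝[>] 0) (𝓝 0) := by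
    have h := ((tendsto_id.mono_left nhdsWithin_le_nhds).add hη').const_mul C
    simpa using h
  refine ⟨min T₀ T₁, _, _, lt_min hT₀ hT₁, hγ, hγ, fun T hT hTT f hf ω hω x₀ hx₀ => ?_⟩
  obtain ⟨hTT₀, hTT₁⟩ := lt_min_iff.1 hTT
  have hω' : IsCommand Mω T |η T| ω :=
    ⟨hω.measurable, hω.bound, fun t ht => (hω.hold t ht).trans (le_abs_self _)⟩
  have hcl := hf.clamp hρr0.le (lt_add_of_pos_right ρr hγ₁) (le_max_left (F (ρr + γ₁)) 0)
  have hp := hperf T |η T| hT hTT₀ (abs_nonneg _) (hT₁η ⟨hT, hTT₁⟩)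
  -- `performance` is used twice. For the clamped uncertainty it keeps trajectories inside the ball,
  -- where clamping does nothing, so they solve the original problem. For `f` itself it bounds the
  -- difference of arbitrary trajectories.
  obtain ⟨hc₁, hc₂, -⟩ := hp _ _ hcl (fun t ht z₁ z₂ _ _ => hcl.lipschitz (‖z₁‖ + ‖z₂‖ + 1)
    (by positivity) t ht _ _ (by linarith [norm_nonneg z₂]) (by linarith [norm_nonneg z₁]))
    ω hω' x₀ hx₀
  obtain ⟨-, -, hmain⟩ := hp F f hf (fun t ht z₁ z₂ h₁ h₂ =>
    (hf.lipschitz (ρr + γ₁) (by positivity) t ht _ _ (by linarith) (by linarith)).trans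
      (mul_le_mul_of_nonneg_right (le_max_left _ _) (norm_nonneg _))) ω hω' x₀ hx₀
  refine ⟨?_, ?_, fun xref x hxref hx => ?_⟩
  · obtain ⟨x, hx⟩ := hd.exists_reference hH₁' (le_max_right _ _) hcl x₀ hω.trunc_mem
    exact ⟨x, hx.congr fun t ht => by rw [clamp_eq_self (hc₁ x hx t ht).le]⟩
  · obtain ⟨x, hx⟩ := d.exists_closedLoop (le_max_right _ _) hcl x₀ hT ω
    exact ⟨x, hx.congr fun t ht => by rw [clamp_eq_self (hc₂ x hx t ht).le]⟩
  · exact ⟨signalLinf_le fun t ht => (hmain xref x hxref hx t ht).1,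
      signalLinf_le fun t ht => (hmain xref x hxref hx t ht).2⟩
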